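/- An instance of the problems MinCCA and MinRCPT consists of a finite connected simple undirected graph $G$, a root $r\in V(G)$, a finite set $X$ of at least $\Delta(G)+1$ colours, and traversal costs $\mathrm{tc}:X^2\to\mathbb{R}_{\ge 0}$ with $\mathrm{tc}(i,j)=\mathrm{tc}(j,i)$ and $\mathrm{tc}(i,i)=0$ for all $i,j\in X$. A solution consists of a proper edge colouring $\chi:E(G)\to X$ and a spanning tree $T$ of $G$ rooted at $r$. For $v\neq r$ let $P_T(r,v)$ be the path of $T$ from $r$ to $v$. A traversal of a path is an ordered pair $(e,e')$ of consecutive edges of it, and its cost is $\mathrm{tc}(\chi(e),\chi(e'))$. MinCCA asks for a solution that minimises the changeover cost, the sum of the costs of all distinct traversals that occur in at least one of the paths $P_T(r,v)$, $v\ne r$. MinRCPT asks for a solution that minimises the reload cost, the sum over all $v\neq r$ of the costs of all traversals of $P_T(r,v)$. A cut vertex of a connected graph is a vertex whose removal disconnects it, and a block of $G$ is a maximal induced subgraph that is connected and has no cut vertex of its own. **Theorem.** Let $c_1,c_2\in\mathbb{N}$ be constants. MinCCA and MinRCPT are both solvable in polynomial time on the instances in which (a) every cut vertex of $G$ has degree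 at most $c_1$, and (b) $|E(B)|-|V(B)|\le c_2$ for every block $B$ of $G$. That is, for each of the two problems and each pair $(c_1,c_2)$ there are an algorithm and a polynomial $p$ such that the algorithm outputs an optimal solution $(\chi,T)$ of every such instance in time at most $p(N)$, where $N$ is the size of the input. The input is given by the adjacency matrix of $G$, the root $r$, and the $|X|\times|X|$ matrix of traversal costs, together with the numbers $|V(G)|$ and $|X|$. The algorithm runs on a list-processing machine that handles finite binary trees whose leaves are empty or hold one real number; the only operations on real numbers are addition, comparison and the constant $0$. Each elementary operation costs the number of nodes of its operand, and each real number contributes $1$ to that number and to $N$. (In particular, for rational traversal costs written in binary, the time is polynomial on a Turing machine.) -/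

import Mathlib

/-! ## The machine model

Polynomial time is measured on a list-processing (pointer) machine: values are binary trees whose
leaves are `nil` or single real numbers, and a program builds, takes apart and tests such trees.
Real numbers can be added and compared, and nothing else: a program contains no real constant but
`0`, and there is no multiplication or rounding. Every elementary operation is charged the size
of its whole input, so that a computation of cost `t` never holds a tree with more than `t` nodes;
on inputs without real numbers the model is therefore polynomially equivalent to Turing machines.
A number held after `t` steps is a combination of the input numbers with natural coefficients of at
most `t + 1` bits, so on rational inputs written in binary a polynomial bound in this model is also
a polynomial bound on a Turing machine. -/

namespace ReloadCost

/-- Values: binary trees whose leaves are `nil` or a real number. -/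
inductive Data : Type
  | nil : Data
  | real : ℝ → Data
  | pair : Data → Data → Data

namespace Data

/-- The number of nodes; a real number counts as one. -/
def size : Data → ℕ
  | nil => 1
  | real _ => 1
  | pair a b => size a + size b + 1

/-- First component, `nil` on values that are not pairs. -/
def fst : Data → Data
  | pair a _ => a
  | _ => nil

/-- Second component, `nil` on values that are not pairs. -/
def snd : Data → Data
  | pair _ b => b
  | _ => nil

/-- The truth values: `nil` is false; the canonical true value is `pair nil nil`. -/
noncomputable def ofProp (p : Prop) : Data :=
  open Classical in if p then pair nil nil else nil

/-- The sum of a pair of real numbers. -/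
noncomputable def add : Data → Data
  | pair (real x) (real y) => real (x + y)
  | _ => nil

/-- The comparison of a pair of real numbers. -/
noncomputable def le : Data → Data
  | pair (real x) (real y) => ofProp (x ≤ y)
  | _ => nil

/-- A natural number, in unary. -/
def ofNat : ℕ → Data
  | 0 => nil
  | n + 1 => pair nil (ofNat n)

/-- A list, as nested pairs that end in `nil`. -/
def ofList : List Data → Data
  | [] => nil
  | a :: l => pair a (ofList l)

/-- A square matrix, as the list of its rows. -/
def ofMatrix {m : ℕ} (f : Fin m → Fin m → Data) : Data :=
  ofList (List.ofFn fun i => ofList (List.ofFn fun j => f i j))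

end Data

/-- Programs. Each one computes a partial function from values to values. -/
inductive Prog : Type
  | id : Prog
  | nil : Prog
  | zero : Prog
  | fst : Prog
  | snd : Prog
  | add : Prog
  | le : Prog
  | pair : Prog → Prog → Prog
  | comp : Prog → Prog → Prog
  | cond : Prog → Prog → Prog → Prog
  | loop : Prog → Prog → Prog

/-- `Eval c x y t`: the program `c` halts on the input `x` with output `y` at cost `t`.
`comp f g` runs `g` and then `f`; `cond c f g` runs `g` if `c` yields `nil`, and `f` otherwise;
`loop c f` repeats `f` until `c` yields `nil`. -/
inductive Eval : Prog → Data → Data → ℕ → Prop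
  | id (x : Data) : Eval .id x x x.size
  | nil (x : Data) : Eval .nil x .nil x.size
  | zero (x : Data) : Eval .zero x (.real 0) x.size
  | fst (x : Data) : Eval .fst x x.fst x.size
  | snd (x : Data) : Eval .snd x x.snd x.size
  | add (x : Data) : Eval .add x x.add x.size
  | le (x : Data) : Eval .le x x.le x.size
  | pair {f g : Prog} {x y z : Data} {s t : ℕ} :
      Eval f x y s → Eval g x z t → Eval (.pair f g) x (.pair y z) (s + t + 1)
  | comp {f g : Prog} {x y z : Data} {s t : ℕ} :
      Eval g x y s → Eval f y z t → Eval (.comp f g) x z (s + t + 1)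
  | cond_true {c f g : Prog} {x b y : Data} {s t : ℕ} :
      Eval c x b s → b ≠ .nil → Eval f x y t → Eval (.cond c f g) x y (s + t + 1)
  | cond_false {c f g : Prog} {x y : Data} {s t : ℕ} :
      Eval c x .nil s → Eval g x y t → Eval (.cond c f g) x y (s + t + 1)
  | loop_done {c f : Prog} {x : Data} {s : ℕ} :
      Eval c x .nil s → Eval (.loop c f) x x (s + 1)
  | loop_step {c f : Prog} {x b y z : Data} {s t u : ℕ} :
      Eval c x b s → b ≠ .nil → Eval f x y t → Eval (.loop c f) y z u →
      Eval (.loop c f) x z (s + t + u + 1)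

/-! ## Cut vertices and blocks -/

/-- `v` is a cut vertex of `G`: removing it disconnects the graph (for connected `G`). -/
def IsCutVertex {V : Type*} (G : SimpleGraph V) (v : V) : Prop :=
  ¬ (G.induce {v}ᶜ).Preconnected

/-- Connected and without cut vertices. -/
def IsBiconnected {V : Type*} (G : SimpleGraph V) : Prop :=
  G.Connected ∧ ∀ v, ¬ IsCutVertex G v

/-- `B` is the vertex set of a block of `G`: a maximal biconnected induced subgraph. -/
def IsBlock {V : Type*} (G : SimpleGraph V) (B : Set V) : Prop :=
  Maximal (fun S : Set V => IsBiconnected (G.induce S)) B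

/-! ## Instances, solutions and their costs -/

/-- The common instances of the two problems. The vertices are `0, …, n - 1` and the colours are
`0, …, k - 1`. -/
structure Inst where
  /-- the number of vertices -/
  n : ℕ
  /-- the graph -/
  graph : SimpleGraph (Fin n)
  connected : graph.Connected
  /-- the root -/
  root : Fin n
  /-- the number of colours -/
  k : ℕ
  maxDegree_lt : (open Classical in graph.maxDegree + 1) ≤ k
  /-- the traversal costs -/
  tc : Fin k → Fin k → ℝ
  tc_nonneg : ∀ i j, 0 ≤ tc i j
  tc_symm : ∀ i j, tc i j = tc j i
  tc_self : ∀ i, tc i i = 0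

/-- The input: number of vertices, adjacency matrix, root, number of colours, cost matrix. -/
noncomputable def Inst.encode (I : Inst) : Data :=
  .ofList [.ofNat I.n, .ofMatrix fun u v => .ofProp (I.graph.Adj u v), .ofNat I.root, .ofNat I.k,
    .ofMatrix fun i j => .real (I.tc i j)]

/-- Feasible solutions: a proper edge colouring of the graph, that is, a colouring of its line
graph, and a spanning tree. -/
structure Solution (I : Inst) where
  /-- the edge colouring -/
  χ : I.graph.lineGraph.Coloring (Fin I.k)
  /-- the spanning tree -/
  tree : SimpleGraph (Fin I.n)
  tree_le : tree ≤ I.graph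
  isTree : tree.IsTree

namespace Solution

variable {I : Inst}

/-- The output: the matrix whose entry at `(u, v)` says whether `uv` is a tree edge and gives its
colour if `uv` is an edge of the graph, and is `nil` if it is not. -/
noncomputable def encode (s : Solution I) : Data :=
  .ofMatrix fun u v =>
    open Classical in
    if h : I.graph.Adj u v then
      .pair (.ofProp (s.tree.Adj u v)) (.ofNat (s.χ ⟨s(u, v), h⟩))
    else .nil

/-- The path of the tree from the root to `v`. -/
noncomputable def path (s : Solution I) (v : Fin I.n) : s.tree.Walk I.root v :=
  (s.isTree.existsUnique_path I.root v).choose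

/-- The traversals of the tree path from the root to `v`: its pairs of consecutive edges, from the
root on. -/
noncomputable def traversals (s : Solution I) (v : Fin I.n) :
    List (Sym2 (Fin I.n) × Sym2 (Fin I.n)) :=
  (s.path v).edges.zip (s.path v).edges.tail

/-- The cost of a traversal. The value `0` outside the edge set is never used, since tree edges are
edges of the graph. -/
noncomputable def travCost (s : Solution I) (t : Sym2 (Fin I.n) × Sym2 (Fin I.n)) : ℝ :=
  open Classical in
  if h : t.1 ∈ I.graph.edgeSet ∧ t.2 ∈ I.graph.edgeSet then
    I.tc (s.χ ⟨t.1, h.1⟩) (s.χ ⟨t.2, h.2⟩)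
  else 0

/-- The reload cost: each traversal counts once for every path from the root that contains it. -/
noncomputable def reloadCost (s : Solution I) : ℝ :=
  ∑ v ∈ Finset.univ.erase I.root, ((s.traversals v).map s.travCost).sum

/-- The changeover cost: each traversal of a path from the root counts once. -/
noncomputable def changeoverCost (s : Solution I) : ℝ :=
  ∑ t ∈ (Finset.univ.erase I.root).biUnion fun v => (s.traversals v).toFinset, s.travCost t

end Solution

/-! ## Solvability in polynomial time -/

/-- The minimisation of `cost` over the solutions of an instance is solvable in polynomial time on
the instances with the property `P`: one program outputs an optimal solution of each of them, within
a cost bounded by a polynomial in the size of the input. -/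
def SolvableInPolyTime (cost : ∀ {I : Inst}, Solution I → ℝ) (P : Inst → Prop) : Prop :=
  ∃ (c : Prog) (p : Polynomial ℕ), ∀ I : Inst, P I →
    ∃ (s : Solution I) (t : ℕ), Eval c I.encode s.encode t ∧ t ≤ p.eval I.encode.size ∧
      ∀ s' : Solution I, cost s ≤ cost s'

/-- Every cut vertex has degree at most `c₁`, and `|E(B)| - |V(B)| ≤ c₂` for every block `B`. -/
def SparseBlocks (c₁ c₂ : ℕ) (I : Inst) : Prop :=
  (∀ v, IsCutVertex I.graph v → (I.graph.neighborSet v).ncard ≤ c₁) ∧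
  ∀ B, IsBlock I.graph B → ((I.graph.induce B).edgeSet.ncard : ℤ) - B.ncard ≤ c₂

end ReloadCost

namespace ReloadCost

/-! ## Polynomial-time functions -/

/-! The algorithm is dynamic programming over vertex sets with few boundary edges. A solution is
first made local. For every pair `(x, u)` the vertex `x` stores the colour of `xu` and, on tree
edges, the size of the subtree below the edge. A solution then amounts to conditions at single
vertices, together with agreement of the two ends of each edge. At a vertex other than the root,
exactly one label has a nonzero `out`, and it is one more than the sum of all `inn`. Sizes therefore
grow strictly towards the parent, which excludes cycles (`Valid.exists_solution`). The costs are
local as well: a traversal is charged to its middle vertex, with weight 1 for the changeover cost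
and with the size of the subtree below its lower edge for the reload cost (`Describes.itemCost_eq`).

A partial solution on a set `S` thus meets the rest only in the labels on the boundary of `S`, and
one cheapest partial solution for each boundary labelling suffices (`exists_mem_table`). In a
connected graph `S` is determined by its boundary and by whether it contains the root
(`eq_of_bd_eq`). So there are polynomially many keys with at most `W` boundary edges
(`length_table_le`), and no decomposition of the graph has to be computed: all compatible items are
merged, for `n` rounds.

It remains to build the whole vertex set from single vertices by disjoint unions with boundary at
most `W`. If `A` and its complement are connected, all edges between them lie in one block, and
counting the edges of that block bounds their number by `c₂ + 2` (`card_bd_le`). This bounds the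
degree of every vertex that is not a cut vertex; `c₁` bounds the others. From a connected set `S`
with connected complement, remove a suitable vertex `v`. The components of the remainder are sets of
the same kind, and they can be glued to `v` one by one, with every boundary inside that of `S` or
that of `v` (`derivable_of_conn`).

Vizing's theorem provides a feasible solution, so that an optimal one can be output
(`nonempty_solution`). The running time follows from closure properties of `PolyTime`, where bounded
folds play the role of loops. -/

/-- Types whose elements are represented as values of the machine. -/
class Enc (α : Type) where
  /-- the representation -/
  enc : α → Data

open Enc (enc)

/-- The size of the representation. -/
def sz {α : Type} [Enc α] (a : α) : ℕ := (enc a).size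

instance : Enc Unit := ⟨fun _ => .nil⟩
instance : Enc ℕ := ⟨Data.ofNat⟩
instance : Enc Bool := ⟨fun b => if b then .pair .nil .nil else .nil⟩
instance : Enc ℝ := ⟨Data.real⟩
instance {α β : Type} [Enc α] [Enc β] : Enc (α × β) := ⟨fun x => .pair (enc x.1) (enc x.2)⟩
instance {α : Type} [Enc α] : Enc (List α) := ⟨fun l => Data.ofList (l.map enc)⟩
instance {α : Type} [Enc α] : Enc (Option α) := ⟨fun o => o.elim .nil enc⟩
instance {α : Type} [Enc α] (P : α → Prop) : Enc {a // P a} := ⟨fun a => enc a.1⟩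

/-! ### Sizes of encodings -/

section Size

variable {α β : Type} [Enc α] [Enc β]

lemma enc_cons (a : α) (l : List α) : enc (a :: l) = .pair (enc a) (enc l) := rfl

@[simp] lemma sz_pair (a : α) (b : β) : sz (a, b) = sz a + sz b + 1 := rfl
@[simp] lemma sz_nil : sz ([] : List α) = 1 := rfl
@[simp] lemma sz_cons (a : α) (l : List α) : sz (a :: l) = sz a + sz l + 1 := rfl
@[simp] lemma sz_real (x : ℝ) : sz x = 1 := rfl
@[simp] lemma sz_subtype {P : α → Prop} (a : {a // P a}) : sz a = sz a.1 := rfl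

@[simp] lemma sz_nat (n : ℕ) : sz n = 2 * n + 1 := by
  induction n with
  | zero => rfl
  | succ n ih =>
    have : sz (n + 1) = 1 + sz n + 1 := rfl
    omega

lemma one_le_size (x : Data) : 1 ≤ x.size := by cases x <;> simp [Data.size]

lemma one_le_sz (a : α) : 1 ≤ sz a := one_le_size _

lemma length_le_sz (l : List α) : l.length ≤ sz l := by
  induction l with
  | nil => simp
  | cons a l ih => simp; omega

lemma sz_append (l l' : List α) : sz (l ++ l') + 1 = sz l + sz l' := by
  induction l with
  | nil => simp; omega
  | cons a l ih => simp; omega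

lemma sz_le_of_mem {l : List α} {a : α} (h : a ∈ l) : sz a ≤ sz l := by
  induction l with
  | nil => simp at h
  | cons b l ih =>
    rcases List.mem_cons.1 h with rfl | h
    · simp; omega
    · have := ih h; simp; omega

lemma sz_list_le {l : List α} {B : ℕ} (h : ∀ a ∈ l, sz a ≤ B) :
    sz l ≤ l.length * (B + 1) + 1 := by
  induction l with
  | nil => simp
  | cons b l ih =>
    have h1 := ih fun a ha => h a (List.mem_cons_of_mem _ ha)
    have h2 := h b List.mem_cons_self
    simp [add_mul] at *; omega

lemma sz_le_of_suffix {l l' : List α} (h : l <:+ l') : sz l ≤ sz l' := by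
  obtain ⟨t, rfl⟩ := h
  have := sz_append t l; have := one_le_sz t; omega

lemma sz_le_of_sublist {l l' : List α} (h : l.Sublist l') : sz l ≤ sz l' := by
  induction h with
  | slnil => simp
  | cons a h ih => simp; omega
  | cons_cons a h ih => simp; omega

end Size

lemma size_fst_le (x : Data) : x.fst.size ≤ x.size := by
  cases x <;> simp [Data.size, Data.fst]; omega

lemma size_snd_le (x : Data) : x.snd.size ≤ x.size := by
  cases x <;> simp [Data.size, Data.snd]; omega

lemma size_add_le (x : Data) : x.add.size ≤ x.size := by
  rcases x with _ | _ | ⟨_ | _ | _, _ | _ | _⟩ <;> simp [Data.size, Data.add]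

lemma size_le_le (x : Data) : x.le.size ≤ x.size := by
  rcases x with _ | _ | ⟨_ | _ | _, _ | _ | _⟩ <;> simp [Data.size, Data.le, Data.ofProp]
  split <;> simp [Data.size]

/-- Every elementary operation pays for its whole input and none returns more than it reads. Time
bounds are therefore also bounds for output sizes, which is what makes them compose. -/
lemma Eval.size_le {c : Prog} {x y : Data} {t : ℕ} (h : Eval c x y t) :
    x.size ≤ t ∧ y.size ≤ t := by
  induction h with
  | id x => simp
  | nil x => exact ⟨le_rfl, one_le_size x⟩
  | zero x => exact ⟨le_rfl, one_le_size x⟩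
  | fst x => exact ⟨le_rfl, size_fst_le x⟩
  | snd x => exact ⟨le_rfl, size_snd_le x⟩
  | add x => exact ⟨le_rfl, size_add_le x⟩
  | le x => exact ⟨le_rfl, size_le_le x⟩
  | pair _ _ ih₁ ih₂ => simp only [Data.size]; omega
  | comp _ _ ih₁ ih₂ => omega
  | cond_true _ _ _ ih₁ ih₂ => omega
  | cond_false _ _ ih₁ ih₂ => omega
  | loop_done _ ih => omega
  | loop_step _ _ _ _ ih₁ ih₂ ih₃ => omega

/-- `f` is computed by a program in polynomial time. -/
@[fun_prop]
def PolyTime {α β : Type} [Enc α] [Enc β] (f : α → β) : Prop :=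
  ∃ (c : Prog) (p : Polynomial ℕ), ∀ a, ∃ t, Eval c (enc a) (enc (f a)) t ∧ t ≤ p.eval (sz a)

lemma eval_mono (p : Polynomial ℕ) {m n : ℕ} (h : m ≤ n) : p.eval m ≤ p.eval n := by
  rw [Polynomial.eval_eq_sum, Polynomial.eval_eq_sum]
  exact Finset.sum_le_sum fun i _ => Nat.mul_le_mul_left _ (Nat.pow_le_pow_left h i)

/-- `f` is bounded by a polynomial in the size of its argument. -/
def PolyBdd {α : Type} [Enc α] (f : α → ℕ) : Prop :=
  ∃ p : Polynomial ℕ, ∀ a, f a ≤ p.eval (sz a)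

namespace PolyBdd

variable {α β : Type} [Enc α] [Enc β] {f g : α → ℕ}

lemma mono (hg : PolyBdd g) (h : ∀ a, f a ≤ g a) : PolyBdd f :=
  hg.imp fun _ hp a => (h a).trans (hp a)

lemma const (n : ℕ) : PolyBdd fun _ : α => n := ⟨.C n, by simp⟩

lemma size : PolyBdd fun a : α => sz a := ⟨.X, by simp⟩

lemma add (hf : PolyBdd f) (hg : PolyBdd g) : PolyBdd fun a => f a + g a := by
  obtain ⟨p, hp⟩ := hf
  obtain ⟨q, hq⟩ := hg
  exact ⟨p + q, fun a => by simpa using Nat.add_le_add (hp a) (hq a)⟩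

lemma mul (hf : PolyBdd f) (hg : PolyBdd g) : PolyBdd fun a => f a * g a := by
  obtain ⟨p, hp⟩ := hf
  obtain ⟨q, hq⟩ := hg
  exact ⟨p * q, fun a => by simpa using Nat.mul_le_mul (hp a) (hq a)⟩

lemma pow (hf : PolyBdd f) (n : ℕ) : PolyBdd fun a => f a ^ n := by
  obtain ⟨p, hp⟩ := hf
  exact ⟨p ^ n, fun a => by simpa using Nat.pow_le_pow_left (hp a) n⟩

lemma eval (hf : PolyBdd f) (p : Polynomial ℕ) : PolyBdd fun a => p.eval (f a) := by
  obtain ⟨q, hq⟩ := hf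
  exact ⟨p.comp q, fun a => by simpa using eval_mono p (hq a)⟩

end PolyBdd

/-! ### Closure under composition, branching and bounded folds -/

namespace PolyTime

variable {α β γ δ σ : Type} [Enc α] [Enc β] [Enc γ] [Enc δ] [Enc σ]

lemma sz_bdd {f : α → β} (hf : PolyTime f) : PolyBdd fun a => sz (f a) := by
  obtain ⟨c, p, h⟩ := hf
  refine ⟨p, fun a => ?_⟩
  obtain ⟨t, ht, hp⟩ := h a
  exact ht.size_le.2.trans hp

/-- A function computed by an elementary operation. -/
lemma of_eval {f : α → β} (c : Prog) (h : ∀ a, Eval c (enc a) (enc (f a)) (sz a)) :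
    PolyTime f := ⟨c, .X, fun a => ⟨_, h a, by simp⟩⟩

/-- For maps that only change the type under which a value is read; the identity program computes
them. -/
lemma of_enc_eq {f : α → β} (h : ∀ a, enc (f a) = enc a) : PolyTime f :=
  of_eval .id fun a => by rw [h]; exact .id _

@[fun_prop]
lemma id : PolyTime fun a : α => a := of_enc_eq fun _ => rfl

@[fun_prop]
lemma comp {g : β → γ} {f : α → β} (hg : PolyTime g) (hf : PolyTime f) :
    PolyTime fun a => g (f a) := by
  obtain ⟨c, p, hf⟩ := hf
  obtain ⟨d, q, hg⟩ := hg
  refine ⟨.comp d c, p + q.comp p + 1, fun a => ?_⟩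
  obtain ⟨s, hs, hsp⟩ := hf a
  obtain ⟨t, ht, htq⟩ := hg (f a)
  refine ⟨_, .comp hs ht, ?_⟩
  have := htq.trans (eval_mono q (hs.size_le.2.trans hsp))
  simp only [Polynomial.eval_add, Polynomial.eval_comp, Polynomial.eval_one]
  omega

@[fun_prop]
lemma prodMk {f : α → β} {g : α → γ} (hf : PolyTime f) (hg : PolyTime g) :
    PolyTime fun a => (f a, g a) := by
  obtain ⟨c, p, hf⟩ := hf
  obtain ⟨d, q, hg⟩ := hg
  refine ⟨.pair c d, p + q + 1, fun a => ?_⟩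
  obtain ⟨s, hs, hsp⟩ := hf a
  obtain ⟨t, ht, htq⟩ := hg a
  refine ⟨_, .pair hs ht, ?_⟩
  simp only [Polynomial.eval_add, Polynomial.eval_one]
  omega

lemma fst' : PolyTime fun x : α × β => x.1 := of_eval .fst fun a => .fst (enc a)

lemma snd' : PolyTime fun x : α × β => x.2 := of_eval .snd fun a => .snd (enc a)

@[fun_prop]
lemma fst {f : α → β × γ} (hf : PolyTime f) : PolyTime fun a => (f a).1 := fst'.comp hf

@[fun_prop]
lemma snd {f : α → β × γ} (hf : PolyTime f) : PolyTime fun a => (f a).2 := snd'.comp hf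

@[fun_prop]
lemma val {P : β → Prop} {f : α → {b // P b}} (hf : PolyTime f) : PolyTime fun a => (f a).1 :=
  hf

/-- Subtypes carry no data. They express promises on the input, such as a nonempty list or bounded
degrees. -/
lemma mk {P : β → Prop} {f : α → {b // P b}} (hf : PolyTime fun a => (f a).1) : PolyTime f :=
  hf

lemma enc_eq_nil : PolyTime fun _ : α => () := of_eval .nil fun a => .nil (enc a)

@[fun_prop]
lemma const_nat (n : ℕ) : PolyTime fun _ : α => n := by
  induction n with
  | zero => exact of_eval .nil fun a => .nil (enc a)
  | succ n ih => exact (enc_eq_nil.prodMk ih : PolyTime fun _ : α => ((), n))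

@[fun_prop]
lemma const_nil : PolyTime fun _ : α => ([] : List β) := of_eval .nil fun a => .nil (enc a)

@[fun_prop]
lemma const_none : PolyTime fun _ : α => (none : Option β) := of_eval .nil fun a => .nil (enc a)

@[fun_prop]
lemma const_false : PolyTime fun _ : α => false := of_eval .nil fun a => .nil (enc a)

@[fun_prop]
lemma const_true : PolyTime fun _ : α => true :=
  (const_false.prodMk const_false : PolyTime fun _ : α => (false, false))

@[fun_prop]
lemma const_zero : PolyTime fun _ : α => (0 : ℝ) := of_eval .zero fun a => .zero (enc a)

@[fun_prop]
lemma some {f : α → β} (hf : PolyTime f) : PolyTime fun a => Option.some (f a) := hf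

@[fun_prop]
lemma cons {f : α → β} {g : α → List β} (hf : PolyTime f) (hg : PolyTime g) :
    PolyTime fun a => f a :: g a := hf.prodMk hg

@[fun_prop]
lemma cond {b : α → Bool} {f g : α → β} (hb : PolyTime b) (hf : PolyTime f)
    (hg : PolyTime g) : PolyTime fun a => bif b a then f a else g a := by
  obtain ⟨c, p, hb⟩ := hb
  obtain ⟨d, q, hf⟩ := hf
  obtain ⟨e, r, hg⟩ := hg
  refine ⟨.cond c d e, p + q + r + 1, fun a => ?_⟩
  obtain ⟨s, hs, hsp⟩ := hb a
  obtain ⟨t, ht, htq⟩ := hf a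
  obtain ⟨u, hu, hur⟩ := hg a
  simp only [Polynomial.eval_add, Polynomial.eval_one]
  cases h : b a
  · rw [h] at hs
    exact ⟨_, .cond_false hs hu, by omega⟩
  · rw [h] at hs
    exact ⟨_, .cond_true hs (by simp [enc]) ht, by omega⟩

@[fun_prop]
lemma and {f g : α → Bool} (hf : PolyTime f) (hg : PolyTime g) :
    PolyTime fun a => f a && g a := by
  have : (fun a => f a && g a) = fun a => bif f a then g a else false := by
    ext a; cases f a <;> rfl
  rw [this]; exact cond hf hg const_false

@[fun_prop]
lemma or {f g : α → Bool} (hf : PolyTime f) (hg : PolyTime g) :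
    PolyTime fun a => f a || g a := by
  have : (fun a => f a || g a) = fun a => bif f a then true else g a := by
    ext a; cases f a <;> rfl
  rw [this]; exact cond hf const_true hg

@[fun_prop]
lemma not {f : α → Bool} (hf : PolyTime f) : PolyTime fun a => !f a := by
  have : (fun a => !f a) = fun a => bif f a then false else true := by
    ext a; cases f a <;> rfl
  rw [this]; exact cond hf const_false const_true

@[fun_prop]
lemma isEmpty {l : α → List β} (hl : PolyTime l) : PolyTime fun a => (l a).isEmpty := by
  suffices h : PolyTime fun l : List β => l.isEmpty from h.comp hl
  refine ⟨.cond .id .nil (.pair .nil .nil), 4 * .X + 2, fun l => ?_⟩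
  cases l with
  | nil => exact ⟨_, .cond_false (.id _) (.pair (.nil _) (.nil _)), by
      simp [enc, Data.ofList, Data.size]⟩
  | cons b l => exact ⟨_, .cond_true (.id _) (by simp [enc, Data.ofList]) (.nil _), by
      change sz (b :: l) + sz (b :: l) + 1 ≤ _; simp; omega⟩

@[fun_prop]
lemma tail {l : α → List β} (hl : PolyTime l) : PolyTime fun a => (l a).tail := by
  suffices h : PolyTime fun l : List β => l.tail from h.comp hl
  refine of_eval .snd fun l => ?_
  cases l with
  | nil => exact .snd _
  | cons b l => exact .snd (enc (b :: l))

lemma head : PolyTime fun l : {l : List β // l ≠ []} => l.1.head l.2 := by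
  refine of_eval .fst fun ⟨l, hl⟩ => ?_
  cases l with
  | nil => exact absurd rfl hl
  | cons b l => exact .fst (enc (b :: l))

@[fun_prop]
lemma headD {l : α → List β} {d : α → β} (hl : PolyTime l) (hd : PolyTime d) :
    PolyTime fun a => (l a).headD (d a) := by
  suffices h : PolyTime fun x : List β × β => x.1.headD x.2 from h.comp (hl.prodMk hd)
  refine ⟨.cond .fst (.comp .fst .fst) .snd, 4 * .X + 2, fun ⟨l, d⟩ => ?_⟩
  cases l with
  | nil => exact ⟨_, .cond_false (.fst _) (.snd _), by
      change sz (([] : List β), d) + sz (([] : List β), d) + 1 ≤ _; simp; omega⟩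
  | cons b l => exact ⟨_, .cond_true (.fst _) (by simp [enc, Data.ofList, Data.fst])
      (.comp (.fst _) (.fst _)), by
      change sz (b :: l, d) + (sz (b :: l, d) + sz (b :: l) + 1) + 1 ≤ _; simp; omega⟩

/-- The sequence `X` of states plays the role of a loop invariant; the factor `m + 1` also counts
the final, failing test. -/
lemma eval_loop {c f : Prog} {X : ℕ → Data} {m b : ℕ}
    (h : ∀ i < m, ∃ y s t, Eval c (X i) y s ∧ y ≠ .nil ∧ Eval f (X i) (X (i + 1)) t ∧
      s + t + 1 ≤ b)
    (hm : ∃ s, Eval c (X m) .nil s ∧ s + 1 ≤ b) :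
    ∃ t, Eval (.loop c f) (X 0) (X m) t ∧ t ≤ (m + 1) * b := by
  induction m generalizing X with
  | zero =>
    obtain ⟨s, hs, hb⟩ := hm
    exact ⟨_, .loop_done hs, by simpa using hb⟩
  | succ m ih =>
    obtain ⟨y, s, t, hs, hy, ht, hb⟩ := h 0 (by omega)
    obtain ⟨u, hu, hub⟩ := ih (X := fun i => X (i + 1)) (fun i hi => h (i + 1) (by omega)) hm
    refine ⟨_, .loop_step hs hy ht hu, ?_⟩
    rw [add_mul (m + 1)]
    omega

/-- Folds over lists, when the intermediate states have polynomial size. -/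
lemma foldl_of_bdd {l : α → List β} {init : α → σ} {step : α → σ → β → σ}
    (hl : PolyTime l) (hinit : PolyTime init)
    (hstep : PolyTime fun x : α × σ × β => step x.1 x.2.1 x.2.2)
    {B : α → ℕ} (hB : PolyBdd B)
    (hbd : ∀ a, ∀ l', l' <+: l a → sz (l'.foldl (step a) (init a)) ≤ B a) :
    PolyTime fun a => (l a).foldl (step a) (init a) := by
  -- The state consists of the argument, the rest of the list and the accumulator. The promise of a
  -- nonempty rest lets the body take the head without a default value.
  let body : {x : α × List β × σ // x.2.1 ≠ []} → α × List β × σ := fun x =>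
    (x.1.1, x.1.2.1.tail, step x.1.1 x.1.2.2 (x.1.2.1.head x.2))
  have hbody : PolyTime body := by
    refine prodMk (fst (val id)) (prodMk (tail (fst (snd (val id)))) ?_)
    refine hstep.comp (f := fun x : {x : α × List β × σ // x.2.1 ≠ []} =>
      (x.1.1, x.1.2.2, x.1.2.1.head x.2)) ?_
    refine prodMk (fst (val id)) (prodMk (snd (snd (val id))) ?_)
    exact head.comp (f := fun x : {x : α × List β × σ // x.2.1 ≠ []} =>
      (⟨x.1.2.1, x.2⟩ : {l : List β // l ≠ []})) (mk (fst (snd (val id))))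
  have hcnd : PolyTime fun x : α × List β × σ => x.2.1 := fst (snd id)
  obtain ⟨pB, hpB⟩ := hB
  obtain ⟨pl, hpl⟩ : ∃ p : Polynomial ℕ, ∀ a, sz (l a) ≤ p.eval (sz a) := hl.sz_bdd
  obtain ⟨c, p, hc⟩ := hcnd
  obtain ⟨f, q, hf⟩ := hbody
  let R : Polynomial ℕ := .X + pl + pB + 2
  -- The size bound is known only for states that are reachable from an initial one, so the domain
  -- of the loop is restricted to initial states.
  have hloop : PolyTime fun x : {x : α × List β × σ // ∃ a, x = (a, l a, init a)} =>
      (x.1.1, ([] : List β), (l x.1.1).foldl (step x.1.1) (init x.1.1)) := by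
    refine ⟨.loop c f, (pl + 1) * (p.comp R + q.comp R + 1), ?_⟩
    rintro ⟨_, a, rfl⟩
    let Y : ℕ → α × List β × σ := fun i =>
      (a, (l a).drop i, ((l a).take i).foldl (step a) (init a))
    have hY : ∀ i, sz (Y i) ≤ R.eval (sz a) := fun i => by
      have h1 := hbd a _ (List.take_prefix i (l a))
      have h2 := sz_le_of_suffix (List.drop_suffix i (l a))
      have h3 := hpl a
      have h4 := hpB a
      simp only [Y, sz_pair, R, Polynomial.eval_add, Polynomial.eval_X, Polynomial.eval_ofNat]
      omega
    have hp : ∀ i, p.eval (sz (Y i)) ≤ (p.comp R).eval (sz a) := fun i => by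
      rw [Polynomial.eval_comp]; exact eval_mono p (hY i)
    have hq : ∀ i, q.eval (sz (Y i)) ≤ (q.comp R).eval (sz a) := fun i => by
      rw [Polynomial.eval_comp]; exact eval_mono q (hY i)
    have key := eval_loop (c := c) (f := f) (X := fun i => enc (Y i)) (m := (l a).length)
      (b := (p.comp R).eval (sz a) + (q.comp R).eval (sz a) + 1) ?_ ?_
    · obtain ⟨t, ht, htb⟩ := key
      refine ⟨t, ?_, htb.trans ?_⟩
      · change Eval _ (enc (a, l a, init a)) _ _
        simpa [Y] using ht
      · have hle : sz a ≤ sz ((a, l a, init a) : α × List β × σ) := by simp; omega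
        have h1 := (length_le_sz (l a)).trans (hpl a)
        have h2 := eval_mono (p.comp R + q.comp R + 1) hle
        have h3 := eval_mono pl hle
        simp only [Polynomial.eval_mul, Polynomial.eval_add, Polynomial.eval_one, sz_subtype] at *
        exact Nat.mul_le_mul (by omega) (by omega)
    · intro i hi
      have hne : (Y i).2.1 ≠ [] := by simp [Y]; omega
      obtain ⟨s, hs, hsp⟩ := hc (Y i)
      obtain ⟨t, ht, htq⟩ := hf ⟨Y i, hne⟩
      have hbd : body ⟨Y i, hne⟩ = Y (i + 1) := by
        simp only [body, Y, List.tail_drop, List.head_drop, List.take_add_one,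
          List.foldl_append, List.getElem?_eq_getElem hi]
        simp
      rw [hbd] at ht
      have hnil : ∀ l : List β, l ≠ [] → enc l ≠ .nil := fun l => by
        cases l <;> simp [enc, Data.ofList]
      refine ⟨_, s, t, hs, hnil _ hne, ht, ?_⟩
      · have := hp i; have := hq i; simp only [sz_subtype] at htq; omega
    · obtain ⟨s, hs, hsp⟩ := hc (Y (l a).length)
      refine ⟨s, ?_, ?_⟩
      · simpa [Y, enc, Data.ofList] using hs
      · have := hp (l a).length; omega
  exact snd (snd (hloop.comp (f := fun a =>
    (⟨(a, l a, init a), a, rfl⟩ : {x : α × List β × σ // ∃ a, x = (a, l a, init a)}))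
    (mk (prodMk id (prodMk hl hinit)))))

end PolyTime
-- Unary numbers are literally lists of units, so arithmetic on natural numbers reduces to list
-- operations.
lemma enc_nat (n : ℕ) : enc n = enc (List.replicate n ()) := by
  induction n with
  | zero => rfl
  | succ n ih =>
    rw [List.replicate_succ, enc_cons, ← ih]
    rfl

/-- The comparison of real numbers. -/
noncomputable def leB (x y : ℝ) : Bool := open Classical in decide (x ≤ y)

lemma leB_iff {x y : ℝ} : leB x y = true ↔ x ≤ y := by simp [leB]

/-! ### Lists, natural numbers and real numbers -/

namespace PolyTime

variable {α β γ δ σ : Type} [Enc α] [Enc β] [Enc γ] [Enc δ] [Enc σ]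

/-- Folds over lists, when each step adds a polynomial amount to the state. -/
lemma foldl_of_add {l : α → List β} {init : α → σ} {step : α → σ → β → σ}
    (hl : PolyTime l) (hinit : PolyTime init)
    (hstep : PolyTime fun x : α × σ × β => step x.1 x.2.1 x.2.2)
    {q : α × β → ℕ} (hq : PolyBdd q)
    (hadd : ∀ a s b, b ∈ l a → sz (step a s b) ≤ sz s + q (a, b)) :
    PolyTime fun a => (l a).foldl (step a) (init a) := by
  obtain ⟨p, hp⟩ := hq
  refine foldl_of_bdd hl hinit hstep
    (B := fun a => sz (init a) + sz (l a) * p.eval (sz a + sz (l a) + 1))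
    (hinit.sz_bdd.add (hl.sz_bdd.mul (((PolyBdd.size.add hl.sz_bdd).add (.const 1)).eval p))) ?_
  intro a l' hl'
  suffices h : ∀ l' : List β, (∀ b ∈ l', b ∈ l a) → ∀ s, sz (l'.foldl (step a) s) ≤
      sz s + l'.length * p.eval (sz a + sz (l a) + 1) by
    refine (h l' (fun b hb => hl'.subset hb) _).trans ?_
    have := hl'.length_le
    have := length_le_sz (l a)
    gcongr
    omega
  intro l'
  induction l' with
  | nil => simp
  | cons b l' ih =>
    intro hmem s
    have h1 := ih (fun b hb => hmem b (List.mem_cons_of_mem _ hb)) (step a s b)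
    have h2 := hadd a s b (hmem b List.mem_cons_self)
    have h3 := hp (a, b)
    have h4 := eval_mono p (m := sz (a, b)) (n := sz a + sz (l a) + 1) (by
      have := sz_le_of_mem (hmem b List.mem_cons_self)
      simp; omega)
    simp only [List.foldl_cons, List.length_cons, add_mul]
    omega

/-- Folds over lists, when each step does not increase the state. -/
lemma foldl_of_le {l : α → List β} {init : α → σ} {step : α → σ → β → σ}
    (hl : PolyTime l) (hinit : PolyTime init)
    (hstep : PolyTime fun x : α × σ × β => step x.1 x.2.1 x.2.2)
    (hle : ∀ a s b, sz (step a s b) ≤ sz s) :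
    PolyTime fun a => (l a).foldl (step a) (init a) :=
  foldl_of_add hl hinit hstep (PolyBdd.const 0) fun a s b _ => by simpa using hle a s b

@[fun_prop]
lemma reverse {l : α → List β} (hl : PolyTime l) : PolyTime fun a => (l a).reverse := by
  have : (fun a => (l a).reverse) = fun a => (l a).foldl (fun s b => b :: s) [] := by
    ext1 a; simp
  rw [this]
  refine foldl_of_add (q := fun x => sz x.2 + 1) hl const_nil (by fun_prop)
    ((sz_bdd (by fun_prop)).add (.const 1)) fun a s b _ => ?_
  simp; omega

@[fun_prop]
lemma append {l l' : α → List β} (hl : PolyTime l) (hl' : PolyTime l') :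
    PolyTime fun a => l a ++ l' a := by
  have : (fun a => l a ++ l' a) = fun a => (l a).reverse.foldl (fun s b => b :: s) (l' a) := by
    ext1 a; simp
  rw [this]
  refine foldl_of_add (q := fun x => sz x.2 + 1) (reverse hl) hl' (by fun_prop)
    ((sz_bdd (by fun_prop)).add (.const 1)) fun a s b _ => ?_
  simp; omega

@[fun_prop]
lemma flatMap {l : α → List β} {g : α → β → List γ} (hl : PolyTime l)
    (hg : PolyTime fun x : α × β => g x.1 x.2) :
    PolyTime fun a => (l a).flatMap fun b => g a b := by
  have : (fun a => (l a).flatMap fun b => g a b) =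
      fun a => (l a).foldl (fun s b => s ++ g a b) [] := by
    ext1 a
    have h : ∀ (l : List β) s, l.foldl (fun s b => s ++ g a b) s = s ++ l.flatMap fun b => g a b :=
      fun l => by induction l <;> simp_all
    simp [h]
  rw [this]
  refine foldl_of_add (q := fun x => sz (g x.1 x.2)) hl const_nil ?_ hg.sz_bdd fun a s b _ => ?_
  · have h : PolyTime fun x : α × List γ × β => g x.1 x.2.2 :=
      hg.comp (f := fun x : α × List γ × β => (x.1, x.2.2)) (by fun_prop)
    fun_prop
  · have := sz_append s (g a b)
    dsimp only
    omega

@[fun_prop]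
lemma map {l : α → List β} {g : α → β → γ} (hl : PolyTime l)
    (hg : PolyTime fun x : α × β => g x.1 x.2) :
    PolyTime fun a => (l a).map fun b => g a b := by
  have : (fun a => (l a).map fun b => g a b) = fun a => (l a).flatMap fun b => [g a b] := by
    ext1 a; induction l a <;> simp_all
  rw [this]
  exact flatMap hl (cons hg const_nil)

@[fun_prop]
lemma filter {l : α → List β} {g : α → β → Bool} (hl : PolyTime l)
    (hg : PolyTime fun x : α × β => g x.1 x.2) :
    PolyTime fun a => (l a).filter fun b => g a b := by
  have : (fun a => (l a).filter fun b => g a b) =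
      fun a => (l a).flatMap fun b => bif g a b then [b] else [] := by
    ext1 a
    induction l a with
    | nil => rfl
    | cons b l ih => rw [List.filter_cons, List.flatMap_cons, ← ih]; cases g a b <;> simp
  rw [this]
  exact flatMap hl (cond hg (cons (snd id) const_nil) const_nil)

@[fun_prop]
lemma all {l : α → List β} {g : α → β → Bool} (hl : PolyTime l)
    (hg : PolyTime fun x : α × β => g x.1 x.2) :
    PolyTime fun a => (l a).all fun b => g a b := by
  have : (fun a => (l a).all fun b => g a b) =
      fun a => ((l a).filter fun b => !g a b).isEmpty := by
    ext1 a
    rw [Bool.eq_iff_iff]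
    simp [List.filter_eq_nil_iff]
  rw [this]
  exact isEmpty (filter hl (not hg))

@[fun_prop]
lemma any {l : α → List β} {g : α → β → Bool} (hl : PolyTime l)
    (hg : PolyTime fun x : α × β => g x.1 x.2) :
    PolyTime fun a => (l a).any fun b => g a b := by
  simp only [List.any_eq_not_all_not]
  exact not (all hl (not hg))

lemma toUnits : PolyTime fun n : ℕ => List.replicate n () := of_enc_eq fun n => (enc_nat n).symm

@[fun_prop]
lemma length {l : α → List β} (hl : PolyTime l) : PolyTime fun a => (l a).length := by
  have h : PolyTime fun a => (l a).map fun _ => () := map hl enc_eq_nil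
  obtain ⟨c, p, hc⟩ := h
  refine ⟨c, p, fun a => ?_⟩
  rw [enc_nat]
  simpa [List.map_const'] using hc a

@[fun_prop]
lemma natAdd {f g : α → ℕ} (hf : PolyTime f) (hg : PolyTime g) : PolyTime fun a => f a + g a := by
  simpa using length (append (toUnits.comp hf) (toUnits.comp hg))

@[fun_prop]
lemma natSub {f g : α → ℕ} (hf : PolyTime f) (hg : PolyTime g) : PolyTime fun a => f a - g a := by
  have h : (fun a => f a - g a) = fun a => (List.foldl (fun s (_ : Unit) => s.tail)
      (List.replicate (f a) ()) (List.replicate (g a) ())).length := by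
    ext a
    have : ∀ m n, (List.foldl (fun s (_ : Unit) => s.tail)
        (List.replicate n ()) (List.replicate m ())).length = n - m := by
      intro m
      induction m with
      | zero => simp
      | succ m ih => intro n; simp [List.replicate_succ, ih]; omega
    exact (this _ _).symm
  rw [h]
  refine length (foldl_of_le (toUnits.comp hg) (toUnits.comp hf) (by fun_prop) fun a s b => ?_)
  exact sz_le_of_suffix (List.tail_suffix s)

@[fun_prop]
lemma natLe {f g : α → ℕ} (hf : PolyTime f) (hg : PolyTime g) :
    PolyTime fun a => decide (f a ≤ g a) := by
  have : (fun a => decide (f a ≤ g a)) =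
      fun a => (List.replicate (f a - g a) ()).isEmpty := by
    ext a
    rw [Bool.eq_iff_iff]
    simp [Nat.sub_eq_zero_iff_le]
  rw [this]
  exact isEmpty (toUnits.comp (natSub hf hg))

@[fun_prop]
lemma natEq {f g : α → ℕ} (hf : PolyTime f) (hg : PolyTime g) :
    PolyTime fun a => decide (f a = g a) := by
  have : (fun a => decide (f a = g a)) = fun a => decide (f a ≤ g a) && decide (g a ≤ f a) := by
    ext a
    rw [Bool.eq_iff_iff]
    simp [le_antisymm_iff]
  rw [this]
  fun_prop

@[fun_prop]
lemma range {f : α → ℕ} (hf : PolyTime f) : PolyTime fun a => List.range (f a) := by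
  suffices h : PolyTime List.range from h.comp hf
  have : List.range = fun n => (List.replicate n ()).foldl (fun s _ => s ++ [s.length]) [] := by
    ext1 n
    induction n with
    | zero => rfl
    | succ n ih => rw [List.range_succ, List.replicate_succ', List.foldl_append, ← ih]; simp
  rw [this]
  -- Each entry is at most `n` and so has size at most `2 * n + 1`; one more node links it into the
  -- list.
  refine foldl_of_bdd (B := fun n => n * (2 * n + 2) + 1) toUnits const_nil (by fun_prop)
    ⟨.X * (2 * .X + 2) + 1, fun n => ?_⟩ fun n l' hl' => ?_
  · simp only [Polynomial.eval_add, Polynomial.eval_mul, Polynomial.eval_X, Polynomial.eval_ofNat,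
      Polynomial.eval_one]
    have : n ≤ sz n := by simp; omega
    gcongr
  · have hl := hl'.length_le
    have h : l' = List.replicate l'.length () := by simp [List.eq_replicate_iff]
    have h2 := congrFun this l'.length
    rw [← h] at h2
    rw [← h2]
    simp only [List.length_replicate] at hl
    refine (sz_list_le (B := 2 * n + 1) fun i hi => ?_).trans ?_
    · have := List.mem_range.1 hi
      simp; omega
    · rw [List.length_range]
      gcongr

@[fun_prop]
lemma drop {l : α → List β} {f : α → ℕ} (hl : PolyTime l) (hf : PolyTime f) :
    PolyTime fun a => (l a).drop (f a) := by
  have : (fun a => (l a).drop (f a)) =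
      fun a => (List.replicate (f a) ()).foldl (fun s _ => s.tail) (l a) := by
    ext1 a
    have : ∀ m (l : List β), (List.replicate m ()).foldl (fun s _ => s.tail) l = l.drop m := by
      intro m
      induction m with
      | zero => simp
      | succ m ih => intro l; simp [List.replicate_succ, ih]
    exact (this _ _).symm
  rw [this]
  exact foldl_of_le (toUnits.comp hf) hl (by fun_prop) fun a s b =>
    sz_le_of_suffix (List.tail_suffix s)

@[fun_prop]
lemma getD {l : α → List β} {f : α → ℕ} {d : α → β} (hl : PolyTime l) (hf : PolyTime f)
    (hd : PolyTime d) : PolyTime fun a => (l a).getD (f a) (d a) := by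
  have : (fun a => (l a).getD (f a) (d a)) = fun a => ((l a).drop (f a)).headD (d a) := by
    ext1 a
    simp [List.getD_eq_getElem?_getD, List.headD_eq_head?_getD]
  rw [this]
  fun_prop

@[fun_prop]
lemma natSum {l : α → List ℕ} (hl : PolyTime l) : PolyTime fun a => (l a).sum := by
  have : (fun a => (l a).sum) = fun a => (l a).foldl (fun s b => s + b) 0 := by
    ext1 a; exact List.sum_eq_foldl
  rw [this]
  refine foldl_of_add (q := fun x => sz x.2) hl (const_nat 0) (by fun_prop) (sz_bdd (by fun_prop))
    fun a s b _ => ?_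
  simp only [sz_nat]; omega

@[fun_prop]
lemma realAdd {f g : α → ℝ} (hf : PolyTime f) (hg : PolyTime g) :
    PolyTime fun a => f a + g a := by
  have h : PolyTime fun x : ℝ × ℝ => x.1 + x.2 := of_eval .add fun a => .add (enc a)
  exact h.comp (prodMk hf hg)

@[fun_prop]
lemma leB {f g : α → ℝ} (hf : PolyTime f) (hg : PolyTime g) :
    PolyTime fun a => leB (f a) (g a) := by
  have h : PolyTime fun x : ℝ × ℝ => ReloadCost.leB x.1 x.2 := of_eval .le fun a => by
    have := Eval.le (enc a)
    rwa [show (enc a).le = enc (ReloadCost.leB a.1 a.2) by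
      simp [enc, Data.le, Data.ofProp, ReloadCost.leB]] at this
  exact h.comp (prodMk hf hg)

@[fun_prop]
lemma realSum {l : α → List ℝ} (hl : PolyTime l) : PolyTime fun a => (l a).sum := by
  have : (fun a => (l a).sum) = fun a => (l a).foldl (fun s b => s + b) 0 := by
    ext1 a; exact List.sum_eq_foldl
  rw [this]
  exact foldl_of_le hl const_zero (by fun_prop) fun a s b => by simp

-- The machine cannot multiply reals, but the multiplier is unary, so repeated addition is
-- affordable. The reload cost needs this.
@[fun_prop]
lemma nsmul {f : α → ℕ} {g : α → ℝ} (hf : PolyTime f) (hg : PolyTime g) :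
    PolyTime fun a => f a • g a := by
  have : (fun a => f a • g a) = fun a => ((List.range (f a)).map fun _ => g a).sum := by
    ext1 a; simp
  rw [this]
  fun_prop

/-- Iteration, when the intermediate states have polynomial size. -/
lemma iterate_of_bdd {m : α → ℕ} {init : α → σ} {step : α → σ → σ}
    (hm : PolyTime m) (hinit : PolyTime init)
    (hstep : PolyTime fun x : α × σ => step x.1 x.2)
    {B : α → ℕ} (hB : PolyBdd B) (hbd : ∀ a, ∀ i, sz ((step a)^[i] (init a)) ≤ B a) :
    PolyTime fun a => (step a)^[m a] (init a) := by
  have h : ∀ a (l : List Unit) s, l.foldl (fun s _ => step a s) s = (step a)^[l.length] s := by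
    intro a l
    induction l <;> simp_all
  have : (fun a => (step a)^[m a] (init a)) =
      fun a => (List.replicate (m a) ()).foldl (fun s _ => step a s) (init a) := by
    ext1 a; simp [h]
  rw [this]
  refine foldl_of_bdd (toUnits.comp hm) hinit ?_ hB fun a l' _ => by rw [h]; exact hbd a _
  exact hstep.comp (f := fun x : α × σ × Unit => (x.1, x.2.1)) (by fun_prop)

end PolyTime
/-! ## The algorithm -/

noncomputable instance : Enc Inst := ⟨Inst.encode⟩

namespace Inst

/-- The adjacency matrix, as a list of lists. -/
noncomputable def adjM (I : Inst) : List (List Bool) :=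
  open Classical in List.ofFn fun u => List.ofFn fun v => decide (I.graph.Adj u v)

/-- The cost matrix, as a list of lists. -/
def tcM (I : Inst) : List (List ℝ) := List.ofFn fun i => List.ofFn fun j => I.tc i j

/-- The adjacency test, on numbers. -/
noncomputable def adj (I : Inst) (u v : ℕ) : Bool := (I.adjM.getD u []).getD v false

/-- The traversal costs, on numbers. -/
def cost (I : Inst) (i j : ℕ) : ℝ := (I.tcM.getD i []).getD j 0

end Inst

/-- The label of a pair `(u, v)`: the colour of the edge `uv`, and the size of the subtree below it
if `v` is the parent of `u`, and if `u` is the parent of `v`; these are `0` otherwise. -/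
abbrev Lab := ℕ × ℕ × ℕ

namespace Lab

/-- The colour. -/
def col (l : Lab) : ℕ := l.1
/-- The size of the subtree that hangs on the edge, seen from its lower end. -/
def out (l : Lab) : ℕ := l.2.1
/-- The size of the subtree that hangs on the edge, seen from its upper end. -/
def inn (l : Lab) : ℕ := l.2.2
/-- The label seen from the other end. -/
def flip (l : Lab) : Lab := (l.1, l.2.2, l.2.1)

end Lab

/-- The labels of the pairs that start at one vertex. -/
abbrev Row := List Lab

/-- The label at a position. -/
def Row.lab (r : Row) (v : ℕ) : Lab := r.getD v (0, 0, 0)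

/-- Rows for the vertices of some set, and empty lists for the other vertices. -/
abbrev Item := List Row

namespace Item

/-- The row of a vertex. -/
def row (M : Item) (u : ℕ) : Row := M.getD u []

/-- Whether there is a row for `u`. -/
def has (M : Item) (u : ℕ) : Bool := !(M.row u).isEmpty

/-- The label of a pair. -/
def lab (M : Item) (u v : ℕ) : Lab := (M.row u).lab v

end Item

/-- All labels that are possible on an edge. -/
def edgeLabels (k n : ℕ) : List Lab :=
  (List.range k).flatMap fun c => (List.range (n + 1)).flatMap fun o =>
    (List.range (n + 1)).map fun i => (c, o, i)

/-- All labels that are possible on the pair `(x, u)`. -/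
noncomputable def choices (I : Inst) (x u : ℕ) : List Lab :=
  bif I.adj x u then edgeLabels I.k I.n else [(0, 0, 0)]

/-- Extends the row prefixes by one entry. -/
noncomputable def extendRows (I : Inst) (x : ℕ) (rs : List Row) (u : ℕ) : List Row :=
  rs.flatMap fun r => (choices I x u).map fun l => r ++ [l]

/-- All rows of possible labels. -/
noncomputable def allRows (I : Inst) (x : ℕ) : List Row :=
  (List.range I.n).foldl (extendRows I x) [[]]

/-- The edges at `x` have distinct colours. -/
noncomputable def colOK (I : Inst) (x : ℕ) (r : Row) : Bool :=
  (List.range I.n).all fun u => (List.range I.n).all fun v =>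
    !(!decide (u = v) && I.adj x u && I.adj x v && decide ((r.lab u).col = (r.lab v).col))

/-- The root has no parent; any other vertex has one parent, and the sizes of subtrees fit. -/
def flowOK (I : Inst) (x : ℕ) (r : Row) : Bool :=
  bif decide (x = I.root) then
    (List.range I.n).all fun u => decide ((r.lab u).out = 0)
  else
    -- By the second condition the sum on the left has at most one nonzero term, the size of the
    -- subtree at `x`. The added `1` counts `x` itself and forces this term to be nonzero.
    decide (((List.range I.n).map fun u => (r.lab u).out).sum =
      ((List.range I.n).map fun u => (r.lab u).inn).sum + 1) &&
    (List.range I.n).all fun u => (List.range I.n).all fun v =>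
      decide (u = v) || decide ((r.lab u).out = 0) || decide ((r.lab v).out = 0)

/-- The admissible rows of `x`. -/
noncomputable def rows (I : Inst) (x : ℕ) : List Row :=
  (allRows I x).filter fun r => colOK I x r && flowOK I x r

/-- The cost of the traversals with middle vertex `x`, where `r` is the row of `x`. -/
def rowCost (w : ℕ → ℕ) (I : Inst) (r : Row) : ℝ :=
  ((List.range I.n).map fun u => ((List.range I.n).map fun v =>
    -- A term survives only if `u` is the parent and `v` a child of the middle vertex. The weight
    -- `w` is constantly `1` for the changeover cost and the identity for the reload cost.
    bif decide ((r.lab u).out = 0) || decide ((r.lab v).inn = 0) then 0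
    else w (r.lab v).inn • I.cost (r.lab u).col (r.lab v).col).sum).sum

/-- The cost of the traversals whose middle vertex has a row. -/
def itemCost (w : ℕ → ℕ) (I : Inst) (M : Item) : ℝ :=
  ((List.range I.n).map fun u => rowCost w I (M.row u)).sum

/-- The items with a single row. -/
noncomputable def baseItems (I : Inst) : List Item :=
  (List.range I.n).flatMap fun x => (rows I x).map fun r =>
    (List.range I.n).map fun u => bif decide (u = x) then r else []

/-- Equality of labels. -/
def Lab.beq (l l' : Lab) : Bool :=
  decide (l.1 = l'.1) && decide (l.2.1 = l'.2.1) && decide (l.2.2 = l'.2.2)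

/-- Two items have disjoint sets of vertices and agree on the pairs between them. -/
def compat (I : Inst) (M M' : Item) : Bool :=
  (List.range I.n).all fun u => (List.range I.n).all fun v =>
    !(M.has u && M'.has v) || (!decide (u = v) && (M.lab u v).beq (M'.lab v u).flip)

/-- The union of two items with disjoint sets of vertices. -/
def merge (I : Inst) (M M' : Item) : Item :=
  (List.range I.n).map fun u => M.row u ++ M'.row u

/-- All unions of two items. -/
def merges (I : Inst) (T : List Item) : List Item :=
  T.flatMap fun M => (T.filter fun M' => compat I M M').map fun M' => merge I M M'

/-- Two items have the same set of vertices and the same labels on its boundary. -/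
def sameKey (I : Inst) (M M' : Item) : Bool :=
  ((List.range I.n).all fun u => (M.has u && M'.has u) || (!M.has u && !M'.has u)) &&
  (List.range I.n).all fun u => (List.range I.n).all fun v =>
    !(M.has u && !M.has v) || (M.lab u v).beq (M'.lab u v)

/-- The number of edges on the boundary of the set of vertices of an item. -/
noncomputable def width (I : Inst) (M : Item) : ℕ :=
  ((List.range I.n).map fun u => ((List.range I.n).map fun v =>
    bif I.adj u v && M.has u && !M.has v then 1 else 0).sum).sum

/-- Adds an item to a table that keeps one cheapest item of each key, unless it is too wide. -/
noncomputable def insertItem (W : ℕ) (w : ℕ → ℕ) (I : Inst) (T : List Item) (M : Item) :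
    List Item :=
  bif !decide (width I M ≤ W) ||
    T.any fun M' => sameKey I M' M && leB (itemCost w I M') (itemCost w I M) then T
  else M :: T.filter fun M' => !sameKey I M' M

/-- The table of a list of items. -/
noncomputable def prune (W : ℕ) (w : ℕ → ℕ) (I : Inst) (l : List Item) : List Item :=
  l.foldl (insertItem W w I) []

/-- One round: all unions of two items of the table are added. -/
noncomputable def round (W : ℕ) (w : ℕ → ℕ) (I : Inst) (T : List Item) : List Item :=
  prune W w I (T ++ merges I T)

/-- The table after some number of rounds. -/
noncomputable def table (W : ℕ) (w : ℕ → ℕ) (I : Inst) (i : ℕ) : List Item :=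
  (round W w I)^[i] (prune W w I (baseItems I))

/-- Whether each vertex has a row. -/
def full (I : Inst) (M : Item) : Bool := (List.range I.n).all fun u => M.has u

/-- The output that an item describes. -/
noncomputable def output (I : Inst) (M : Item) : List (List (Option (Bool × ℕ))) :=
  (List.range I.n).map fun u => (List.range I.n).map fun v =>
    bif I.adj u v then
      some (!decide ((M.lab u v).out = 0) || !decide ((M.lab u v).inn = 0), (M.lab u v).col)
    else none

/-- The algorithm. -/
noncomputable def solve (W : ℕ) (w : ℕ → ℕ) (I : Inst) : List (List (Option (Bool × ℕ))) :=
  output I (((table W w I I.n).filter fun M => full I M).headD [])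

/-- The final unit is the `nil` that ends the encoded list. The equality makes the components of an
instance available as projections. -/
lemma encode_eq (I : Inst) : enc I = enc (I.n, I.adjM, I.root.val, I.k, I.tcM, ()) := by
  simp only [enc, Inst.encode, Data.ofList, Data.ofMatrix, Inst.adjM, Inst.tcM, List.map_ofFn]
  congr! 6 with u
  · simp only [Data.ofProp, Function.comp_def, List.map_ofFn]
    congr! 2
    funext v
    by_cases h : I.graph.Adj u v <;> simp [h]
  · simp [Function.comp_def, List.map_ofFn]

/-! ### Polynomial time for the pieces of the algorithm -/

namespace PolyTime

variable {α : Type} [Enc α]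

lemma encode : PolyTime fun I : Inst => (I.n, I.adjM, I.root.val, I.k, I.tcM, ()) :=
  of_enc_eq fun I => (encode_eq I).symm

variable {I : α → Inst} {u v i j x k : α → ℕ} {l l' : α → Lab} {r : α → Row} {M M' : α → Item}
  {T : α → List Item} {rs : α → List Row} {W : ℕ} {w : ℕ → ℕ}

@[fun_prop]
lemma n (hI : PolyTime I) : PolyTime fun a => (I a).n := (encode.comp hI).fst

@[fun_prop]
lemma adjM (hI : PolyTime I) : PolyTime fun a => (I a).adjM := (encode.comp hI).snd.fst

@[fun_prop]
lemma root (hI : PolyTime I) : PolyTime fun a => ((I a).root : ℕ) := (encode.comp hI).snd.snd.fst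

@[fun_prop]
lemma k' (hI : PolyTime I) : PolyTime fun a => (I a).k := (encode.comp hI).snd.snd.snd.fst

@[fun_prop]
lemma tcM (hI : PolyTime I) : PolyTime fun a => (I a).tcM :=
  (encode.comp hI).snd.snd.snd.snd.fst

@[fun_prop]
lemma adj (hI : PolyTime I) (hu : PolyTime u) (hv : PolyTime v) :
    PolyTime fun a => (I a).adj (u a) (v a) := by unfold Inst.adj; fun_prop

@[fun_prop]
lemma cost (hI : PolyTime I) (hi : PolyTime i) (hj : PolyTime j) :
    PolyTime fun a => (I a).cost (i a) (j a) := by unfold Inst.cost; fun_prop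

@[fun_prop]
lemma col (hl : PolyTime l) : PolyTime fun a => (l a).col := by unfold Lab.col; fun_prop

@[fun_prop]
lemma out (hl : PolyTime l) : PolyTime fun a => (l a).out := by unfold Lab.out; fun_prop

@[fun_prop]
lemma inn (hl : PolyTime l) : PolyTime fun a => (l a).inn := by unfold Lab.inn; fun_prop

@[fun_prop]
lemma flip (hl : PolyTime l) : PolyTime fun a => (l a).flip := by unfold Lab.flip; fun_prop

@[fun_prop]
lemma rowLab (hr : PolyTime r) (hv : PolyTime v) : PolyTime fun a => (r a).lab (v a) := by
  unfold Row.lab; fun_prop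

@[fun_prop]
lemma row (hM : PolyTime M) (hu : PolyTime u) : PolyTime fun a => (M a).row (u a) := by
  unfold Item.row; fun_prop

@[fun_prop]
lemma has (hM : PolyTime M) (hu : PolyTime u) : PolyTime fun a => (M a).has (u a) := by
  unfold Item.has; fun_prop

@[fun_prop]
lemma lab (hM : PolyTime M) (hu : PolyTime u) (hv : PolyTime v) :
    PolyTime fun a => (M a).lab (u a) (v a) := by
  unfold Item.lab; fun_prop

@[fun_prop]
lemma edgeLabels (hk : PolyTime k) (hi : PolyTime i) :
    PolyTime fun a => edgeLabels (k a) (i a) := by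
  unfold ReloadCost.edgeLabels; fun_prop

@[fun_prop]
lemma choices (hI : PolyTime I) (hx : PolyTime x) (hu : PolyTime u) :
    PolyTime fun a => choices (I a) (x a) (u a) := by
  unfold ReloadCost.choices; fun_prop

@[fun_prop]
lemma extendRows (hI : PolyTime I) (hx : PolyTime x) (hrs : PolyTime rs) (hu : PolyTime u) :
    PolyTime fun a => extendRows (I a) (x a) (rs a) (u a) := by
  unfold ReloadCost.extendRows; fun_prop

@[fun_prop]
lemma colOK (hI : PolyTime I) (hx : PolyTime x) (hr : PolyTime r) :
    PolyTime fun a => colOK (I a) (x a) (r a) := by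
  unfold ReloadCost.colOK; fun_prop

@[fun_prop]
lemma flowOK (hI : PolyTime I) (hx : PolyTime x) (hr : PolyTime r) :
    PolyTime fun a => flowOK (I a) (x a) (r a) := by
  unfold ReloadCost.flowOK; fun_prop

@[fun_prop]
lemma rowCost (hw : PolyTime w) (hI : PolyTime I) (hr : PolyTime r) :
    PolyTime fun a => rowCost w (I a) (r a) := by
  unfold ReloadCost.rowCost; fun_prop

@[fun_prop]
lemma itemCost (hw : PolyTime w) (hI : PolyTime I) (hM : PolyTime M) :
    PolyTime fun a => itemCost w (I a) (M a) := by
  unfold ReloadCost.itemCost; fun_prop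

@[fun_prop]
lemma beq (hl : PolyTime l) (hl' : PolyTime l') : PolyTime fun a => (l a).beq (l' a) := by
  unfold Lab.beq; fun_prop

@[fun_prop]
lemma compat (hI : PolyTime I) (hM : PolyTime M) (hM' : PolyTime M') :
    PolyTime fun a => compat (I a) (M a) (M' a) := by
  unfold ReloadCost.compat; fun_prop

@[fun_prop]
lemma merge (hI : PolyTime I) (hM : PolyTime M) (hM' : PolyTime M') :
    PolyTime fun a => merge (I a) (M a) (M' a) := by
  unfold ReloadCost.merge; fun_prop

@[fun_prop]
lemma merges (hI : PolyTime I) (hT : PolyTime T) : PolyTime fun a => merges (I a) (T a) := by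
  unfold ReloadCost.merges; fun_prop

@[fun_prop]
lemma sameKey (hI : PolyTime I) (hM : PolyTime M) (hM' : PolyTime M') :
    PolyTime fun a => sameKey (I a) (M a) (M' a) := by
  unfold ReloadCost.sameKey; fun_prop

@[fun_prop]
lemma width (hI : PolyTime I) (hM : PolyTime M) : PolyTime fun a => width (I a) (M a) := by
  unfold ReloadCost.width; fun_prop

@[fun_prop]
lemma insertItem (hw : PolyTime w) (hI : PolyTime I) (hT : PolyTime T) (hM : PolyTime M) :
    PolyTime fun a => insertItem W w (I a) (T a) (M a) := by
  unfold ReloadCost.insertItem; fun_prop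

@[fun_prop]
lemma prune (hw : PolyTime w) (hI : PolyTime I) (hT : PolyTime T) :
    PolyTime fun a => prune W w (I a) (T a) := by
  unfold ReloadCost.prune
  refine foldl_of_add (q := fun x => sz x.2 + 1) hT const_nil (by fun_prop)
    ((sz_bdd (by fun_prop)).add (.const 1)) fun a s b _ => ?_
  unfold ReloadCost.insertItem
  cases !decide (ReloadCost.width (I a) b ≤ W) || s.any fun M' => ReloadCost.sameKey (I a) M' b &&
    ReloadCost.leB (ReloadCost.itemCost w (I a) M') (ReloadCost.itemCost w (I a) b)
  · have := sz_le_of_sublist (List.filter_sublist (l := s)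
      (p := fun M' => !ReloadCost.sameKey (I a) M' b))
    simp; omega
  · simp

@[fun_prop]
lemma round (hw : PolyTime w) (hI : PolyTime I) (hT : PolyTime T) :
    PolyTime fun a => round W w (I a) (T a) := by
  unfold ReloadCost.round; fun_prop

@[fun_prop]
lemma full (hI : PolyTime I) (hM : PolyTime M) : PolyTime fun a => full (I a) (M a) := by
  unfold ReloadCost.full; fun_prop

@[fun_prop]
lemma output (hI : PolyTime I) (hM : PolyTime M) : PolyTime fun a => output (I a) (M a) := by
  unfold ReloadCost.output; fun_prop

end PolyTime

/-! ## Correctness of the tables -/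

lemma sum_map_range {M : Type*} [AddCommMonoid M] (n : ℕ) (f : ℕ → M) :
    ((List.range n).map f).sum = ∑ i : Fin n, f i := by
  rw [Fin.sum_univ_eq_sum_range]
  induction n with
  | zero => simp
  | succ n ih => rw [List.range_succ, Finset.sum_range_succ]; simp [ih]

lemma all_range_iff {n : ℕ} {p : ℕ → Bool} :
    (List.range n).all p = true ↔ ∀ u : Fin n, p u = true := by
  simp [Fin.forall_iff]

/-- The pairs `(u, v)` of adjacent vertices such that `u` is in `S` and `v` is not. -/
noncomputable def bd {V : Type*} [Fintype V] (G : SimpleGraph V) (S : Finset V) :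
    Finset (V × V) :=
  open Classical in Finset.univ.filter fun x => G.Adj x.1 x.2 ∧ x.1 ∈ S ∧ x.2 ∉ S

lemma mem_bd {V : Type*} [Fintype V] {G : SimpleGraph V} {S : Finset V} {x : V × V} :
    x ∈ bd G S ↔ G.Adj x.1 x.2 ∧ x.1 ∈ S ∧ x.2 ∉ S := by simp [bd]

/-- The sets that arise from single vertices by disjoint unions, where each set that occurs has at
most `W` edges on its boundary. -/
inductive Derivable {V : Type*} [Fintype V] [DecidableEq V] (G : SimpleGraph V) (W : ℕ) :
    Finset V → Prop
  | single (v : V) : (bd G {v}).card ≤ W → Derivable G W {v}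
  | union {S S' : Finset V} : Derivable G W S → Derivable G W S' → Disjoint S S' →
      (bd G (S ∪ S')).card ≤ W → Derivable G W (S ∪ S')

/-- Both parts of a union are proper subsets of it, so a set of size `m` is reached after `m - 1`
rounds. -/
lemma Derivable.card_pos {V : Type*} [Fintype V] [DecidableEq V] {G : SimpleGraph V} {W : ℕ}
    {S : Finset V} (h : Derivable G W S) : 0 < S.card := by
  induction h with
  | single v _ => simp
  | union _ _ hd _ h₁ h₂ => rw [Finset.card_union_of_disjoint hd]; omega

/-! ### The meaning of rows, keys and merging -/

section Basic

variable {I : Inst} {M M' : Item} {r : Row}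

lemma getD_ofFn {α : Type*} {n : ℕ} (f : Fin n → α) (d : α) (u : ℕ) :
    (List.ofFn f).getD u d = if h : u < n then f ⟨u, h⟩ else d := by
  split <;> simp_all [List.getD_eq_getElem?_getD]

lemma getD_map_range {α : Type*} {n : ℕ} (f : ℕ → α) (d : α) (u : ℕ) :
    ((List.range n).map f).getD u d = if u < n then f u else d := by
  split <;> simp_all [List.getD_eq_getElem?_getD]

lemma adj_iff_exists {u v : ℕ} :
    I.adj u v = true ↔ ∃ hu hv, I.graph.Adj ⟨u, hu⟩ ⟨v, hv⟩ := by
  unfold Inst.adj Inst.adjM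
  rw [getD_ofFn]
  split
  · rw [getD_ofFn]
    split <;> simp_all
  · simp_all

lemma adj_iff {u v : Fin I.n} : I.adj u v = true ↔ I.graph.Adj u v := by
  simp [adj_iff_exists]

lemma cost_eq (i j : Fin I.k) : I.cost i j = I.tc i j := by
  simp [Inst.cost, Inst.tcM]

lemma mem_edgeLabels {k n : ℕ} {l : Lab} :
    l ∈ edgeLabels k n ↔ l.col < k ∧ l.out ≤ n ∧ l.inn ≤ n := by
  obtain ⟨c, o, i⟩ := l
  simp [edgeLabels, Lab.col, Lab.out, Lab.inn]

lemma mem_choices {x u : ℕ} {l : Lab} :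
    l ∈ choices I x u ↔ if I.adj x u then l.col < I.k ∧ l.out ≤ I.n ∧ l.inn ≤ I.n
      else l = (0, 0, 0) := by
  unfold choices
  cases I.adj x u <;> simp [mem_edgeLabels]

lemma mem_foldl_extendRows {x m : ℕ} {r : Row} :
    r ∈ (List.range m).foldl (extendRows I x) [[]] ↔
      r.length = m ∧ ∀ u < m, r.lab u ∈ choices I x u := by
  induction m generalizing r with
  | zero => simp
  | succ m ih =>
    rw [List.range_succ, List.foldl_append]
    simp only [List.foldl_cons, List.foldl_nil, extendRows, List.mem_flatMap, List.mem_map, ih]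
    have hlab : ∀ (r : Row) l, r.length = m → ∀ u ≤ m,
        Row.lab (r ++ [l]) u = if u < m then r.lab u else l := by
      intro r l h u hu
      split
      · simp [Row.lab, List.getD_eq_getElem?_getD, *]
      · obtain rfl : u = m := by omega
        simp [Row.lab, List.getD_eq_getElem?_getD, *]
    constructor
    · rintro ⟨r, ⟨hr, h⟩, l, hl, rfl⟩
      refine ⟨by simp [hr], fun u hu => ?_⟩
      rw [hlab r l hr u (by omega)]
      split
      · exact h u ‹_›
      · rwa [show u = m by omega]
    · rintro ⟨hr, h⟩
      have hne : r ≠ [] := by rintro rfl; simp at hr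
      have hr' : r.dropLast.length = m := by simp [hr]
      have heq := List.dropLast_append_getLast hne
      have hl := hlab r.dropLast (r.getLast hne) hr'
      rw [heq] at hl
      refine ⟨r.dropLast, ⟨hr', fun u hu => ?_⟩, r.getLast hne, ?_, heq⟩
      · have := hl u hu.le
        rw [if_pos hu] at this
        exact this ▸ h u (by omega)
      · have := hl m le_rfl
        rw [if_neg (by omega)] at this
        exact this ▸ h m (by omega)

/-- The admissible rows, in terms of their labels. -/
lemma mem_rows {x : Fin I.n} : r ∈ rows I x ↔ r.length = I.n ∧
    (∀ u : Fin I.n, r.lab u ∈ choices I x u) ∧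
    (∀ u v : Fin I.n, u ≠ v → I.graph.Adj x u → I.graph.Adj x v →
      (r.lab u).col ≠ (r.lab v).col) ∧
    (x = I.root → ∀ u : Fin I.n, (r.lab u).out = 0) ∧
    (x ≠ I.root → (∑ u : Fin I.n, (r.lab u).out = ∑ u : Fin I.n, (r.lab u).inn + 1) ∧
      ∀ u v : Fin I.n, u ≠ v → (r.lab u).out = 0 ∨ (r.lab v).out = 0) := by
  have hc : colOK I x r = true ↔ ∀ u v : Fin I.n, u ≠ v → I.graph.Adj x u → I.graph.Adj x v →
      (r.lab u).col ≠ (r.lab v).col := by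
    unfold colOK
    simp only [all_range_iff, ← adj_iff, Bool.not_eq_true', Bool.and_eq_false_iff,
      decide_eq_false_iff_not, Bool.not_eq_false', decide_eq_true_eq, Fin.val_inj]
    refine forall_congr' fun u => forall_congr' fun v => ?_
    cases I.adj x u <;> cases I.adj x v <;> simp; tauto
  have hf : flowOK I x r = true ↔ (x = I.root → ∀ u : Fin I.n, (r.lab u).out = 0) ∧
    (x ≠ I.root → (∑ u : Fin I.n, (r.lab u).out = ∑ u : Fin I.n, (r.lab u).inn + 1) ∧
      ∀ u v : Fin I.n, u ≠ v → (r.lab u).out = 0 ∨ (r.lab v).out = 0) := by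
    unfold flowOK
    by_cases h : x = I.root
    · simp only [h, decide_true, cond_true, all_range_iff]
      simp
    · have : (x : ℕ) ≠ I.root := fun h' => h (Fin.ext h')
      simp only [this, decide_false, cond_false, Bool.and_eq_true, all_range_iff, sum_map_range]
      simp [h, Fin.val_inj, or_iff_not_imp_left]
  rw [rows, List.mem_filter, allRows, mem_foldl_extendRows, Bool.and_eq_true, hc, hf, and_assoc]
  simp [Fin.forall_iff]

lemma rowCost_nil (w : ℕ → ℕ) : rowCost w I [] = 0 := by
  simp [rowCost, Row.lab, Lab.out]

lemma rowCost_eq (w : ℕ → ℕ) : rowCost w I r = ∑ u : Fin I.n, ∑ v : Fin I.n,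
    if (r.lab u).out = 0 ∨ (r.lab v).inn = 0 then 0
    else w (r.lab v).inn • I.cost (r.lab u).col (r.lab v).col := by
  simp only [rowCost, sum_map_range, Bool.cond_eq_ite, Bool.or_eq_true, decide_eq_true_eq]

lemma itemCost_eq (w : ℕ → ℕ) : itemCost w I M = ∑ u : Fin I.n, rowCost w I (M.row u) :=
  sum_map_range _ _

lemma has_iff {u : ℕ} : M.has u = true ↔ M.row u ≠ [] := by simp [Item.has]

lemma beq_iff {l l' : Lab} : l.beq l' = true ↔ l = l' := by
  obtain ⟨c, o, i⟩ := l
  obtain ⟨c', o', i'⟩ := l'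
  simp [Lab.beq, and_assoc]

/-- The vertices that have rows. -/
noncomputable def supp (I : Inst) (M : Item) : Finset (Fin I.n) :=
  Finset.univ.filter fun u => M.has u = true

lemma mem_supp {u : Fin I.n} : u ∈ supp I M ↔ M.has u = true := by simp [supp]

lemma width_eq : width I M = (bd I.graph (supp I M)).card := by
  classical
  simp only [width, sum_map_range, bd, Finset.card_filter, Bool.cond_eq_ite, mem_supp,
    Fintype.sum_prod_type]
  simp [adj_iff, and_assoc]

lemma sameKey_iff : sameKey I M M' = true ↔ supp I M = supp I M' ∧
    ∀ u ∈ supp I M, ∀ v ∉ supp I M, M.lab u v = M'.lab u v := by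
  simp only [sameKey, Bool.and_eq_true, all_range_iff, Finset.ext_iff, mem_supp]
  refine and_congr (forall_congr' fun u => ?_) (forall_congr' fun u => ?_)
  · cases M.has u <;> cases M'.has u <;> simp
  · cases M.has u
    · simp
    · simp only [Bool.true_and, Bool.not_not, forall_const]
      refine forall_congr' fun v => ?_
      cases M.has v <;> simp [beq_iff]

lemma sameKey_refl (I : Inst) (M : Item) : sameKey I M M = true := by simp [sameKey_iff]

lemma sameKey_symm (h : sameKey I M M' = true) : sameKey I M' M = true := by
  rw [sameKey_iff] at *
  exact ⟨h.1.symm, fun u hu v hv => (h.2 u (h.1 ▸ hu) v (h.1 ▸ hv)).symm⟩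

lemma sameKey_trans {M'' : Item} (h : sameKey I M M' = true) (h' : sameKey I M' M'' = true) :
    sameKey I M M'' = true := by
  rw [sameKey_iff] at *
  exact ⟨h.1.trans h'.1, fun u hu v hv => (h.2 u hu v hv).trans
    (h'.2 u (h.1 ▸ hu) v (h.1 ▸ hv))⟩

lemma compat_iff : compat I M M' = true ↔ Disjoint (supp I M) (supp I M') ∧
    ∀ u ∈ supp I M, ∀ v ∈ supp I M', M.lab u v = (M'.lab v u).flip := by
  have : compat I M M' = true ↔ ∀ u v : Fin I.n, M.has u = true → M'.has v = true →
      u ≠ v ∧ M.lab u v = (M'.lab v u).flip := by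
    simp only [compat, all_range_iff]
    refine forall_congr' fun u => forall_congr' fun v => ?_
    cases M.has u <;> cases M'.has v <;> simp [beq_iff, Fin.val_inj]
  rw [this, Finset.disjoint_iff_ne]
  simp only [mem_supp]
  exact ⟨fun h => ⟨fun u hu v hv => (h u v hu hv).1, fun u hu v hv => (h u v hu hv).2⟩,
    fun h u v hu hv => ⟨h.1 u hu v hv, h.2 u hu v hv⟩⟩

lemma row_merge (u : Fin I.n) : (merge I M M').row u = M.row u ++ M'.row u := by
  rw [merge, Item.row, getD_map_range, if_pos u.2]

lemma supp_merge : supp I (merge I M M') = supp I M ∪ supp I M' := by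
  ext u
  simp only [Finset.mem_union, mem_supp, has_iff, row_merge]
  simp [or_iff_not_imp_left]

lemma row_merge_left (h : Disjoint (supp I M) (supp I M')) {u : Fin I.n} (hu : u ∈ supp I M) :
    (merge I M M').row u = M.row u := by
  have := Finset.disjoint_left.1 h hu
  rw [mem_supp, has_iff, not_not] at this
  rw [row_merge, this, List.append_nil]

lemma row_merge_right (h : Disjoint (supp I M) (supp I M')) {u : Fin I.n} (hu : u ∈ supp I M') :
    (merge I M M').row u = M'.row u := by
  have := Finset.disjoint_right.1 h hu
  rw [mem_supp, has_iff, not_not] at this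
  rw [row_merge, this, List.nil_append]

/-- The cost of a traversal is read off from the row of its middle vertex alone, so no traversal
across the two parts is missed or counted twice. -/
lemma itemCost_merge (w : ℕ → ℕ) (h : Disjoint (supp I M) (supp I M')) :
    itemCost w I (merge I M M') = itemCost w I M + itemCost w I M' := by
  simp only [itemCost_eq, ← Finset.sum_add_distrib]
  refine Finset.sum_congr rfl fun u _ => ?_
  by_cases hu : u ∈ supp I M
  · have := Finset.disjoint_left.1 h hu
    rw [mem_supp, has_iff, not_not] at this
    rw [row_merge_left h hu, this, rowCost_nil, add_zero]
  · rw [mem_supp, has_iff, not_not] at hu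
    rw [row_merge, hu, rowCost_nil, zero_add, List.nil_append]

/-- The items that describe partial solutions. -/
structure Valid (I : Inst) (M : Item) : Prop where
  length : M.length = I.n
  row : ∀ u ∈ supp I M, M.row u ∈ rows I u
  lab : ∀ u ∈ supp I M, ∀ v ∈ supp I M, M.lab u v = (M.lab v u).flip

lemma Valid.merge (h : Valid I M) (h' : Valid I M') (hc : compat I M M' = true) :
    Valid I (merge I M M') := by
  rw [compat_iff] at hc
  obtain ⟨hd, hc⟩ := hc
  refine ⟨by simp [ReloadCost.merge], fun u hu => ?_, fun u hu v hv => ?_⟩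
  · rw [supp_merge, Finset.mem_union] at hu
    rcases hu with hu | hu
    · rw [row_merge_left hd hu]; exact h.row u hu
    · rw [row_merge_right hd hu]; exact h'.row u hu
  · rw [supp_merge, Finset.mem_union] at hu hv
    unfold Item.lab
    rcases hu with hu | hu <;> rcases hv with hv | hv
    · rw [row_merge_left hd hu, row_merge_left hd hv]; exact h.lab u hu v hv
    · rw [row_merge_left hd hu, row_merge_right hd hv]; exact hc u hu v hv
    · rw [row_merge_right hd hu, row_merge_left hd hv]
      have := hc v hv u hu
      unfold Item.lab at this
      rw [this]; rfl
    · rw [row_merge_right hd hu, row_merge_right hd hv]; exact h'.lab u hu v hv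

/-- The item with the single row `r`, at `x`. -/
def single (I : Inst) (x : ℕ) (r : Row) : Item :=
  (List.range I.n).map fun u => bif decide (u = x) then r else []

lemma row_single (x u : Fin I.n) : (single I x r).row u = if u = x then r else [] := by
  simp [single, Item.row, Fin.val_inj, Bool.cond_eq_ite]

lemma supp_single {x : Fin I.n} (hr : r ∈ rows I x) : supp I (single I x r) = {x} := by
  have : r ≠ [] := by
    rintro rfl
    have h := (mem_rows.1 hr).1
    have := x.2
    rw [List.length_nil] at h
    omega
  ext u
  rw [mem_supp, has_iff, row_single]
  simp [this]

lemma mem_baseItems : M ∈ baseItems I ↔ ∃ x : Fin I.n, ∃ r ∈ rows I x, M = single I x r := by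
  simp [baseItems, single, Fin.exists_iff, eq_comm]

lemma valid_of_mem_baseItems (h : M ∈ baseItems I) : Valid I M := by
  obtain ⟨x, r, hr, rfl⟩ := mem_baseItems.1 h
  refine ⟨by simp [single], fun u hu => ?_, fun u hu v hv => ?_⟩
  · rw [supp_single hr, Finset.mem_singleton] at hu
    rw [row_single, if_pos hu, hu]
    exact hr
  · rw [supp_single hr, Finset.mem_singleton] at hu hv
    subst hu hv
    -- A vertex is not adjacent to itself, so its label towards itself is `(0, 0, 0)`, which equals
    -- its flip.
    have h := (mem_rows.1 hr).2.1 v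
    rw [mem_choices, if_neg (by simp [adj_iff])] at h
    rw [Item.lab, row_single, if_pos rfl, h]
    rfl

end Basic

/-! ### Dominance, and optimality of the table -/

section Prune

variable {W : ℕ} {w : ℕ → ℕ} {I : Inst} {T l : List Item} {M N : Item}

/-- `T` has an item that is at least as good as `M`. -/
def Dominates (w : ℕ → ℕ) (I : Inst) (T : List Item) (M : Item) : Prop :=
  ∃ N ∈ T, sameKey I N M = true ∧ itemCost w I N ≤ itemCost w I M

lemma dominates_of_mem (h : M ∈ T) : Dominates w I T M := ⟨M, h, sameKey_refl I M, le_rfl⟩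

lemma insertItem_cases (W : ℕ) (w : ℕ → ℕ) (I : Inst) (T : List Item) (M : Item) :
    (insertItem W w I T M = T ∧ (width I M ≤ W → Dominates w I T M)) ∨
    (insertItem W w I T M = M :: T.filter (fun N => !sameKey I N M) ∧ width I M ≤ W ∧
      ¬ Dominates w I T M) := by
  have hd : (T.any fun N => sameKey I N M && leB (itemCost w I N) (itemCost w I M)) = true ↔
      Dominates w I T M := by
    simp [Dominates, leB_iff]
  unfold insertItem
  by_cases h : width I M ≤ W
  · by_cases h' : Dominates w I T M
    · left; simp [hd.2 h', h']
    · right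
      rw [← hd, Bool.not_eq_true] at h'
      refine ⟨by rw [h']; simp [h], h, ?_⟩
      rw [← hd, h']; simp
  · left; simp [h]

/-- An old item is dropped only for a new one with the same key, and only when no old item with that
key is as cheap as the new one. The new item then takes over everything the old one dominated. -/
lemma dominates_insertItem (h : Dominates w I T N) : Dominates w I (insertItem W w I T M) N := by
  obtain ⟨N', hN', hk, hc⟩ := h
  rcases insertItem_cases W w I T M with ⟨h, -⟩ | ⟨h, -, hn⟩ <;> rw [h]
  · exact ⟨N', hN', hk, hc⟩
  · by_cases hs : sameKey I N' M = true
    · refine ⟨M, List.mem_cons_self, sameKey_trans (sameKey_symm hs) hk, ?_⟩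
      by_contra hlt
      exact hn ⟨N', hN', hs, hc.trans (not_le.1 hlt).le⟩
    · exact ⟨N', List.mem_cons_of_mem _ (List.mem_filter.2 ⟨hN', by simpa using hs⟩), hk, hc⟩

lemma dominates_insertItem_self (h : width I M ≤ W) :
    Dominates w I (insertItem W w I T M) M := by
  rcases insertItem_cases W w I T M with ⟨h', hd⟩ | ⟨h', -, -⟩ <;> rw [h']
  · exact hd h
  · exact dominates_of_mem List.mem_cons_self

lemma mem_insertItem (h : N ∈ insertItem W w I T M) : N ∈ T ∨ (N = M ∧ width I M ≤ W) := by
  rcases insertItem_cases W w I T M with ⟨h', -⟩ | ⟨h', hw, -⟩ <;> rw [h'] at h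
  · exact .inl h
  · rcases List.mem_cons.1 h with h | h
    · exact .inr ⟨h, hw⟩
    · exact .inl (List.mem_filter.1 h).1

lemma pairwise_insertItem (h : T.Pairwise fun M N => ¬ sameKey I M N = true) :
    (insertItem W w I T M).Pairwise fun M N => ¬ sameKey I M N = true := by
  rcases insertItem_cases W w I T M with ⟨h', -⟩ | ⟨h', -, -⟩ <;> rw [h']
  · exact h
  · refine List.pairwise_cons.2 ⟨fun N hN => ?_, h.filter _⟩
    have := (List.mem_filter.1 hN).2
    exact fun hs => by simp [sameKey_symm hs] at this

lemma dominates_prune (hM : M ∈ l) (hw : width I M ≤ W) : Dominates w I (prune W w I l) M := by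
  suffices h : ∀ T, Dominates w I T M ∨ M ∈ l → Dominates w I (l.foldl (insertItem W w I) T) M from
    h [] (.inr hM)
  clear hM
  induction l with
  | nil => simp
  | cons N l ih =>
    rintro T (h | h)
    · exact ih _ (.inl (dominates_insertItem h))
    · rcases List.mem_cons.1 h with rfl | h
      · exact ih _ (.inl (dominates_insertItem_self hw))
      · exact ih _ (.inr h)

lemma mem_prune (h : M ∈ prune W w I l) : M ∈ l ∧ width I M ≤ W := by
  suffices h : ∀ T, M ∈ l.foldl (insertItem W w I) T → M ∈ T ∨ (M ∈ l ∧ width I M ≤ W) by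
    simpa using h [] ‹_›
  clear h
  induction l with
  | nil => simp
  | cons N l ih =>
    intro T h
    rcases ih _ h with h | h
    · rcases mem_insertItem h with h | ⟨rfl, h⟩
      · exact .inl h
      · exact .inr ⟨List.mem_cons_self, h⟩
    · exact .inr ⟨List.mem_cons_of_mem _ h.1, h.2⟩

lemma pairwise_prune : (prune W w I l).Pairwise fun M N => ¬ sameKey I M N = true := by
  suffices h : ∀ T : List Item, (T.Pairwise fun M N => ¬ sameKey I M N = true) →
      (l.foldl (insertItem W w I) T).Pairwise fun M N => ¬ sameKey I M N = true from
    h [] List.Pairwise.nil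
  induction l with
  | nil => simp
  | cons N l ih => exact fun T h => ih _ (pairwise_insertItem h)

lemma table_succ (i : ℕ) : table W w I (i + 1) = round W w I (table W w I i) := by
  rw [table, Function.iterate_succ_apply']; rfl

lemma pairwise_table (i : ℕ) : (table W w I i).Pairwise fun M N => ¬ sameKey I M N = true := by
  cases i with
  | zero => exact pairwise_prune
  | succ i => rw [table_succ]; exact pairwise_prune

lemma mem_merges : M ∈ merges I T ↔
    ∃ N ∈ T, ∃ N' ∈ T, compat I N N' = true ∧ M = merge I N N' := by
  simp only [merges, List.mem_flatMap, List.mem_map, List.mem_filter, and_assoc]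
  exact exists_congr fun N => and_congr_right fun _ => exists_congr fun N' =>
    and_congr_right fun _ => and_congr_right fun _ => eq_comm

lemma of_mem_table {i : ℕ} (h : M ∈ table W w I i) : Valid I M ∧ width I M ≤ W := by
  induction i generalizing M with
  | zero =>
    obtain ⟨h, hw⟩ := mem_prune (show M ∈ prune W w I (baseItems I) from h)
    exact ⟨valid_of_mem_baseItems h, hw⟩
  | succ i ih =>
    rw [table_succ] at h
    obtain ⟨h, hw⟩ := mem_prune h
    refine ⟨?_, hw⟩
    rcases List.mem_append.1 h with h | h
    · exact (ih h).1
    · obtain ⟨N, hN, N', hN', hc, rfl⟩ := mem_merges.1 h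
      exact (ih hN).1.merge (ih hN').1 hc

/-- Exchange step: an item with the same key can replace `M` without disturbing the agreement with
`F` outside. -/
lemma lab_eq_of_mem_bd {F : Item} {S : Finset (Fin I.n)} (hk : sameKey I N M = true)
    (hS : supp I M = S) (h : ∀ u ∈ S, ∀ v ∉ S, M.lab u v = F.lab u v) :
    supp I N = S ∧ ∀ u ∈ S, ∀ v ∉ S, N.lab u v = F.lab u v := by
  rw [sameKey_iff] at hk
  obtain ⟨h1, h2⟩ := hk
  rw [h1, hS] at h2
  exact ⟨h1.trans hS, fun u hu v hv => (h2 u hu v hv).trans (h u hu v hv)⟩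

/-- Each derivable set has an item that agrees on the boundary with a given solution and is not more
expensive. -/
lemma exists_mem_table {F : Item} (hF : Valid I F) (hfull : supp I F = Finset.univ)
    {S : Finset (Fin I.n)} (hS : Derivable I.graph W S) {i : ℕ} (hi : S.card ≤ i + 1) :
    ∃ M ∈ table W w I i, supp I M = S ∧ (∀ u ∈ S, ∀ v ∉ S, M.lab u v = F.lab u v) ∧
      itemCost w I M ≤ ∑ u ∈ S, rowCost w I (F.row u) := by
  have step : ∀ {S : Finset (Fin I.n)} {l : List Item}, (bd I.graph S).card ≤ W →
      (∃ M ∈ l, supp I M = S ∧ (∀ u ∈ S, ∀ v ∉ S, M.lab u v = F.lab u v) ∧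
        itemCost w I M ≤ ∑ u ∈ S, rowCost w I (F.row u)) →
      ∃ M ∈ prune W w I l, supp I M = S ∧ (∀ u ∈ S, ∀ v ∉ S, M.lab u v = F.lab u v) ∧
        itemCost w I M ≤ ∑ u ∈ S, rowCost w I (F.row u) := by
    rintro S l hS ⟨M, hM, hs, hl, hc⟩
    obtain ⟨N, hN, hk, hc'⟩ := dominates_prune (W := W) (w := w) hM (by rwa [width_eq, hs])
    obtain ⟨h1, h2⟩ := lab_eq_of_mem_bd hk hs hl
    exact ⟨N, hN, h1, h2, hc'.trans hc⟩
  have mono : ∀ {S : Finset (Fin I.n)} {i : ℕ}, (bd I.graph S).card ≤ W →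
      (∃ M ∈ table W w I i, supp I M = S ∧ (∀ u ∈ S, ∀ v ∉ S, M.lab u v = F.lab u v) ∧
        itemCost w I M ≤ ∑ u ∈ S, rowCost w I (F.row u)) →
      ∃ M ∈ table W w I (i + 1), supp I M = S ∧ (∀ u ∈ S, ∀ v ∉ S, M.lab u v = F.lab u v) ∧
        itemCost w I M ≤ ∑ u ∈ S, rowCost w I (F.row u) := by
    rintro S i hS ⟨M, hM, h⟩
    rw [table_succ]
    exact step hS ⟨M, List.mem_append_left _ hM, h⟩
  induction hS generalizing i with
  | single x hx =>
    clear hi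
    induction i with
    | succ i ih => exact mono hx ih
    | zero =>
      have hr := hF.row x (by rw [hfull]; exact Finset.mem_univ x)
      refine step hx ⟨single I x (F.row x), mem_baseItems.2 ⟨x, _, hr, rfl⟩, supp_single hr,
        fun u hu v _ => ?_, ?_⟩
      · rw [Finset.mem_singleton] at hu
        subst hu
        simp [Item.lab, row_single]
      · rw [itemCost_eq, Finset.sum_singleton]
        refine le_of_eq ?_
        rw [Finset.sum_eq_single x, row_single, if_pos rfl]
        · intro u _ hu
          rw [row_single, if_neg hu, rowCost_nil]
        · simp
  | @union S S' hS hS' hd hw ih ih' =>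
    have h1 := hS.card_pos
    have h2 := hS'.card_pos
    rw [Finset.card_union_of_disjoint hd] at hi
    -- Both parts are nonempty, so each is smaller than the union by at least one and was available
    -- a round earlier.
    obtain ⟨i, rfl⟩ : ∃ j, i = j + 1 := ⟨i - 1, by omega⟩
    obtain ⟨M, hM, hs, hl, hc⟩ := ih (i := i) (by omega)
    obtain ⟨M', hM', hs', hl', hc'⟩ := ih' (i := i) (by omega)
    subst hs hs'
    rw [table_succ]
    -- Between the two parts both items carry the labels of `F`, and these are consistent.
    have hcomp : compat I M M' = true := by
      refine compat_iff.2 ⟨hd, fun u hu v hv => ?_⟩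
      rw [hl u hu v (Finset.disjoint_right.1 hd hv), hl' v hv u (Finset.disjoint_left.1 hd hu)]
      exact hF.lab u (by simp [hfull]) v (by simp [hfull])
    refine step hw ⟨merge I M M',
      List.mem_append_right _ (mem_merges.2 ⟨M, hM, M', hM', hcomp, rfl⟩),
      supp_merge, fun u hu v hv => ?_, ?_⟩
    · rw [Finset.mem_union] at hu
      rw [Finset.mem_union, not_or] at hv
      unfold Item.lab
      rcases hu with hu | hu
      · rw [row_merge_left hd hu]; exact hl u hu v hv.1
      · rw [row_merge_right hd hu]; exact hl' u hu v hv.2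
    · rw [itemCost_merge w hd, Finset.sum_union hd]
      exact add_le_add hc hc'

/-- If the set of all vertices is derivable, then the algorithm finds an item that describes an
optimal solution. -/
lemma exists_solve_eq (hW : Derivable I.graph W Finset.univ)
    (hex : ∃ F, Valid I F ∧ supp I F = Finset.univ) :
    ∃ M, Valid I M ∧ supp I M = Finset.univ ∧ solve W w I = output I M ∧
      ∀ F, Valid I F → supp I F = Finset.univ → itemCost w I M ≤ itemCost w I F := by
  have hfull : ∀ M, full I M = true ↔ supp I M = Finset.univ := fun M => by
    simp [full, all_range_iff, supp, Finset.filter_eq_self, -List.all_eq_true]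
  have key : ∀ F, Valid I F → supp I F = Finset.univ →
      ∃ M ∈ table W w I I.n, full I M = true ∧ itemCost w I M ≤ itemCost w I F := by
    intro F hF hs
    obtain ⟨M, hM, hs', -, hc⟩ := exists_mem_table (w := w) hF hs hW (i := I.n) (by simp)
    exact ⟨M, hM, (hfull M).2 hs', by rwa [itemCost_eq w (M := F)]⟩
  -- Items on the whole vertex set have an empty boundary, hence all the same key, and a table holds
  -- one item for each key. The head of the filtered list is therefore the optimum.
  have huniq : ∀ M ∈ table W w I I.n, ∀ N ∈ table W w I I.n, full I M = true → full I N = true →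
      M = N := by
    intro M hM N hN h h'
    by_contra hne
    have : Std.Symm fun M N : Item => ¬ sameKey I M N = true :=
      ⟨fun _ _ h h' => h (sameKey_symm h')⟩
    refine (pairwise_table I.n).forall hM hN hne (sameKey_iff.2 ?_)
    rw [hfull] at h h'
    simp [h, h']
  obtain ⟨F, hF, hs⟩ := hex
  obtain ⟨M, hM, hMf, -⟩ := key F hF hs
  refine ⟨M, (of_mem_table hM).1, (hfull M).1 hMf, ?_, fun F hF hs => ?_⟩
  · unfold solve
    congr 1
    have hmem : M ∈ (table W w I I.n).filter fun M => full I M := List.mem_filter.2 ⟨hM, hMf⟩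
    cases h : (table W w I I.n).filter fun M => full I M with
    | nil => simp [h] at hmem
    | cons N l =>
      have hN : N ∈ (table W w I I.n).filter fun M => full I M := h ▸ List.mem_cons_self
      obtain ⟨h1, h2⟩ := List.mem_filter.1 hN
      exact huniq N h1 M hM h2 hMf
  · obtain ⟨N, hN, hNf, hc⟩ := key F hF hs
    rwa [huniq M hM N hN hMf hNf]

end Prune
/-! ## The running time -/

/-- A bound for the sizes of labels. -/
def labBound (I : Inst) : ℕ := 2 * I.k + 4 * I.n + 5

/-- A bound for the number of labels. -/
def labCount (I : Inst) : ℕ := I.k * ((I.n + 1) * (I.n + 1))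

section Sizes

variable {I : Inst} {x u : ℕ} {l : Lab} {r : Row} {M : Item}

lemma sz_le_of_mem_choices (h : l ∈ choices I x u) : sz l ≤ labBound I := by
  rw [mem_choices] at h
  obtain ⟨c, o, i⟩ := l
  simp only [Lab.col, Lab.out, Lab.inn] at h
  -- Three unary numbers and two pair nodes give `2 * c + 2 * o + 2 * i + 5`.
  simp only [sz_pair, sz_nat, labBound]
  split at h
  · omega
  · simp only [Prod.mk.injEq] at h; omega

lemma sz_row_le {m : ℕ} (h : r.length = m) (hr : ∀ u < m, r.lab u ∈ choices I x u) :
    sz r ≤ m * (labBound I + 1) + 1 := by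
  have := sz_list_le (l := r) (B := labBound I) fun l hl => by
    obtain ⟨u, hu, rfl⟩ := List.mem_iff_getElem.1 hl
    have := hr u (by omega)
    rw [Row.lab, List.getD_eq_getElem _ _ hu] at this
    exact sz_le_of_mem_choices this
  rwa [h] at this

lemma sz_item_le (hM : Valid I M) : sz M ≤ I.n * (I.n * (labBound I + 1) + 2) + 1 := by
  have := sz_list_le (l := M) (B := I.n * (labBound I + 1) + 1) fun r hr => by
    obtain ⟨u, hu, rfl⟩ := List.mem_iff_getElem.1 hr
    have hun : u < I.n := hM.length ▸ hu
    have hrow : M.row u = M[u] := by rw [Item.row, List.getD_eq_getElem _ _ hu]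
    by_cases h : M.row u = []
    · rw [← hrow, h]; simp
    · have := mem_rows.1 (hM.row ⟨u, hun⟩ (mem_supp.2 (has_iff.2 h)))
      rw [← hrow]
      exact sz_row_le this.1 fun v hv => this.2.1 ⟨v, hv⟩
  rwa [hM.length] at this

lemma length_choices (I : Inst) (x u : ℕ) :
    (choices I x u).length = if I.adj x u then labCount I else 1 := by
  unfold choices
  cases I.adj x u <;> simp [edgeLabels, labCount, List.length_flatMap]

/-- A neighbour multiplies the number of rows by the number of labels, any other vertex by one. The
exponent is thus at most the degree, and this is why degrees must be bounded. -/
lemma length_foldl_extendRows (I : Inst) (x m : ℕ) :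
    ((List.range m).foldl (extendRows I x) [[]]).length =
      labCount I ^ (List.range m).countP fun u => I.adj x u := by
  induction m with
  | zero => simp
  | succ m ih =>
    rw [List.range_succ, List.foldl_append, List.countP_append, pow_add, ← ih]
    simp only [List.foldl_cons, List.foldl_nil, extendRows, List.length_flatMap, List.length_map,
      List.map_const', List.sum_replicate, smul_eq_mul, length_choices]
    congr 1
    by_cases h : I.adj x m = true <;> simp [h]

lemma countP_adj_le {W : ℕ} (hI : ∀ v, (I.graph.neighborSet v).ncard ≤ W) (x m : ℕ) :
    ((List.range m).countP fun u => I.adj x u) ≤ W := by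
  classical
  by_cases hx : x < I.n
  · refine le_trans ?_ (hI ⟨x, hx⟩)
    rw [List.countP_eq_length_filter, ← List.toFinset_card_of_nodup (List.nodup_range.filter _),
      ← Set.ncard_coe_finset, ← Set.ncard_image_of_injective _ Fin.val_injective]
    refine Set.ncard_le_ncard (fun u hu => ?_) (Set.toFinite _)
    simp only [List.coe_toFinset, List.mem_filter, Set.mem_ofPred_eq] at hu
    obtain ⟨_, hu, h⟩ := adj_iff_exists.1 hu.2
    exact ⟨⟨u, hu⟩, h, rfl⟩
  · rw [List.countP_eq_zero.2]
    · exact Nat.zero_le _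
    · intro u _ h
      exact hx (adj_iff_exists.1 h).1

lemma sz_foldl_extendRows_le {W : ℕ} (hI : ∀ v, (I.graph.neighborSet v).ncard ≤ W) (x : ℕ) {m : ℕ}
    (hm : m ≤ I.n) : sz ((List.range m).foldl (extendRows I x) [[]]) ≤
      (labCount I + 1) ^ W * (I.n * (labBound I + 1) + 2) + 1 := by
  refine (sz_list_le (B := I.n * (labBound I + 1) + 1) fun r hr => ?_).trans ?_
  · obtain ⟨h1, h2⟩ := mem_foldl_extendRows.1 hr
    refine (sz_row_le h1 h2).trans ?_
    gcongr
  · rw [length_foldl_extendRows]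
    refine Nat.add_le_add_right (Nat.mul_le_mul ?_ le_rfl) 1
    exact (Nat.pow_le_pow_left (Nat.le_succ _) _).trans
      (Nat.pow_le_pow_right (Nat.succ_pos _) (countP_adj_le hI x m))

end Sizes

/-! ### The number of keys -/

section Count

variable {W : ℕ} {w : ℕ → ℕ} {I : Inst} {M N : Item}

lemma card_filter_card_le {α : Type*} [DecidableEq α] (U : Finset α) (W : ℕ) :
    (U.powerset.filter fun s => s.card ≤ W).card ≤ (W + 1) * (U.card + 1) ^ W := by
  have : (U.powerset.filter fun s => s.card ≤ W) ⊆
      (Finset.range (W + 1)).biUnion fun j => U.powersetCard j := by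
    intro s hs
    simp only [Finset.mem_filter, Finset.mem_powerset] at hs
    simp only [Finset.mem_biUnion, Finset.mem_range, Finset.mem_powersetCard]
    exact ⟨s.card, by omega, hs.1, rfl⟩
  refine (Finset.card_le_card this).trans (Finset.card_biUnion_le.trans ?_)
  refine (Finset.sum_le_card_nsmul _ _ ((U.card + 1) ^ W) fun j hj => ?_).trans (by simp)
  rw [Finset.card_powersetCard]
  refine (Nat.choose_le_pow _ _).trans ((Nat.pow_le_pow_left (Nat.le_succ _) _).trans ?_)
  exact Nat.pow_le_pow_right (Nat.succ_pos _) (by simp at hj; omega)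

/-- The boundary of the set of vertices of an item, with its labels. -/
noncomputable def bdLab (I : Inst) (M : Item) : Finset ((Fin I.n × Fin I.n) × Lab) :=
  (bd I.graph (supp I M)).image fun x => (x, M.lab x.1 x.2)

lemma mem_bdLab {x : Fin I.n × Fin I.n} {l : Lab} :
    (x, l) ∈ bdLab I M ↔ x ∈ bd I.graph (supp I M) ∧ l = M.lab x.1 x.2 := by
  simp only [bdLab, Finset.mem_image, Prod.mk.injEq]
  exact ⟨by rintro ⟨y, hy, rfl, rfl⟩; exact ⟨hy, rfl⟩, fun ⟨h, h'⟩ => ⟨x, h, rfl, h'.symm⟩⟩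

lemma lab_mem_choices (hM : Valid I M) {u : Fin I.n} (hu : u ∈ supp I M) (v : Fin I.n) :
    M.lab u v ∈ choices I u v := (mem_rows.1 (hM.row u hu)).2.1 v

/-- In a connected graph, a set of vertices is determined by its boundary and one vertex. -/
lemma eq_of_bd_eq {V : Type*} [Fintype V] {G : SimpleGraph V} (hG : G.Connected)
    {S S' : Finset V} (h : bd G S = bd G S') {r : V} (hr : r ∈ S ↔ r ∈ S') : S = S' := by
  ext u
  obtain ⟨p⟩ := hG.preconnected r u
  induction p with
  | nil => exact hr
  | @cons a b _ hab p ih =>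
    refine ih ?_
    -- An edge that separates a set from its complement appears in the boundary in exactly one
    -- orientation. Hence both sets change sides at the same edges of a walk from `r`.
    have h1 := Finset.ext_iff.1 h (a, b)
    have h2 := Finset.ext_iff.1 h (b, a)
    simp only [mem_bd, hab, hab.symm, true_and] at h1 h2
    tauto

/-- Boundary edges and the root bit fix the set. Pairs of nonadjacent vertices all have the label
`(0, 0, 0)`, so they add nothing to the key. -/
lemma sameKey_of_bdLab_eq (hM : Valid I M) (hN : Valid I N) (h : bdLab I M = bdLab I N)
    (hr : M.has I.root = N.has I.root) : sameKey I M N = true := by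
  have hbd : bd I.graph (supp I M) = bd I.graph (supp I N) := by
    ext x
    have h1 := Finset.ext_iff.1 h (x, M.lab x.1 x.2)
    have h2 := Finset.ext_iff.1 h (x, N.lab x.1 x.2)
    simp only [mem_bdLab] at h1 h2
    tauto
  have hs := eq_of_bd_eq I.connected hbd (r := I.root) (by simp [mem_supp, hr])
  refine sameKey_iff.2 ⟨hs, fun u hu v hv => ?_⟩
  by_cases ha : I.graph.Adj u v
  · have h1 := Finset.ext_iff.1 h ((u, v), M.lab u v)
    rw [mem_bdLab, mem_bdLab] at h1
    exact (h1.1 ⟨mem_bd.2 ⟨ha, hu, hv⟩, rfl⟩).2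
  · have h1 := lab_mem_choices hM hu v
    have h2 := lab_mem_choices hN (hs ▸ hu) v
    rw [mem_choices, if_neg (by rwa [adj_iff])] at h1 h2
    rw [h1, h2]

/-- Items in a table have different keys, and a key is coded by the root bit (the factor `2`) and a
set of at most `W` of the `n * n * labCount` possible labelled pairs. -/
lemma length_table_le (W : ℕ) (w : ℕ → ℕ) (I : Inst) (i : ℕ) : (table W w I i).length ≤
    2 * ((W + 1) * (I.n * I.n * labCount I + 1) ^ W) := by
  classical
  let U : Finset ((Fin I.n × Fin I.n) × Lab) :=
    Finset.univ ×ˢ (edgeLabels I.k I.n).toFinset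
  have hU : U.card ≤ I.n * I.n * labCount I := by
    simp only [U, Finset.card_product, Finset.card_univ, Fintype.card_prod, Fintype.card_fin]
    gcongr
    refine (List.toFinset_card_le _).trans (le_of_eq ?_)
    simp [edgeLabels, labCount, List.length_flatMap]
  let code : Item → Bool × Finset ((Fin I.n × Fin I.n) × Lab) := fun M =>
    (M.has I.root, bdLab I M)
  have hnd : ((table W w I i).map code).Nodup := by
    rw [List.Nodup, List.pairwise_map]
    refine (pairwise_table i).imp_of_mem fun {M N} hM hN hne heq => hne ?_
    simp only [code, Prod.mk.injEq] at heq
    exact sameKey_of_bdLab_eq (of_mem_table hM).1 (of_mem_table hN).1 heq.2 heq.1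
  have hsub : ((table W w I i).map code).toFinset ⊆
      Finset.univ ×ˢ (U.powerset.filter fun s => s.card ≤ W) := by
    intro y hy
    simp only [List.mem_toFinset, List.mem_map] at hy
    obtain ⟨M, hM, rfl⟩ := hy
    obtain ⟨hv, hw⟩ := of_mem_table hM
    simp only [code, Finset.mem_product, Finset.mem_univ, true_and, Finset.mem_filter,
      Finset.mem_powerset]
    refine ⟨fun ⟨x, l⟩ hx => ?_, Finset.card_image_le.trans (width_eq (I := I) ▸ hw)⟩
    obtain ⟨hxb, rfl⟩ := mem_bdLab.1 hx
    replace hx := mem_bd.1 hxb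
    have := lab_mem_choices hv hx.2.1 x.2
    rw [mem_choices, if_pos (adj_iff.2 hx.1)] at this
    simp [U, mem_edgeLabels, this]
  have := Finset.card_le_card hsub
  rw [List.toFinset_card_of_nodup hnd, List.length_map, Finset.card_product, Finset.card_univ,
    Fintype.card_bool] at this
  refine this.trans (Nat.mul_le_mul_left _ ((card_filter_card_le U W).trans ?_))
  gcongr

lemma sz_table_le (W : ℕ) (w : ℕ → ℕ) (I : Inst) (i : ℕ) : sz (table W w I i) ≤
    2 * ((W + 1) * (I.n * I.n * labCount I + 1) ^ W) *
      (I.n * (I.n * (labBound I + 1) + 2) + 2) + 1 := by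
  refine (sz_list_le fun M hM => sz_item_le (of_mem_table hM).1).trans ?_
  have := length_table_le W w I i
  gcongr

end Count

/-- The instances with degrees at most `W`. -/
abbrev DegLe (W : ℕ) : Type := {I : Inst // ∀ v, (I.graph.neighborSet v).ncard ≤ W}

/-! ### Polynomial time for the whole algorithm -/

section Time

variable {W : ℕ} {w : ℕ → ℕ} {α : Type} [Enc α] {I : α → Inst}

lemma PolyBdd.n (hI : PolyTime I) : PolyBdd fun a => (I a).n :=
  (PolyTime.n hI).sz_bdd.mono fun a => by simp; omega

lemma PolyBdd.k (hI : PolyTime I) : PolyBdd fun a => (I a).k :=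
  (PolyTime.k' hI).sz_bdd.mono fun a => by simp; omega

lemma PolyBdd.labBound (hI : PolyTime I) : PolyBdd fun a => labBound (I a) :=
  (((const 2).mul (k hI)).add ((const 4).mul (n hI))).add (const 5)

lemma PolyBdd.labCount (hI : PolyTime I) : PolyBdd fun a => labCount (I a) :=
  (k hI).mul (((n hI).add (const 1)).mul ((n hI).add (const 1)))

lemma PolyTime.allRows : PolyTime fun x : DegLe W × ℕ => allRows x.1.1 x.2 := by
  have hI : PolyTime fun x : DegLe W × ℕ => x.1.1 := val (fst id)
  refine foldl_of_bdd (step := fun (x : DegLe W × ℕ) rs u => ReloadCost.extendRows x.1.1 x.2 rs u)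
    (range (n hI)) (cons const_nil const_nil)
    (extendRows (val (fst (fst id))) (by fun_prop) (by fun_prop) (by fun_prop))
    (B := fun x => (ReloadCost.labCount x.1.1 + 1) ^ W *
      (x.1.1.n * (ReloadCost.labBound x.1.1 + 1) + 2) + 1)
    (((((PolyBdd.labCount hI).add (.const 1)).pow W).mul
      (((PolyBdd.n hI).mul ((PolyBdd.labBound hI).add (.const 1))).add (.const 2))).add (.const 1))
    fun x l' hl' => ?_
  have hlen : l'.length ≤ x.1.1.n := by simpa using hl'.length_le
  have : l' = List.range l'.length := by
    have := List.prefix_iff_eq_take.1 hl'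
    rwa [List.take_range, min_eq_left hlen] at this
  rw [this]
  exact sz_foldl_extendRows_le x.1.2 x.2 hlen

lemma PolyTime.rows : PolyTime fun x : DegLe W × ℕ => rows x.1.1 x.2 := by
  have h := PolyTime.allRows (W := W)
  refine filter h (and (colOK ?_ ?_ ?_) (flowOK ?_ ?_ ?_)) <;> fun_prop

lemma PolyTime.baseItems : PolyTime fun I : DegLe W => baseItems I.1 := by
  unfold ReloadCost.baseItems
  have h := PolyTime.rows (W := W)
  refine flatMap (by fun_prop) (map h ?_)
  fun_prop

/-- The degree promise is needed only to enumerate the rows of single vertices; the later tables are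
small on every instance, thanks to the width bound. -/
lemma PolyTime.solve (hw : PolyTime w) : PolyTime fun I : DegLe W => solve W w I.1 := by
  have hI : PolyTime fun I : DegLe W => I.1 := val id
  have hT : PolyTime fun I : DegLe W => table W w I.1 I.1.n := by
    refine iterate_of_bdd (step := fun (I : DegLe W) T => ReloadCost.round W w I.1 T) (n hI)
      (prune hw hI baseItems) (by fun_prop)
      (B := fun I => 2 * ((W + 1) * (I.1.n * I.1.n * ReloadCost.labCount I.1 + 1) ^ W) *
        (I.1.n * (I.1.n * (ReloadCost.labBound I.1 + 1) + 2) + 2) + 1) ?_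
      fun I i => sz_table_le W w I.1 i
    have hn := PolyBdd.n hI
    refine .add (.mul (.mul (.const 2) (.mul (.const _) (.pow (.add (.mul (.mul hn hn) ?_)
      (.const 1)) W))) (.add (.mul hn (.add (.mul hn (.add ?_ (.const 1))) (.const 2)))
      (.const 2))) (.const 1)
    · exact PolyBdd.labCount hI
    · exact PolyBdd.labBound hI
  unfold ReloadCost.solve
  fun_prop

end Time

/-! ## Blocks, and sets with small boundary -/

section Graph

variable {V : Type*} {G : SimpleGraph V}

/-- `a` and `b` are connected by a walk in `G` whose vertices after `a` are in `S`, as well as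
those before `b`. -/
def Linked (G : SimpleGraph V) (S : Set V) : V → V → Prop :=
  Relation.ReflTransGen fun x y => G.Adj x y ∧ x ∈ S ∧ y ∈ S

namespace Linked

variable {S S' : Set V} {a b c : V}

lemma refl : Linked G S a a := Relation.ReflTransGen.refl

lemma of_adj (h : G.Adj a b) (ha : a ∈ S) (hb : b ∈ S) : Linked G S a b :=
  Relation.ReflTransGen.single ⟨h, ha, hb⟩

lemma trans (h : Linked G S a b) (h' : Linked G S b c) : Linked G S a c :=
  Relation.ReflTransGen.trans h h'

lemma symm (h : Linked G S a b) : Linked G S b a :=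
  have : Std.Symm fun x y => G.Adj x y ∧ x ∈ S ∧ y ∈ S := ⟨fun _ _ h => ⟨h.1.symm, h.2.2, h.2.1⟩⟩
  Relation.ReflTransGen.stdSymm.symm _ _ h

lemma mono (h : Linked G S a b) (hS : S ⊆ S') : Linked G S' a b :=
  Relation.ReflTransGen.mono (fun _ _ h => ⟨h.1, hS h.2.1, hS h.2.2⟩) _ _ h

lemma of_walk (p : G.Walk a b) (hp : ∀ x ∈ p.support, x ∈ S) : Linked G S a b := by
  induction p with
  | nil => exact refl
  | cons h p ih =>
    simp only [SimpleGraph.Walk.support_cons, List.mem_cons, forall_eq_or_imp] at hp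
    exact (of_adj h hp.1 (hp.2 _ p.start_mem_support)).trans (ih hp.2)

lemma exists_walk (h : Linked G S a b) (ha : a ∈ S) :
    ∃ p : G.Walk a b, ∀ x ∈ p.support, x ∈ S := by
  induction h using Relation.ReflTransGen.head_induction_on with
  | refl => exact ⟨.nil, by simpa using ha⟩
  | head h _ ih =>
    obtain ⟨p, hp⟩ := ih h.2.2
    exact ⟨.cons h.1 p, by simpa using ⟨ha, hp⟩⟩

lemma exists_path (h : Linked G S a b) (ha : a ∈ S) :
    ∃ p : G.Walk a b, p.IsPath ∧ ∀ x ∈ p.support, x ∈ S := by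
  classical
  obtain ⟨p, hp⟩ := h.exists_walk ha
  exact ⟨p.bypass, p.bypass_isPath, fun x hx => hp x (p.support_bypass_subset_support hx)⟩

lemma mem (h : Linked G S a b) (ha : a ∈ S) : b ∈ S := by
  obtain ⟨p, hp⟩ := h.exists_walk ha
  exact hp _ p.end_mem_support

end Linked

/-- Any two vertices of `S` are connected within `S`. -/
def Conn (G : SimpleGraph V) (S : Set V) : Prop := ∀ a ∈ S, ∀ b ∈ S, Linked G S a b

/-- Embeddings are used instead of sets so that an induced subgraph of an induced subgraph is
covered too, as in the definition of a block. -/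
lemma preconnected_comap_iff {U : Type*} (f : U ↪ V) :
    (G.comap f).Preconnected ↔ Conn G (Set.range f) := by
  constructor
  · rintro h _ ⟨a, rfl⟩ _ ⟨b, rfl⟩
    have := (SimpleGraph.reachable_iff_reflTransGen a b).1 (h a b)
    exact Relation.ReflTransGen.lift f (fun x y h => ⟨h, ⟨x, rfl⟩, ⟨y, rfl⟩⟩) _ _ this
  · intro h a b
    have key : ∀ b', Linked G (Set.range f) (f a) b' → ∀ b, f b = b' →
        (G.comap f).Reachable a b := by
      intro b' hb'
      induction hb' with
      | refl => rintro b hb; rw [f.injective hb]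
      | tail _ hs ih =>
        rintro b rfl
        obtain ⟨c, rfl⟩ := hs.2.1
        have hadj : (G.comap f).Adj c b := hs.1
        exact (ih c rfl).trans hadj.reachable
    exact key _ (h _ ⟨a, rfl⟩ _ ⟨b, rfl⟩) b rfl

lemma preconnected_induce_iff {S : Set V} : (G.induce S).Preconnected ↔ Conn G S := by
  rw [SimpleGraph.induce, preconnected_comap_iff]
  simp

lemma isBiconnected_iff {S : Set V} : IsBiconnected (G.induce S) ↔
    S.Nonempty ∧ Conn G S ∧ ∀ v ∈ S, Conn G (S \ {v}) := by
  rw [IsBiconnected, SimpleGraph.connected_iff, preconnected_induce_iff, Set.nonempty_coe_sort]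
  have : ∀ v : S, ¬ IsCutVertex (G.induce S) v ↔ Conn G (S \ {(v : V)}) := by
    intro v
    let f : ({v}ᶜ : Set S) ↪ V := (Function.Embedding.subtype _).trans (.subtype _)
    have h1 : (G.induce S).induce {v}ᶜ = G.comap f := rfl
    have h2 : Set.range f = S \ {(v : V)} := by
      ext x
      simp only [f, Set.mem_range, Function.Embedding.trans_apply,
        Function.Embedding.subtype_apply, Set.mem_sdiff, Set.mem_singleton_iff]
      constructor
      · rintro ⟨y, rfl⟩
        exact ⟨y.1.2, fun h => y.2 (Subtype.ext h)⟩
      · rintro ⟨hx, hv⟩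
        exact ⟨⟨⟨x, hx⟩, fun h => hv (congrArg Subtype.val h)⟩, rfl⟩
    rw [IsCutVertex, not_not, h1, preconnected_comap_iff, h2]
  simp only [this, Subtype.forall]
  tauto

/-- Adding a path between two vertices keeps a set biconnected. -/
lemma isBiconnected_union_support {B : Set V} (hB : IsBiconnected (G.induce B)) {a b : V}
    (ha : a ∈ B) (hb : b ∈ B) (p : G.Walk a b) (hp : p.IsPath) :
    IsBiconnected (G.induce (B ∪ {x | x ∈ p.support})) := by
  classical
  rw [isBiconnected_iff] at *
  obtain ⟨hne, hc, hcut⟩ := hB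
  have hcut' : ∀ v, Conn G (B \ {v}) := fun v => by
    by_cases hv : v ∈ B
    · exact hcut v hv
    · rwa [Set.sdiff_singleton_eq_self hv]
  have aux : ∀ B' S' : Set V, B' ⊆ S' → Conn G B' → (∀ u ∈ S', ∃ z ∈ B', Linked G S' u z) →
      Conn G S' := by
    intro B' S' hs hB' h u hu v hv
    obtain ⟨z, hz, huz⟩ := h u hu
    obtain ⟨y, hy, hvy⟩ := h v hv
    exact (huz.trans ((hB' z hz y hy).mono hs)).trans hvy.symm
  refine ⟨hne.mono Set.subset_union_left, aux B _ Set.subset_union_left hc fun u hu => ?_,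
    fun w _ => aux (B \ {w}) _ (Set.sdiff_subset_sdiff_left Set.subset_union_left) (hcut' w)
      fun u hu => ?_⟩
  · rcases hu with hu | hu
    · exact ⟨u, hu, .refl⟩
    · refine ⟨a, ha, (Linked.of_walk (p.takeUntil u hu) fun x hx => .inr ?_).symm⟩
      exact p.support_takeUntil_subset_support hu hx
  · obtain ⟨hu | hu, hw⟩ := hu
    · exact ⟨u, ⟨hu, hw⟩, .refl⟩
    · have hu : u ∈ p.support := hu
      -- A deleted vertex `w ≠ u` lies on only one side of `u` along the path, so the other side
      -- still leads from `u` to an end in `B`.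
      have hnd : (p.takeUntil u hu).support.Disjoint (p.dropUntil u hu).support.tail := by
        have := hp.support_nodup
        rw [← p.take_spec hu, SimpleGraph.Walk.support_append] at this
        exact (List.nodup_append'.1 this).2.2
      by_cases h : w ∈ (p.takeUntil u hu).support
      · have hw' : w ∉ (p.dropUntil u hu).support := by
          rw [← SimpleGraph.Walk.cons_tail_support, List.mem_cons, not_or]
          exact ⟨fun h => hw h.symm, hnd h⟩
        refine ⟨b, ⟨hb, ?_⟩, Linked.of_walk (p.dropUntil u hu) fun x hx => ⟨.inr ?_, ?_⟩⟩
        · rintro rfl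
          exact hw' (SimpleGraph.Walk.end_mem_support _)
        · exact p.support_dropUntil_subset_support hu hx
        · rintro rfl
          exact hw' hx
      · refine ⟨a, ⟨ha, ?_⟩, Linked.symm (Linked.of_walk (p.takeUntil u hu) fun x hx =>
          ⟨.inr ?_, ?_⟩)⟩
        · rintro rfl
          exact h (SimpleGraph.Walk.start_mem_support _)
        · exact p.support_takeUntil_subset_support hu hx
        · rintro rfl
          exact h hx

/-- By maximality: a path between two vertices of a block could otherwise be added to it. -/
lemma IsBlock.support_subset {B : Set V} (hB : IsBlock G B) {a b : V} (ha : a ∈ B) (hb : b ∈ B)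
    {p : G.Walk a b} (hp : p.IsPath) : ∀ x ∈ p.support, x ∈ B := fun _ hx =>
  hB.le_of_ge (isBiconnected_union_support hB.1 ha hb p hp) Set.subset_union_left (.inr hx)

lemma isBiconnected_pair {a b : V} (h : G.Adj a b) :
    IsBiconnected (G.induce ({a, b} : Set V)) := by
  rw [isBiconnected_iff]
  have hs : ∀ v x : V, Conn G {x} := by
    rintro v x _ rfl _ rfl
    exact .refl
  refine ⟨⟨a, by simp⟩, ?_, ?_⟩
  · have : Linked G {a, b} a b := .of_adj h (by simp) (by simp)
    rintro x (rfl | rfl) y (rfl | rfl)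
    exacts [.refl, this, this.symm, .refl]
  · have hd : Conn G ({a, b} \ {a}) := by
      rw [show ({a, b} \ {a} : Set V) = {b} by
        ext x; have := h.ne; simp only [Set.mem_sdiff, Set.mem_insert_iff, Set.mem_singleton_iff]
        grind]
      exact hs a b
    have hd' : Conn G ({a, b} \ {b}) := by
      rw [show ({a, b} \ {b} : Set V) = {a} by
        ext x; have := h.ne; simp only [Set.mem_sdiff, Set.mem_insert_iff, Set.mem_singleton_iff]
        grind]
      exact hs a a
    rintro v (rfl | rfl)
    exacts [hd, hd']

lemma exists_isBlock [Finite V] {a b : V} (h : G.Adj a b) : ∃ B, IsBlock G B ∧ a ∈ B ∧ b ∈ B := by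
  obtain ⟨B, hle, hB⟩ := (Set.toFinite {S : Set V | IsBiconnected (G.induce S)}).exists_le_maximal
    (isBiconnected_pair h)
  exact ⟨B, hB, hle (by simp), hle (by simp)⟩

/-- The edges with both ends in `S`. -/
def edgesIn (G : SimpleGraph V) (S : Set V) : Set (Sym2 V) := {e ∈ G.edgeSet | ∀ x ∈ e, x ∈ S}

lemma ncard_edgesIn (S : Set V) : (edgesIn G S).ncard = (G.induce S).edgeSet.ncard := by
  have : edgesIn G S = Sym2.map Subtype.val '' (G.induce S).edgeSet := by
    ext e
    constructor
    · rintro ⟨he, hS⟩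
      induction e with | _ x y
      exact ⟨s(⟨x, hS x (by simp)⟩, ⟨y, hS y (by simp)⟩), he, rfl⟩
    · rintro ⟨e, he, rfl⟩
      induction e with | _ x y
      exact ⟨he, by simp⟩
  rw [this, Set.ncard_image_of_injective _ (Sym2.map.injective Subtype.val_injective)]

lemma ncard_le_edgesIn [Finite V] {S : Set V} (hS : Conn G S) : S.ncard ≤ (edgesIn G S).ncard + 1 := by
  rcases S.eq_empty_or_nonempty with rfl | hne
  · simp
  · have hc : (G.induce S).Connected := by
      rw [SimpleGraph.connected_iff, preconnected_induce_iff, Set.nonempty_coe_sort]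
      exact ⟨hS, hne⟩
    have := hc.card_vert_le_card_edgeSet_add_one
    rwa [Nat.card_coe_set_eq, Nat.card_coe_set_eq, ← ncard_edgesIn] at this

variable [Fintype V] {c D : ℕ}

/-- If a set and its complement are connected, then all edges between them are in one block, and
their number is bounded. -/
lemma card_bd_le (hG : ∀ B, IsBlock G B →
      ((G.induce B).edgeSet.ncard : ℤ) - B.ncard ≤ c)
    {A : Finset V} (hA : Conn G A) (hA' : Conn G (A : Set V)ᶜ) : (bd G A).card ≤ c + 2 := by
  rcases (bd G A).eq_empty_or_nonempty with h | ⟨⟨x, y⟩, hxy⟩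
  · simp [h]
  obtain ⟨hadj, hx, hy⟩ := mem_bd.1 hxy
  obtain ⟨B, hB, hxB, hyB⟩ := exists_isBlock hadj
  have hbdB : ∀ z ∈ bd G A, z.1 ∈ B ∧ z.2 ∈ B := by
    intro z hz
    obtain ⟨ha, h1, h2⟩ := mem_bd.1 hz
    obtain ⟨p, hp, hpA⟩ := (hA x hx z.1 h1).exists_path hx
    obtain ⟨q, hq, hqA⟩ := (hA' z.2 h2 y hy).exists_path h2
    -- Fix one boundary edge `xy`. Any other one lies on a path from `x` to `y` that runs inside
    -- `A`, crosses once and returns inside the complement; this path stays in the block of `xy`.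
    have hpath : (p.append (.cons ha q)).IsPath := by
      rw [SimpleGraph.Walk.isPath_def, SimpleGraph.Walk.support_append,
        SimpleGraph.Walk.support_cons, List.tail_cons, List.nodup_append']
      exact ⟨hp.support_nodup, hq.support_nodup, fun w hw hw' => hqA w hw' (hpA w hw)⟩
    have hsub := hB.support_subset hxB hyB hpath
    exact ⟨hsub _ (by simp), hsub _ (by simp)⟩
  -- A path in `S` between two vertices of the block cannot leave the block.
  have hconn : ∀ S : Set V, Conn G S → Conn G (B ∩ S) := by
    intro S hS a ha b hb
    obtain ⟨p, hp, hpS⟩ := (hS a ha.2 b hb.2).exists_path ha.2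
    exact .of_walk p fun x hx => ⟨hB.support_subset ha.1 hb.1 hp x hx, hpS x hx⟩
  have h1 := ncard_le_edgesIn (hconn _ hA)
  have h2 := ncard_le_edgesIn (hconn _ hA')
  have h3 : (B ∩ A).ncard + (B ∩ (A : Set V)ᶜ).ncard = B.ncard := by
    rw [← Set.sdiff_eq, Set.ncard_inter_add_ncard_sdiff_eq_ncard B A (Set.toFinite B)]
  let E : Set (Sym2 V) := (fun z : V × V => s(z.1, z.2)) '' (bd G A : Set (V × V))
  have hE : E.ncard = (bd G A).card := by
    rw [Set.InjOn.ncard_image, Set.ncard_coe_finset]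
    intro z hz z' hz' h
    obtain ⟨-, h1, h2⟩ := mem_bd.1 hz
    obtain ⟨-, h1', h2'⟩ := mem_bd.1 hz'
    rcases Sym2.eq_iff.1 h with ⟨h, h'⟩ | ⟨h, h'⟩
    · exact Prod.ext h h'
    · exact absurd (h ▸ h1) h2'
  have hd1 : Disjoint (edgesIn G (B ∩ A)) (edgesIn G (B ∩ (A : Set V)ᶜ)) := by
    rw [Set.disjoint_left]
    rintro e ⟨-, h⟩ ⟨-, h'⟩
    induction e with | _ a b
    exact (h' a (by simp)).2 (h a (by simp)).2
  have hd2 : Disjoint (edgesIn G (B ∩ A) ∪ edgesIn G (B ∩ (A : Set V)ᶜ)) E := by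
    rw [Set.disjoint_right]
    rintro _ ⟨z, hz, rfl⟩ h
    obtain ⟨-, h1, h2⟩ := mem_bd.1 hz
    rcases h with ⟨-, h⟩ | ⟨-, h⟩
    · exact h2 (h z.2 (by simp)).2
    · exact (h z.1 (by simp)).2 h1
  have hsub : edgesIn G (B ∩ A) ∪ edgesIn G (B ∩ (A : Set V)ᶜ) ∪ E ⊆ edgesIn G B := by
    rintro e ((⟨he, h⟩ | ⟨he, h⟩) | ⟨z, hz, rfl⟩)
    · exact ⟨he, fun x hx => (h x hx).1⟩
    · exact ⟨he, fun x hx => (h x hx).1⟩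
    · refine ⟨(mem_bd.1 hz).1, fun x hx => ?_⟩
      rcases Sym2.mem_iff.1 hx with rfl | rfl
      exacts [(hbdB z hz).1, (hbdB z hz).2]
  -- The two connected parts of `B` have at least `|B ∩ A| - 1` and `|B \ A| - 1` edges. Together
  -- with the boundary these are at most `|E(B)| ≤ |B| + c`, which leaves `c + 2` for the boundary.
  have h4 := Set.ncard_le_ncard hsub (Set.toFinite _)
  rw [Set.ncard_union_eq hd2 (Set.toFinite _) (Set.toFinite _),
    Set.ncard_union_eq hd1 (Set.toFinite _) (Set.toFinite _), hE, ncard_edgesIn B] at h4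
  have h5 := hG B hB
  omega

lemma card_bd_singleton [DecidableEq V] (v : V) :
    (bd G {v}).card = (G.neighborSet v).ncard := by
  have : (bd G {v} : Set (V × V)) = (fun u => (v, u)) '' G.neighborSet v := by
    ext ⟨a, b⟩
    simp only [Finset.mem_coe, mem_bd, Finset.mem_singleton, Set.mem_image,
      SimpleGraph.mem_neighborSet, Prod.mk.injEq]
    constructor
    · rintro ⟨h, rfl, -⟩
      exact ⟨b, h, rfl, rfl⟩
    · rintro ⟨_, h, rfl, rfl⟩
      exact ⟨h, rfl, h.ne'⟩
  rw [← Set.ncard_coe_finset, this, Set.ncard_image_of_injective _ (Prod.mk_right_injective v)]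

/-- A connected set with connected complement is derivable. -/
lemma derivable_of_conn [DecidableEq V] (hGc : G.Connected)
    (hG : ∀ A : Finset V, Conn G A → Conn G (A : Set V)ᶜ → (bd G A).card ≤ c)
    (hD : ∀ v, (bd G {v}).card ≤ D) {S : Finset V} (hne : S.Nonempty) (hS : Conn G S)
    (hS' : Conn G (S : Set V)ᶜ) : Derivable G (c + D) S := by
  classical
  induction hn : S.card using Nat.strong_induction_on generalizing S with | _ n ih
  -- If the complement is nonempty, `v` is chosen next to it; then the vertices outside `S` stay
  -- connected to `v` when the rest of `S` is avoided.
  obtain ⟨v, hv, hvS⟩ : ∃ v ∈ S, ∀ z ∉ S, Linked G ((S : Set V)ᶜ ∪ {v}) z v := by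
    by_cases h : ∃ y, y ∉ S
    · obtain ⟨y, hy⟩ := h
      obtain ⟨x, hx⟩ := hne
      obtain ⟨p⟩ := hGc.preconnected x y
      obtain ⟨d, -, hd, hd'⟩ := p.exists_boundary_dart S hx hy
      refine ⟨d.fst, hd, fun z hz => ?_⟩
      refine ((hS' z hz d.snd hd').mono Set.subset_union_left).trans ?_
      exact .of_adj d.adj.symm (.inl hd') (.inr rfl)
    · push Not at h
      obtain ⟨x, hx⟩ := hne
      exact ⟨x, hx, fun z hz => absurd (h z) hz⟩
  let comp : V → Finset V := fun a => Finset.univ.filter fun u => Linked G (S \ {v}) a u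
  have hcomp : ∀ {a u}, u ∈ comp a ↔ Linked G (S \ {v}) a u := by simp [comp]
  have hsub : ∀ {a u}, a ∈ S → a ≠ v → u ∈ comp a → u ∈ S ∧ u ≠ v := fun ha hav hu =>
    (hcomp.1 hu).mem (S := S \ {v}) ⟨ha, hav⟩
  have hstep : ∀ {a u u'}, a ∈ S → a ≠ v → u ∈ comp a → G.Adj u u' → u' ∈ S → u' ≠ v →
      u' ∈ comp a := fun ha hav hu huu h h' =>
    hcomp.2 ((hcomp.1 hu).trans (.of_adj huu (hsub ha hav hu) ⟨h, h'⟩))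
  have hcompDer : ∀ a ∈ S, a ≠ v → Derivable G (c + D) (comp a) := by
    intro a ha hav
    have hva : v ∉ comp a := fun h => (hsub ha hav h).2 rfl
    have hc : Conn G (comp a) := by
      have h : ∀ u ∈ comp a, Linked G (comp a) a u := by
        intro u hu
        rw [hcomp] at hu
        induction hu with
        | refl => exact .refl
        | tail h hs ih =>
          exact ih.trans (.of_adj hs.1 (hcomp.2 h) (hcomp.2 (h.tail hs)))
      exact fun u hu u' hu' => (h u hu).symm.trans (h u' hu')
    -- Everything outside a component reaches `v` without entering it: inside `S` a walk can pass to
    -- another component only through `v`, and outside `S` the choice of `v` applies.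
    have hc' : Conn G (comp a : Set V)ᶜ := by
      have h : ∀ z, z ∉ comp a → Linked G (comp a : Set V)ᶜ z v := by
        intro z hz
        by_cases hzS : z ∈ S
        · have hlink := hS z hzS v hv
          induction hlink using Relation.ReflTransGen.head_induction_on with
          | refl => exact .refl
          | @head z z' h _ ih =>
            by_cases hzv : z = v
            · rw [hzv]; exact .refl
            · have hz' : z' ∉ comp a := fun h' => hz (hstep ha hav h' h.1.symm hzS hzv)
              exact (Linked.of_adj h.1 hz hz').trans (ih hz' h.2.2)
        · refine (hvS z hzS).mono ?_
          rintro u (hu | rfl) hu'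
          · exact hu (hsub ha hav hu').1
          · exact hva hu'
      exact fun u hu u' hu' => (h u hu).trans (h u' hu').symm
    have hlt : (comp a).card < n := by
      rw [← hn]
      refine Finset.card_lt_card ⟨fun u hu => (hsub ha hav hu).1, fun h => hva (h hv)⟩
    exact ih _ hlt ⟨a, hcomp.2 .refl⟩ hc hc' rfl
  -- `T` ranges over unions of components of `S \ {v}`; splitting off one component is the induction
  -- step.
  have key : ∀ T : Finset V, (∀ u ∈ T, u ∈ S ∧ u ≠ v) →
      (∀ u ∈ T, ∀ u' ∈ S, u' ≠ v → G.Adj u u' → u' ∈ T) → Derivable G (c + D) ({v} ∪ T) := by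
    intro T
    induction hm : T.card using Nat.strong_induction_on generalizing T with | _ m ihT
    intro hTS hT
    have hbd : (bd G ({v} ∪ T)).card ≤ c + D := by
      -- An edge that leaves `{v} ∪ T` either leaves `S` or starts at `v`, because no edge joins `T`
      -- to another component. This gives `c + D`.
      have : bd G ({v} ∪ T) ⊆ bd G S ∪ bd G {v} := by
        intro ⟨x, y⟩ h
        obtain ⟨hadj, hx, hy⟩ := mem_bd.1 h
        simp only [Finset.mem_union, Finset.mem_singleton, not_or] at hx hy
        simp only [Finset.mem_union, mem_bd, Finset.mem_singleton]
        by_cases hyS : y ∈ S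
        · rcases hx with rfl | hx
          · exact .inr ⟨hadj, rfl, hy.1⟩
          · exact absurd (hT x hx y hyS hy.1 hadj) hy.2
        · refine .inl ⟨hadj, ?_, hyS⟩
          rcases hx with rfl | hx
          exacts [hv, (hTS x hx).1]
      refine (Finset.card_le_card this).trans ((Finset.card_union_le _ _).trans ?_)
      exact Nat.add_le_add (hG S hS hS') (hD v)
    rcases T.eq_empty_or_nonempty with rfl | ⟨a, ha⟩
    · rw [Finset.union_empty]
      exact .single v ((hD v).trans (Nat.le_add_left _ _))
    · obtain ⟨haS, hav⟩ := hTS a ha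
      have hsubT : comp a ⊆ T := by
        intro u hu
        rw [hcomp] at hu
        induction hu with
        | refl => exact ha
        | tail _ hs ih => exact hT _ ih _ hs.2.2.1 hs.2.2.2 hs.1
      have hlt : (T \ comp a).card < m := by
        rw [← hm]
        exact Finset.card_lt_card ⟨Finset.sdiff_subset, fun h =>
          (Finset.mem_sdiff.1 (h ha)).2 (hcomp.2 .refl)⟩
      have h1 := ihT _ hlt (T \ comp a) rfl (fun u hu => hTS u (Finset.mem_sdiff.1 hu).1)
        fun u hu u' hu' hne hadj => by
          rw [Finset.mem_sdiff] at hu ⊢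
          exact ⟨hT u hu.1 u' hu' hne hadj, fun h => hu.2 (hstep haS hav h hadj.symm
            (hTS u hu.1).1 (hTS u hu.1).2)⟩
      have heq : {v} ∪ T = ({v} ∪ T \ comp a) ∪ comp a := by
        rw [Finset.union_assoc, Finset.sdiff_union_of_subset hsubT]
      rw [heq] at hbd ⊢
      refine .union h1 (hcompDer a haS hav) ?_ hbd
      rw [Finset.disjoint_union_left]
      refine ⟨?_, Finset.sdiff_disjoint⟩
      rw [Finset.disjoint_singleton_left]
      exact fun h => (hsub haS hav h).2 rfl
  have := key (S.erase v) (fun u hu => ⟨Finset.mem_of_mem_erase hu, Finset.ne_of_mem_erase hu⟩)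
    fun u _ u' hu' hne _ => Finset.mem_erase.2 ⟨hne, hu'⟩
  rwa [← Finset.insert_eq, Finset.insert_erase hv] at this

end Graph

/-- If `v` is not a cut vertex, then `{v}` and its complement are connected, and the cut bound is a
degree bound. -/
lemma SparseBlocks.card_bd_singleton_le {c₁ c₂ : ℕ} {I : Inst} (h : SparseBlocks c₁ c₂ I)
    (v : Fin I.n) : (bd I.graph {v}).card ≤ max c₁ (c₂ + 2) := by
  by_cases hv : IsCutVertex I.graph v
  · rw [card_bd_singleton]
    exact (h.1 v hv).trans (le_max_left _ _)
  · rw [IsCutVertex, not_not, preconnected_induce_iff] at hv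
    refine (card_bd_le h.2 ?_ (by simpa using hv)).trans (le_max_right _ _)
    simp only [Finset.coe_singleton]
    rintro _ rfl _ rfl
    exact .refl

lemma SparseBlocks.derivable_univ {c₁ c₂ : ℕ} {I : Inst} (h : SparseBlocks c₁ c₂ I) :
    Derivable I.graph (c₂ + 2 + max c₁ (c₂ + 2)) Finset.univ := by
  refine derivable_of_conn I.connected (fun A hA hA' => card_bd_le h.2 hA hA')
    h.card_bd_singleton_le ⟨I.root, Finset.mem_univ _⟩ ?_ ?_
  · have : Conn I.graph (Set.range (Function.Embedding.refl (Fin I.n))) :=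
      (preconnected_comap_iff _).1 I.connected.preconnected
    rwa [show Set.range (Function.Embedding.refl (Fin I.n)) = Set.univ from Set.range_id,
      ← Finset.coe_univ] at this
  · intro a ha
    simp at ha

/-! ## Rooted trees -/

section Rooted

variable {V : Type*} {T : SimpleGraph V} {r : V} {π : V → V} {h : V → ℕ}

/-- `T` is the tree in which `π` maps each vertex other than the root `r` to its parent; the heights
`h` show that there are no cycles. -/
structure RootedBy (T : SimpleGraph V) (r : V) (π : V → V) (h : V → ℕ) : Prop where
  adj : ∀ u v, T.Adj u v ↔ (u ≠ r ∧ π u = v) ∨ (v ≠ r ∧ π v = u)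
  lt : ∀ u, u ≠ r → h (π u) < h u

namespace RootedBy

lemma adj_parent (hT : RootedBy T r π h) {u : V} (hu : u ≠ r) : T.Adj (π u) u :=
  (hT.adj _ _).2 (.inr ⟨hu, rfl⟩)

/-- Parents have smaller height, so the path to the parent of `v` cannot contain `v` and extends to
it. -/
lemma exists_path (hT : RootedBy T r π h) (v : V) :
    ∃ p : T.Walk r v, p.IsPath ∧ ∀ x ∈ p.support, h x ≤ h v := by
  induction hn : h v using Nat.strong_induction_on generalizing v with | _ n ih
  subst hn
  by_cases hv : v = r
  · subst hv
    exact ⟨.nil, .nil, by simp⟩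
  · obtain ⟨p, hp, hs⟩ := ih _ (hT.lt v hv) (π v) rfl
    have hlt := hT.lt v hv
    refine ⟨p.concat (hT.adj_parent hv), hp.concat (fun hm => ?_) _, fun x hx => ?_⟩
    · have := hs v hm
      omega
    · rw [SimpleGraph.Walk.support_concat, List.mem_append, List.mem_singleton] at hx
      rcases hx with hx | rfl
      · exact (hs x hx).trans hlt.le
      · exact le_rfl

/-- The graph is connected, and each edge joins some non-root vertex to its parent, so there are at
most `|V| - 1` edges. -/
lemma isTree [Finite V] (hT : RootedBy T r π h) : T.IsTree := by
  classical
  have := Fintype.ofFinite V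
  have hc : T.Connected := by
    refine (SimpleGraph.connected_iff_exists_forall_reachable T).2 ⟨r, fun v => ?_⟩
    obtain ⟨p, -⟩ := hT.exists_path v
    exact ⟨p⟩
  rw [SimpleGraph.isTree_iff_connected_and_card]
  refine ⟨hc, le_antisymm ?_ hc.card_vert_le_card_edgeSet_add_one⟩
  have hsub : T.edgeSet ⊆ (fun u => s(u, π u)) '' ((Finset.univ.erase r : Finset V) : Set V) := by
    intro e he
    induction e with | _ u v
    rcases (hT.adj u v).1 he with ⟨hu, rfl⟩ | ⟨hv, rfl⟩
    · exact ⟨u, by simpa using hu, rfl⟩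
    · exact ⟨v, by simpa using hv, Sym2.eq_swap⟩
  have h1 := (Set.ncard_le_ncard hsub (Set.toFinite _)).trans (Set.ncard_image_le (Set.toFinite _))
  rw [Set.ncard_coe_finset, Finset.card_erase_of_mem (Finset.mem_univ r), Finset.card_univ] at h1
  have : 0 < Fintype.card V := Fintype.card_pos_iff.2 ⟨r⟩
  rw [Nat.card_coe_set_eq, Nat.card_eq_fintype_card]
  omega

/-- The sizes of the subtrees of a rooted tree. -/
lemma exists_sizes [Fintype V] [DecidableEq V] (hT : RootedBy T r π h) :
    ∃ s : V → ℕ, (∀ v, 1 ≤ s v) ∧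
    (∀ v, s v ≤ Fintype.card V) ∧
    ∀ v, s v = 1 + ∑ u, if u ≠ r ∧ π u = v then s u else 0 := by
  classical
  let Des : V → V → Prop := Relation.ReflTransGen fun a b => a ≠ r ∧ π a = b
  have hle : ∀ {a b}, Des a b → h b ≤ h a := by
    intro a b hab
    induction hab with
    | refl => exact le_rfl
    | tail _ hs ih =>
      obtain ⟨hr, rfl⟩ := hs
      exact (hT.lt _ hr).le.trans ih
  -- Of two siblings neither is a proper descendant of the other: their common parent would then be
  -- at least as high as one of its children.
  have hdisj : ∀ {u u'}, u' ≠ r → π u = π u' → Des u u' → u = u' := by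
    intro u u' hu' hp hd
    rcases Relation.ReflTransGen.cases_head hd with rfl | ⟨v, ⟨-, rfl⟩, hv⟩
    · rfl
    · have h1 := hle hv
      have h2 := hT.lt u' hu'
      rw [hp] at h1
      omega
  let D : V → Finset V := fun v => Finset.univ.filter fun w => Des w v
  have hD : ∀ v, D v = insert v ((Finset.univ.filter fun u => u ≠ r ∧ π u = v).biUnion D) := by
    intro v
    ext w
    simp only [D, Finset.mem_filter, Finset.mem_univ, true_and, Finset.mem_insert,
      Finset.mem_biUnion]
    rw [show Des w v ↔ _ from Relation.ReflTransGen.cases_tail_iff _ w v, eq_comm]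
    exact or_congr_right (exists_congr fun u => and_comm)
  refine ⟨fun v => (D v).card, fun v => ?_, fun v => Finset.card_le_univ _, fun v => ?_⟩
  · exact Finset.card_pos.2 ⟨v, by rw [hD]; exact Finset.mem_insert_self _ _⟩
  · dsimp only
    rw [hD v, Finset.card_insert_of_notMem, Finset.card_biUnion, Finset.sum_filter, add_comm]
    · intro u hu u' hu' hne
      replace hu : u ≠ r ∧ π u = v := by simpa using hu
      replace hu' : u' ≠ r ∧ π u' = v := by simpa using hu'
      rw [Function.onFun, Finset.disjoint_left]
      intro w hw hw'
      replace hw : Des w u := by simpa [D] using hw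
      replace hw' : Des w u' := by simpa [D] using hw'
      -- Parents are unique, so the ancestors of `w` form a chain. A common descendant of two
      -- siblings would make them comparable.
      have hru : Relator.RightUnique fun a b => a ≠ r ∧ π a = b :=
        fun a b c h h' => h.2.symm.trans h'.2
      rcases Relation.ReflTransGen.total_of_right_unique hru hw hw' with hd | hd
      · exact hne (hdisj hu'.1 (hu.2.trans hu'.2.symm) hd)
      · exact hne (hdisj hu.1 (hu'.2.trans hu.2.symm) hd).symm
    · simp only [Finset.mem_biUnion, Finset.mem_filter, Finset.mem_univ, true_and, D, not_exists,
        not_and]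
      rintro u ⟨hu, rfl⟩ hd
      have := hle hd
      have := hT.lt u hu
      omega

end RootedBy

/-- Each tree has parents and heights. -/
lemma exists_rootedBy (hT : T.IsTree) (r : V) : ∃ π h, RootedBy T r π h := by
  classical
  choose p hp hu using hT.existsUnique_path r
  refine ⟨fun v => (p v).penultimate, fun v => (p v).length, fun u v => ?_, fun u hur => ?_⟩
  · have hadj : ∀ w, w ≠ r → T.Adj (p w).penultimate w := fun w hw =>
      (p w).adj_penultimate (SimpleGraph.Walk.not_nil_of_ne hw.symm)
    constructor
    · intro h
      by_cases hv : v ∈ (p u).support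
      · have := hT.isAcyclic.eq_penultimate_of_adj_end (hp u) h hv
        refine .inl ⟨?_, this.symm⟩
        rintro rfl
        have : p u = .nil := (hu u .nil .nil).symm
        rw [this] at hv
        exact h.ne' (by simpa using hv)
      · have hc := hu v ((p u).concat h) ((hp u).concat hv h)
        refine .inr ⟨?_, ?_⟩
        · rintro rfl
          exact hv (SimpleGraph.Walk.start_mem_support _)
        · rw [← hc, SimpleGraph.Walk.penultimate_concat]
    · rintro (⟨hur, rfl⟩ | ⟨hvr, rfl⟩)
      · exact (hadj u hur).symm
      · exact hadj v hvr
  · have hn : ¬ (p u).Nil := SimpleGraph.Walk.not_nil_of_ne hur.symm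
    have h1 := hu _ _ ((hp u).dropLast)
    have h2 := congrArg SimpleGraph.Walk.length ((p u).concat_dropLast ((p u).adj_penultimate hn))
    rw [SimpleGraph.Walk.length_concat] at h2
    rw [← h1]
    omega

end Rooted

/-! ### The two costs as sums over vertices -/

namespace Solution

variable {I : Inst} {s : Solution I} {π : Fin I.n → Fin I.n} {h : Fin I.n → ℕ}

lemma isPath_path (s : Solution I) (v : Fin I.n) : (s.path v).IsPath :=
  (s.isTree.existsUnique_path I.root v).choose_spec.1

lemma path_eq {v : Fin I.n} {p : s.tree.Walk I.root v} (hp : p.IsPath) : s.path v = p :=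
  (s.isTree.existsUnique_path I.root v).unique (s.isPath_path v) hp

lemma edges_path (hs : RootedBy s.tree I.root π h) {v : Fin I.n} (hv : v ≠ I.root) :
    (s.path v).edges = (s.path (π v)).edges ++ [s(π v, v)] := by
  obtain ⟨p, hp, hle⟩ := hs.exists_path (π v)
  have hc : (p.concat (hs.adj_parent hv)).IsPath := by
    refine hp.concat (fun hm => ?_) _
    have := hle v hm
    have := hs.lt v hv
    omega
  rw [path_eq hp, path_eq hc, SimpleGraph.Walk.edges_concat, List.concat_eq_append]

lemma traversals_root (s : Solution I) : s.traversals I.root = [] := by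
  rw [traversals, path_eq (p := .nil) .nil]
  simp

/-- The last traversal on the path from the root to `v`. -/
def lastTraversal (π : Fin I.n → Fin I.n) (v : Fin I.n) : Sym2 (Fin I.n) × Sym2 (Fin I.n) :=
  (s(π (π v), π v), s(π v, v))

/-- The path to `v` has one edge more than the path to its parent, hence one more traversal, unless
it consists of that single edge. -/
lemma traversals_eq (hs : RootedBy s.tree I.root π h) {v : Fin I.n} (hv : v ≠ I.root) :
    s.traversals v = s.traversals (π v) ++
      if π v = I.root then [] else [lastTraversal π v] := by
  have aux : ∀ {α : Type} (l : List α) (a b : α), (l ++ [a] ++ [b]).zip (l ++ [a] ++ [b]).tail =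
      (l ++ [a]).zip (l ++ [a]).tail ++ [(a, b)] := by
    intro α l a b
    induction l with
    | nil => rfl
    | cons c l ih =>
      cases l with
      | nil => rfl
      | cons d l => simpa using ih
  split_ifs with hr
  · rw [hr, traversals_root, traversals, edges_path hs hv, hr, path_eq (p := .nil) .nil]
    simp
  · rw [traversals, traversals, edges_path hs hv, edges_path hs hr, aux, lastTraversal]

/-- The cost of the last traversal on the path from the root to `v`, if there is one. -/
noncomputable def lastCost (s : Solution I) (π : Fin I.n → Fin I.n) (v : Fin I.n) : ℝ :=
  if v = I.root ∨ π v = I.root then 0 else s.travCost (lastTraversal π v)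

lemma sum_traversals_eq (hs : RootedBy s.tree I.root π h) {v : Fin I.n} (hv : v ≠ I.root) :
    ((s.traversals v).map s.travCost).sum =
      ((s.traversals (π v)).map s.travCost).sum + s.lastCost π v := by
  rw [traversals_eq hs hv, lastCost]
  by_cases hr : π v = I.root <;> simp [hr, hv]

/-- The last traversal on the path to `v` is paid by each of the `m v` vertices in the subtree at
`v`. The proof is a summation by parts along the tree. -/
lemma reloadCost_eq (hs : RootedBy s.tree I.root π h) {m : Fin I.n → ℕ}
    (hm : ∀ v, v ≠ I.root → m v = 1 + ∑ u, if u ≠ I.root ∧ π u = v then m u else 0) :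
    s.reloadCost = ∑ v, m v • s.lastCost π v := by
  set R : Fin I.n → ℝ := fun v => ((s.traversals v).map s.travCost).sum with hR
  have hR0 : R I.root = 0 := by simp [hR, traversals_root]
  have hstep : ∀ v, v ≠ I.root → s.lastCost π v = R v - R (π v) := fun v hv => by
    rw [hR]; dsimp only; rw [sum_traversals_eq hs hv]; ring
  have h1 : ∑ v, m v • s.lastCost π v =
      ∑ v ∈ Finset.univ.erase I.root, ((m v : ℝ) * R v - m v * R (π v)) := by
    rw [← Finset.add_sum_erase _ _ (Finset.mem_univ I.root)]
    rw [show s.lastCost π I.root = 0 by simp [lastCost], smul_zero, zero_add]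
    refine Finset.sum_congr rfl fun v hv => ?_
    rw [hstep v (Finset.ne_of_mem_erase hv), nsmul_eq_mul]
    ring
  -- The sum is regrouped by parents: the sizes of the children of `x` add up to `m x - 1`, and the
  -- root drops out since `R` vanishes there.
  have h2 : ∑ v ∈ Finset.univ.erase I.root, (m v : ℝ) * R (π v) =
      ∑ x ∈ Finset.univ.erase I.root, ((m x : ℝ) - 1) * R x := by
    have h3 : ∀ v ∈ Finset.univ.erase I.root, (m v : ℝ) * R (π v) =
        ∑ x ∈ Finset.univ.erase I.root, if π v = x then (m v : ℝ) * R x else 0 := by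
      intro v _
      rw [Finset.sum_ite_eq]
      split_ifs with h
      · rfl
      · have : π v = I.root := by simpa using h
        rw [this, hR0, mul_zero]
    rw [Finset.sum_congr rfl h3, Finset.sum_comm]
    refine Finset.sum_congr rfl fun x hx => ?_
    rw [hm x (Finset.ne_of_mem_erase hx)]
    push_cast
    rw [add_sub_cancel_left, Finset.sum_mul,
      ← Finset.add_sum_erase Finset.univ _ (Finset.mem_univ I.root)]
    simp only [ne_eq, not_true_eq_false, false_and, if_false, zero_mul, zero_add]
    refine Finset.sum_congr rfl fun v hv => ?_
    simp only [Finset.ne_of_mem_erase hv, not_false_eq_true, true_and, ite_mul, zero_mul]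
  rw [h1, Finset.sum_sub_distrib, h2, ← Finset.sum_sub_distrib, reloadCost]
  refine Finset.sum_congr rfl fun v _ => ?_
  rw [hR]
  ring

/-- A traversal is determined by its lower edge and this edge by its lower end, so the distinct
traversals correspond to the non-root vertices whose parent is not the root. -/
lemma changeoverCost_eq (hs : RootedBy s.tree I.root π h) :
    s.changeoverCost = ∑ v, s.lastCost π v := by
  have hset : ((Finset.univ.erase I.root).biUnion fun v => (s.traversals v).toFinset) =
      (Finset.univ.filter fun v => ¬ (v = I.root ∨ π v = I.root)).image (lastTraversal π) := by
    ext t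
    simp only [Finset.mem_biUnion, List.mem_toFinset, Finset.mem_image, Finset.mem_filter,
      Finset.mem_univ, true_and, Finset.mem_erase, and_true, not_or]
    constructor
    · rintro ⟨v, -, ht⟩
      induction hn : h v using Nat.strong_induction_on generalizing v with | _ n ih
      subst hn
      by_cases hv : v = I.root
      · rw [hv, traversals_root] at ht
        simp at ht
      rw [traversals_eq hs hv, List.mem_append] at ht
      rcases ht with ht | ht
      · exact ih _ (hs.lt v hv) _ ht rfl
      · split_ifs at ht with hr
        · simp at ht
        · exact ⟨v, ⟨hv, hr⟩, (List.mem_singleton.1 ht).symm⟩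
    · rintro ⟨v, ⟨hv, hr⟩, rfl⟩
      refine ⟨v, hv, ?_⟩
      rw [traversals_eq hs hv, if_neg hr]
      simp
  rw [changeoverCost, hset, Finset.sum_image, Finset.sum_filter]
  · refine Finset.sum_congr rfl fun v _ => ?_
    rw [lastCost, ite_not]
  · intro v hv v' hv' heq
    simp only [Finset.coe_filter, Finset.mem_univ, true_and, Set.mem_ofPred_eq, not_or] at hv hv'
    simp only [lastTraversal, Prod.mk.injEq] at heq
    rcases Sym2.eq_iff.1 heq.2 with ⟨-, h⟩ | ⟨h1, h2⟩
    · exact h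
    · have h3 := hs.lt v hv.1
      have h4 := hs.lt v' hv'.1
      rw [h1] at h3
      rw [← h2] at h4
      omega

end Solution
/-! ## Items and solutions -/

section Describes

variable {I : Inst} {M : Item} {s : Solution I} {π : Fin I.n → Fin I.n} {h m : Fin I.n → ℕ}

/-- The item `M` describes the solution `s`, whose tree has parents `π` and subtree sizes `m`. -/
structure Describes (M : Item) (s : Solution I) (π : Fin I.n → Fin I.n) (h m : Fin I.n → ℕ) :
    Prop where
  rooted : RootedBy s.tree I.root π h
  out : ∀ u v : Fin I.n, (M.lab u v).out = if u ≠ I.root ∧ π u = v then m u else 0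
  inn : ∀ u v : Fin I.n, (M.lab u v).inn = if v ≠ I.root ∧ π v = u then m v else 0
  col : ∀ (u v : Fin I.n) (h : I.graph.Adj u v), (M.lab u v).col = s.χ ⟨s(u, v), h⟩
  pos : ∀ v, v ≠ I.root → m v ≠ 0
  size : ∀ v, v ≠ I.root → m v = 1 + ∑ u, if u ≠ I.root ∧ π u = v then m u else 0

namespace Describes

lemma itemCost_eq (hd : Describes M s π h m) (w : ℕ → ℕ) :
    itemCost w I M = ∑ v, w (m v) • s.lastCost π v := by
  -- For a middle vertex `x` and a child `v`, only the parent of `x` contributes to the sum over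
  -- `u`. At the root there is no such `u`, which matches the value `0` of `lastCost`.
  have key : ∀ x v : Fin I.n, (∑ u : Fin I.n,
      if (M.lab x u).out = 0 ∨ (M.lab x v).inn = 0 then (0 : ℝ)
      else w (M.lab x v).inn • I.cost (M.lab x u).col (M.lab x v).col) =
      if π v = x then w (m v) • s.lastCost π v else 0 := by
    intro x v
    by_cases hv : v ≠ I.root ∧ π v = x
    · obtain ⟨hv, rfl⟩ := hv
      have hinn : (M.lab (π v) v).inn = m v := by rw [hd.inn, if_pos ⟨hv, rfl⟩]
      rw [if_pos rfl, hinn]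
      by_cases hr : π v = I.root
      · rw [Finset.sum_eq_zero, Solution.lastCost, if_pos (.inr hr), smul_zero]
        intro u _
        rw [if_pos (.inl (by rw [hd.out, if_neg (by simp [hr])]))]
      · rw [Finset.sum_eq_single (π (π v))]
        · have h1 := s.tree_le (hd.rooted.adj_parent hr)
          have h2 := s.tree_le (hd.rooted.adj_parent hv)
          have hswap : s.χ ⟨s(π v, π (π v)), h1.symm⟩ = s.χ ⟨s(π (π v), π v), h1⟩ :=
            congrArg s.χ (Subtype.ext Sym2.eq_swap)
          rw [if_neg, hd.col _ _ h1.symm, hd.col _ _ h2, cost_eq, hswap, Solution.lastCost,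
            if_neg (by simp [hv, hr]), Solution.travCost, Solution.lastTraversal, dif_pos ⟨h1, h2⟩]
          rw [hd.out, if_pos ⟨hr, rfl⟩, not_or]
          exact ⟨hd.pos _ hr, hd.pos _ hv⟩
        · intro u _ hu
          rw [if_pos (.inl (by rw [hd.out, if_neg fun h => hu h.2.symm]))]
        · exact fun h => absurd (Finset.mem_univ _) h
    · have hinn : (M.lab x v).inn = 0 := by rw [hd.inn, if_neg hv]
      simp only [hinn, or_true, if_true, Finset.sum_const_zero]
      split_ifs with hp
      · rw [Solution.lastCost, if_pos, smul_zero]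
        exact .inl (by_contra fun h => hv ⟨h, hp⟩)
      · rfl
  rw [ReloadCost.itemCost_eq]
  simp only [rowCost_eq]
  calc _ = ∑ x : Fin I.n, ∑ v : Fin I.n, if π v = x then w (m v) • s.lastCost π v else 0 := by
        refine Finset.sum_congr rfl fun x _ => ?_
        rw [Finset.sum_comm]
        exact Finset.sum_congr rfl fun v _ => key x v
    _ = _ := by
        rw [Finset.sum_comm]
        simp

lemma itemCost_eq_changeoverCost (hd : Describes M s π h m) :
    itemCost (fun _ => 1) I M = s.changeoverCost := by
  rw [hd.itemCost_eq, Solution.changeoverCost_eq hd.rooted]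
  simp

lemma itemCost_eq_reloadCost (hd : Describes M s π h m) :
    itemCost (fun i => i) I M = s.reloadCost := by
  rw [hd.itemCost_eq, Solution.reloadCost_eq hd.rooted hd.size]

lemma enc_output (hd : Describes M s π h m) : enc (output I M) = s.encode := by
  have hmap : ∀ {α : Type} (f : ℕ → α), (List.range I.n).map f = List.ofFn fun i : Fin I.n => f i :=
    fun f => List.ext_getElem (by simp) (by simp)
  simp only [output, hmap, Solution.encode, Data.ofMatrix]
  change Data.ofList (List.map enc _) = _
  rw [List.map_ofFn]
  refine congrArg _ (congrArg _ (funext fun u => ?_))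
  change Data.ofList (List.map enc _) = _
  rw [List.map_ofFn]
  refine congrArg _ (congrArg _ (funext fun v => ?_))
  by_cases ha : I.graph.Adj u v
  · have hadj : (!decide ((M.lab u v).out = 0) || !decide ((M.lab u v).inn = 0)) = true ↔
        s.tree.Adj u v := by
      rw [hd.rooted.adj, hd.out, hd.inn]
      simp only [Bool.or_eq_true, Bool.not_eq_true', decide_eq_false_iff_not]
      refine or_congr ?_ ?_
      · have := hd.pos u
        split_ifs <;> simp_all
      · have := hd.pos v
        split_ifs <;> simp_all
    simp only [Function.comp_apply, adj_iff.2 ha, cond_true, dif_pos ha, ← hd.col u v ha]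
    change Data.pair (enc _) (Data.ofNat _) = _
    refine congrArg (Data.pair · _) ?_
    rw [Data.ofProp]
    by_cases ht : s.tree.Adj u v
    · rw [if_pos ht, hadj.2 ht]; rfl
    · rw [if_neg ht, Bool.eq_false_of_not_eq_true (mt hadj.1 ht)]; rfl
  · have : I.adj u v = false := Bool.eq_false_of_not_eq_true (mt adj_iff.1 ha)
    simp only [Function.comp_apply, this, cond_false, dif_neg ha]
    rfl

end Describes

/-- Each solution is described by an item. -/
lemma Solution.exists_item (s : Solution I) : ∃ M π h m, Valid I M ∧ supp I M = Finset.univ ∧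
    Describes M s π h m := by
  classical
  obtain ⟨π, h, hs⟩ := exists_rootedBy s.isTree I.root
  obtain ⟨m, hpos, hle, hsize⟩ := hs.exists_sizes
  let col : Fin I.n → Fin I.n → ℕ := fun u v =>
    if h : I.graph.Adj u v then s.χ ⟨s(u, v), h⟩ else 0
  have hcol : ∀ {u v} (h : I.graph.Adj u v), col u v = s.χ ⟨s(u, v), h⟩ := fun h => dif_pos h
  let o : Fin I.n → Fin I.n → ℕ := fun u v => if u ≠ I.root ∧ π u = v then m u else 0
  let M : Item := List.ofFn fun u => List.ofFn fun v => (col u v, o u v, o v u)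
  have hrow : ∀ u : Fin I.n, M.row u = List.ofFn fun v => (col u v, o u v, o v u) := fun u => by
    rw [Item.row, getD_ofFn, dif_pos u.2]
  have hlab : ∀ u v : Fin I.n, M.lab u v = (col u v, o u v, o v u) := fun u v => by
    rw [Item.lab, hrow, Row.lab, getD_ofFn, dif_pos v.2]
  have hsupp : supp I M = Finset.univ := by
    rw [Finset.eq_univ_iff_forall]
    intro u
    rw [mem_supp, has_iff, hrow]
    intro h
    have h := congrArg List.length h
    have := u.2
    rw [List.length_ofFn, List.length_nil] at h
    omega
  have hadj : ∀ {u v}, o u v ≠ 0 → I.graph.Adj u v := by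
    intro u v huv
    by_cases hc : u ≠ I.root ∧ π u = v
    · exact s.tree_le ((hs.adj u v).2 (.inl hc))
    · exact absurd (if_neg hc) huv
  have hol : ∀ u v, o u v ≤ I.n := fun u v => by
    have := hle u
    rw [Fintype.card_fin] at this
    simp only [o]
    split_ifs
    exacts [this, Nat.zero_le _]
  have hsum : ∀ u, u ≠ I.root → ∑ v, o u v = m u := fun u hu => by simp [o, hu]
  refine ⟨M, π, h, m, ⟨by simp [M], fun u _ => ?_, fun u _ v _ => ?_⟩, hsupp, hs, fun u v => ?_,
    fun u v => ?_, fun u v h => ?_, fun v _ => Nat.one_le_iff_ne_zero.1 (hpos v),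
    fun v _ => hsize v⟩
  · have hl : ∀ v : Fin I.n, (M.row u).lab v = (col u v, o u v, o v u) := hlab u
    rw [mem_rows]
    simp only [hl, Lab.out, Lab.inn, Lab.col]
    refine ⟨by simp [hrow], fun v => ?_, fun v v' hne ha ha' => ?_, fun hu v => ?_, fun hu =>
      ⟨?_, fun v v' hne => ?_⟩⟩
    · rw [mem_choices]
      split_ifs with ha
      · rw [adj_iff] at ha
        exact ⟨by rw [Lab.col, hcol ha]; exact (s.χ _).2, hol u v, hol v u⟩
      · rw [adj_iff] at ha
        refine Prod.ext (dif_neg ha) (Prod.ext ?_ ?_)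
        · exact not_not.1 (mt hadj ha)
        · exact not_not.1 (mt hadj fun h => ha h.symm)
    · rw [hcol ha, hcol ha', Ne, Fin.val_inj]
      refine s.χ.valid ?_
      rw [SimpleGraph.lineGraph_adj_iff_exists]
      refine ⟨fun h => hne ?_, u, by simp, by simp⟩
      exact Sym2.congr_right.1 (congrArg Subtype.val h)
    · simp [o, hu]
    · rw [hsum u hu, hsize u, add_comm]
    · by_contra hc
      simp only [o, not_or, ite_eq_right_iff, not_forall, exists_prop] at hc
      exact hne (hc.1.1.2.symm.trans hc.2.1.2)
  · rw [hlab, hlab]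
    refine Prod.ext ?_ rfl
    by_cases ha : I.graph.Adj u v
    · change col u v = col v u
      rw [hcol ha, hcol ha.symm]
      exact congrArg (fun e => (s.χ e : ℕ)) (Subtype.ext Sym2.eq_swap)
    · change col u v = col v u
      simp only [col]
      rw [dif_neg ha, dif_neg fun h => ha h.symm]
  · rw [hlab]; rfl
  · rw [hlab]; rfl
  · rw [hlab]; exact hcol h

/-- Each item with all rows describes a solution. -/
lemma Valid.exists_solution (hM : Valid I M) (hfull : supp I M = Finset.univ) :
    ∃ (s : Solution I) (π : _) (h m : _), Describes M s π h m := by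
  classical
  have hmem : ∀ u, u ∈ supp I M := by simp [hfull]
  let o : Fin I.n → Fin I.n → ℕ := fun u v => (M.lab u v).out
  have hrow := fun u => mem_rows.1 (hM.row u (hmem u))
  have hflip : ∀ u v : Fin I.n, M.lab u v = (M.lab v u).flip := fun u v =>
    hM.lab u (hmem u) v (hmem v)
  have hinn : ∀ u v : Fin I.n, (M.lab u v).inn = o v u := fun u v => by rw [hflip]; rfl
  have hch : ∀ u v : Fin I.n, M.lab u v ∈ choices I u v := fun u v => (hrow u).2.1 v
  have hadj : ∀ {u v}, o u v ≠ 0 → I.graph.Adj u v := by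
    intro u v huv
    by_contra ha
    have := hch u v
    rw [mem_choices, if_neg (by rwa [adj_iff])] at this
    exact huv (by simp only [o, this]; rfl)
  have hroot : ∀ v, o I.root v = 0 := (hrow I.root).2.2.2.1 rfl
  have hsum : ∀ u, u ≠ I.root → ∑ v, o u v = ∑ v, o v u + 1 := fun u hu => by
    have := ((hrow u).2.2.2.2 hu).1
    rw [← Finset.sum_congr rfl fun v _ => hinn u v]
    exact this
  have huniq : ∀ u, u ≠ I.root → ∀ v v', v ≠ v' → o u v = 0 ∨ o u v' = 0 := fun u hu =>
    ((hrow u).2.2.2.2 hu).2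
  have hex : ∀ u, ∃ v, u ≠ I.root → o u v ≠ 0 := by
    intro u
    by_cases hu : u = I.root
    · exact ⟨u, fun h => absurd hu h⟩
    · obtain ⟨v, -, hv⟩ := Finset.exists_ne_zero_of_sum_ne_zero
        (show ∑ v, o u v ≠ 0 by rw [hsum u hu]; omega)
      exact ⟨v, fun _ => hv⟩
  choose π hπ using hex
  -- At the root `π` is arbitrary and this value is `0`, not a subtree size. `Describes` therefore
  -- makes demands on `m` only at the other vertices.
  let m : Fin I.n → ℕ := fun u => o u (π u)
  have ho : ∀ u v, o u v = if u ≠ I.root ∧ π u = v then m u else 0 := by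
    intro u v
    by_cases hu : u = I.root
    · rw [if_neg (by simp [hu]), hu, hroot]
    · by_cases hv : π u = v
      · rw [if_pos ⟨hu, hv⟩, ← hv]
      · rw [if_neg fun h => hv h.2]
        exact (huniq u hu _ _ hv).resolve_left (hπ u hu)
  have hms : ∀ u, u ≠ I.root → m u = ∑ v, o v u + 1 := by
    intro u hu
    rw [← hsum u hu, Finset.sum_eq_single (π u)]
    · exact fun v _ hv => (huniq u hu _ _ hv.symm).resolve_left (hπ u hu)
    · simp
  have hmn : ∀ u, u ≠ I.root → m u ≤ I.n := by
    intro u hu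
    have := hch u (π u)
    rw [mem_choices, if_pos (adj_iff.2 (hadj (hπ u hu)))] at this
    exact this.2.1
  -- Sizes increase strictly towards the root, so subtracting them from `n + 1` gives decreasing
  -- heights; they stay positive off the root because sizes are at most `n`.
  let h : Fin I.n → ℕ := fun u => if u = I.root then 0 else I.n + 1 - m u
  have hlt : ∀ u, u ≠ I.root → h (π u) < h u := by
    intro u hu
    have h1 := hmn u hu
    simp only [h, if_neg hu]
    split_ifs with hr
    · omega
    · have h2 : o u (π u) ≤ ∑ v, o v (π u) :=
        Finset.single_le_sum (f := fun v => o v (π u)) (fun _ _ => Nat.zero_le _)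
          (Finset.mem_univ u)
      have h3 := hms _ hr
      have h4 : m u = o u (π u) := rfl
      omega
  let T : SimpleGraph (Fin I.n) :=
    { Adj := fun u v => (u ≠ I.root ∧ π u = v) ∨ (v ≠ I.root ∧ π v = u)
      symm := ⟨fun u v h => h.symm⟩
      loopless := ⟨fun u hu => by
        have h : u ≠ I.root ∧ π u = u := by tauto
        have := hlt u h.1
        rw [h.2] at this
        exact lt_irrefl _ this⟩ }
  have hT : RootedBy T I.root π h := ⟨fun u v => Iff.rfl, hlt⟩
  have hcolflip : ∀ u v : Fin I.n, (M.lab u v).col = (M.lab v u).col := fun u v => by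
    rw [hflip]; rfl
  let color : Sym2 (Fin I.n) → ℕ :=
    Sym2.lift ⟨fun u v => (M.lab u v).col, hcolflip⟩
  have hcolor : ∀ e : I.graph.edgeSet, color e < I.k := by
    rintro ⟨e, he⟩
    induction e with | _ u v
    have := hch u v
    rw [mem_choices, if_pos (adj_iff.2 he)] at this
    exact this.1
  let χ : I.graph.lineGraph.Coloring (Fin I.k) :=
    SimpleGraph.Coloring.mk (fun e => ⟨color e, hcolor e⟩) (by
      rintro ⟨e, he⟩ ⟨e', he'⟩ hee
      rw [SimpleGraph.lineGraph_adj_iff_exists] at hee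
      obtain ⟨hne, x, hx, hx'⟩ := hee
      obtain ⟨a, rfl⟩ := Sym2.mem_iff_exists.1 hx
      obtain ⟨b, rfl⟩ := Sym2.mem_iff_exists.1 hx'
      have hab : a ≠ b := by
        rintro rfl
        exact hne rfl
      intro heq
      exact (hrow x).2.2.1 a b hab he he' (congrArg Fin.val heq))
  refine ⟨⟨χ, T, ?_, hT.isTree⟩, π, h, m, hT, ho, fun u v => ?_, fun u v huv => rfl,
    fun v hv => hπ v hv, fun v hv => ?_⟩
  · rintro u v (⟨hu, rfl⟩ | ⟨hv, rfl⟩)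
    · exact hadj (hπ u hu)
    · exact (hadj (hπ v hv)).symm
  · rw [hinn, ho]
  · rw [hms v hv, add_comm]
    exact congrArg _ (Finset.sum_congr rfl fun u _ => ho u v)

end Describes

/-- The algorithm solves the problem whose cost function agrees with the cost of items. -/
lemma solvable_of_cost (c₁ c₂ : ℕ) (cost : ∀ {I : Inst}, Solution I → ℝ) {w : ℕ → ℕ}
    (hw : PolyTime w) (hcost : ∀ {I : Inst} {M : Item} {s : Solution I} {π h m},
      Describes M s π h m → itemCost w I M = cost s)
    (hex : ∀ I, Nonempty (Solution I)) :
    SolvableInPolyTime cost (SparseBlocks c₁ c₂) := by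
  -- The same `W` serves as the width bound of the tables and as the degree bound for the
  -- enumeration of rows.
  have hmax : max c₁ (c₂ + 2) ≤ c₂ + 2 + max c₁ (c₂ + 2) := Nat.le_add_left _ _
  obtain ⟨c, p, hc⟩ := PolyTime.solve (W := c₂ + 2 + max c₁ (c₂ + 2)) hw
  refine ⟨c, p, fun I hI => ?_⟩
  obtain ⟨t, ht, hp⟩ := hc ⟨I, fun v => by
    rw [← card_bd_singleton]; exact (hI.card_bd_singleton_le v).trans hmax⟩
  obtain ⟨s₀⟩ := hex I
  obtain ⟨F, -, -, -, hF, hFs, -⟩ := s₀.exists_item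
  obtain ⟨M, hM, hs, heq, hopt⟩ := exists_solve_eq (w := w) hI.derivable_univ ⟨F, hF, hFs⟩
  obtain ⟨s, π, h, m, hd⟩ := hM.exists_solution hs
  refine ⟨s, t, ?_, hp, fun s' => ?_⟩
  · rw [← hd.enc_output, ← heq]
    exact ht
  · obtain ⟨M', _, _, _, hM', hs', hd'⟩ := s'.exists_item
    have := hopt M' hM' hs'
    rwa [hcost hd, hcost hd'] at this

/-! ## Vizing's theorem -/

section Vizing

variable {V C : Type*} {H : SimpleGraph V} {f f' : Sym2 V → C} {x y z : V} {a b c : C} {l : List V}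

/-- Adjacent edges of `H` have different colours. -/
def Proper (H : SimpleGraph V) (f : Sym2 V → C) : Prop :=
  ∀ u v w, v ≠ w → H.Adj u v → H.Adj u w → f s(u, v) ≠ f s(u, w)

/-- No edge of `H` at `u` has the colour `c`. -/
def Missing (H : SimpleGraph V) (f : Sym2 V → C) (u : V) (c : C) : Prop :=
  ∀ v, H.Adj u v → f s(u, v) ≠ c

/-- The edge `xy` may be new or already in `H`; in the second case this recolours an edge. -/
lemma Proper.update [DecidableEq V] (hf : Proper H f) (hx : Missing H f x c)
    (hy : Missing H f y c) :
    Proper (H ⊔ SimpleGraph.edge x y) (Function.update f s(x, y) c) := by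
  have key : ∀ u v w, v ≠ w → (H ⊔ SimpleGraph.edge x y).Adj u w → s(u, v) = s(x, y) →
      Function.update f s(x, y) c s(u, v) ≠ Function.update f s(x, y) c s(u, w) := by
    intro u v w hvw hw he
    have hne : s(u, w) ≠ s(x, y) := fun h => hvw (Sym2.congr_right.1 (he.trans h.symm))
    have hH : H.Adj u w := by
      rw [SimpleGraph.sup_adj, SimpleGraph.edge_adj] at hw
      rcases hw with hw | ⟨⟨rfl, rfl⟩ | ⟨rfl, rfl⟩, -⟩
      exacts [hw, absurd rfl hne, absurd Sym2.eq_swap hne]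
    rw [he, Function.update_self, Function.update_of_ne hne]
    rcases Sym2.eq_iff.1 he with ⟨rfl, rfl⟩ | ⟨rfl, rfl⟩
    exacts [(hx w hH).symm, (hy w hH).symm]
  intro u v w hvw hv hw
  by_cases h : s(u, v) = s(x, y)
  · exact key u v w hvw hw h
  by_cases h' : s(u, w) = s(x, y)
  · exact (key u w v hvw.symm hv h').symm
  have hH : ∀ w, s(u, w) ≠ s(x, y) → (H ⊔ SimpleGraph.edge x y).Adj u w → H.Adj u w := by
    intro w hne hw
    rw [SimpleGraph.sup_adj, SimpleGraph.edge_adj] at hw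
    rcases hw with hw | ⟨⟨rfl, rfl⟩ | ⟨rfl, rfl⟩, -⟩
    exacts [hw, absurd rfl hne, absurd Sym2.eq_swap hne]
  rw [Function.update_of_ne h, Function.update_of_ne h']
  exact hf u v w hvw (hH v h hv) (hH w h' hw)

/-- The fans at `x`, in reverse order, that start with the uncoloured edge `xy`: the colour of each
further edge is missing at the end of the edge before it. -/
inductive Fan (H : SimpleGraph V) (f : Sym2 V → C) (x y : V) : List V → Prop
  | single : Fan H f x y [y]
  | cons {u v : V} {l : List V} : Fan H f x y (u :: l) → H.Adj x v →
      Missing H f u (f s(x, v)) → v ∉ u :: l → Fan H f x y (v :: u :: l)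

namespace Fan

lemma ne (h : Fan H f x y l) (hxy : x ≠ y) (hz : z ∈ l) : z ≠ x := by
  induction h with
  | single => rw [List.mem_singleton] at hz; exact hz ▸ hxy.symm
  | cons _ hadj _ _ ih =>
    rcases List.mem_cons.1 hz with rfl | hz
    exacts [hadj.ne', ih hz]

lemma imp (h : Fan H f x y l) (himp : ∀ u ∈ l.tail, ∀ v ∈ l, H.Adj x v →
    Missing H f u (f s(x, v)) → Missing H f' u (f' s(x, v))) : Fan H f' x y l := by
  induction h with
  | single => exact .single
  | cons _ hadj hm hv ih =>
    refine .cons (ih fun u hu v hv => himp u ?_ v ?_) hadj (himp _ ?_ _ ?_ hadj hm) hv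
    · exact List.mem_cons_of_mem _ hu
    · exact List.mem_cons_of_mem _ hv
    · exact List.mem_cons_self
    · exact List.mem_cons_self

/-- A fan can be cut off at any of its vertices. The decrease in length serves the choice of a
shortest fan. -/
lemma exists_of_mem (h : Fan H f x y l) (hz : z ∈ l) :
    ∃ l', Fan H f x y (z :: l') ∧ l'.length < l.length := by
  induction h with
  | single =>
    rw [List.mem_singleton] at hz
    exact ⟨[], hz ▸ .single, by simp⟩
  | cons h hadj hm hv ih =>
    rcases List.mem_cons.1 hz with rfl | hz
    · exact ⟨_, h.cons hadj hm hv, by simp⟩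
    · obtain ⟨l', hl', hlen⟩ := ih hz
      exact ⟨l', hl', hlen.trans (by simp)⟩

/-- If a colour is missing at both ends of the last edge of a fan, then the fan can be recoloured so
that its first edge gets a colour. -/
lemma exists_proper (hxy : x ≠ y) {u : V} (hf : Proper H f) (h : Fan H f x y (u :: l))
    (hx : Missing H f x c) (hu : Missing H f u c) :
    ∃ f' : Sym2 V → C, Proper (H ⊔ SimpleGraph.edge x y) f' := by
  classical
  induction l generalizing f u c with
  | nil =>
    cases h
    exact ⟨_, hf.update hx hu⟩
  | cons v l ih =>
    obtain _ | ⟨h, hadj, hm, hnot⟩ := h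
    have hne : ∀ w ∈ v :: l, w ≠ u := fun w hw heq => hnot (heq ▸ hw)
    -- Giving `xu` the colour `c` frees its old colour at `x`. That colour is missing at `v` too, so
    -- the shorter fan ending in `v` satisfies the hypotheses.
    have hpr : Proper H (Function.update f s(x, u) c) := fun p q r hqr hq hr =>
      hf.update hx hu p q r hqr (.inl hq) (.inl hr)
    have hat : ∀ w ∈ v :: l, ∀ r, Function.update f s(x, u) c s(w, r) = f s(w, r) := by
      intro w hw r
      refine Function.update_of_ne (fun he => ?_) _ _
      rcases Sym2.eq_iff.1 he with ⟨h1, -⟩ | ⟨h1, -⟩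
      exacts [h.ne hxy hw h1, hne w hw h1]
    have hmiss : ∀ w ∈ v :: l, ∀ d, Missing H f w d →
        Missing H (Function.update f s(x, u) c) w d := by
      intro w hw d hd r hr
      rw [hat w hw]
      exact hd r hr
    refine ih (c := f s(x, u)) hpr (h.imp fun w hw r hr _ hmw => ?_) (fun r hr => ?_)
      (hmiss v List.mem_cons_self _ hm)
    · rw [Sym2.eq_swap (a := x) (b := r), hat r hr, Sym2.eq_swap (a := r) (b := x)]
      exact hmiss w (List.mem_of_mem_tail hw) _ hmw
    · by_cases hru : r = u
      · rw [hru, Function.update_self]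
        exact (hx u hadj).symm
      · rw [Function.update_of_ne fun he => hru (Sym2.congr_right.1 he)]
        exact hf x r u hru hr hadj

end Fan

/-- The edges of two colours. -/
def kempe (H : SimpleGraph V) (f : Sym2 V → C) (a b : C) : SimpleGraph V where
  Adj u v := H.Adj u v ∧ (f s(u, v) = a ∨ f s(u, v) = b)
  symm := ⟨fun u v h => by rwa [H.adj_comm, Sym2.eq_swap]⟩
  loopless := ⟨fun u h => H.loopless.irrefl u h.1⟩

/-! ### Kempe changes -/

section Swap

open Classical in
/-- Exchanges the colours `a` and `b` on a component of the graph of these colours. -/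
noncomputable def kempeSwap (H : SimpleGraph V) (f : Sym2 V → C) (a b : C) (y : V) (e : Sym2 V) :
    C :=
  if ∃ u ∈ e, (kempe H f a b).Reachable y u then Equiv.swap a b (f e) else f e

-- It is enough to test one end: an edge of `H` with exactly one end in the component has neither of
-- the two colours, so the swap does not affect it.
open Classical in
lemma kempeSwap_eq {u v : V} (h : H.Adj u v) : kempeSwap H f a b y s(u, v) =
    if (kempe H f a b).Reachable y u then Equiv.swap a b (f s(u, v)) else f s(u, v) := by
  unfold kempeSwap
  by_cases hu : (kempe H f a b).Reachable y u
  · rw [if_pos hu, if_pos ⟨u, by simp, hu⟩]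
  · rw [if_neg hu]
    split_ifs with hv
    · have hab : ¬ (f s(u, v) = a ∨ f s(u, v) = b) := by
        intro hab
        obtain ⟨w, hw, hr⟩ := hv
        rcases Sym2.mem_iff.1 hw with rfl | rfl
        · exact hu hr
        · have hadj : (kempe H f a b).Adj u w := ⟨h, hab⟩
          exact hu (hr.trans hadj.symm.reachable)
      rw [not_or] at hab
      exact Equiv.swap_apply_of_ne_of_ne hab.1 hab.2
    · rfl

lemma Proper.kempeSwap (hf : Proper H f) : Proper H (kempeSwap H f a b y) := by
  classical
  intro u v w hvw hv hw
  rw [kempeSwap_eq hv, kempeSwap_eq hw]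
  split_ifs
  · exact fun h => hf u v w hvw hv hw ((Equiv.swap a b).injective h)
  · exact hf u v w hvw hv hw

open Classical in
lemma Missing.kempeSwap {u : V} (h : Missing H f u c) : Missing H (kempeSwap H f a b y) u
    (if (kempe H f a b).Reachable y u then Equiv.swap a b c else c) := by
  intro v hv
  rw [kempeSwap_eq hv]
  split_ifs
  · exact fun h' => h v hv ((Equiv.swap a b).injective h')
  · exact h v hv

end Swap

/-- If all degrees are at most two, then three vertices of degree at most one are not in a common
component. -/
lemma not_reachable_of_degree_le [Finite V] {K : SimpleGraph V}
    (hK : ∀ u, (K.neighborSet u).ncard ≤ 2) {p q r : V} (hpq : p ≠ q) (hpr : p ≠ r) (hqr : q ≠ r)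
    (hp : (K.neighborSet p).ncard ≤ 1) (hq : (K.neighborSet q).ncard ≤ 1)
    (hr : (K.neighborSet r).ncard ≤ 1) (hrq : K.Reachable p q) : ¬ K.Reachable p r := by
  classical
  intro hrr
  have := Fintype.ofFinite V
  let S : Finset V := Finset.univ.filter fun u => K.Reachable p u
  have hS : ∀ {u}, u ∈ S ↔ K.Reachable p u := by simp [S]
  have hconn : Conn K S := by
    have h : ∀ u ∈ S, Linked K S p u := by
      intro u hu
      obtain ⟨w⟩ := hS.1 hu
      exact .of_walk w fun v hv => hS.2 (w.takeUntil v hv).reachable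
    exact fun u hu v hv => (h u hu).symm.trans (h v hv)
  have h1 : S.card ≤ (K.induce (S : Set V)).edgeFinset.card + 1 := by
    have := ncard_le_edgesIn hconn
    rwa [Set.ncard_coe_finset, ncard_edgesIn, ← SimpleGraph.coe_edgeFinset,
      Set.ncard_coe_finset] at this
  have h2 := (K.induce (S : Set V)).sum_degrees_eq_twice_card_edges
  have hdeg : ∀ u : (S : Set V), (K.induce (S : Set V)).degree u ≤ (K.neighborSet u).ncard := by
    intro u
    rw [← SimpleGraph.card_neighborFinset_eq_degree, ← Set.ncard_coe_finset,
      SimpleGraph.coe_neighborFinset, ← Set.ncard_image_of_injective _ Subtype.val_injective]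
    refine Set.ncard_le_ncard ?_ (Set.toFinite _)
    rintro _ ⟨v, hv, rfl⟩
    exact hv
  have h3 : ∑ u : (S : Set V), (K.induce (S : Set V)).degree u ≤
      ∑ u ∈ S, (K.neighborSet u).ncard := by
    refine (Finset.sum_le_sum fun u _ => hdeg u).trans (le_of_eq ?_)
    exact Finset.sum_coe_sort S fun u => (K.neighborSet u).ncard
  have hsub : ({p, q, r} : Finset V) ⊆ S := by
    intro u hu
    simp only [Finset.mem_insert, Finset.mem_singleton] at hu
    rcases hu with rfl | rfl | rfl
    exacts [hS.2 .rfl, hS.2 hrq, hS.2 hrr]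
  -- Three vertices of degree at most one leave a degree sum of at most `2|S| - 3`, while a
  -- connected graph on `S` needs `2|S| - 2`.
  have h4 : ∑ u ∈ S, (K.neighborSet u).ncard + 3 ≤ 2 * S.card := by
    rw [← Finset.sum_sdiff hsub]
    have h5 : ∑ u ∈ S \ {p, q, r}, (K.neighborSet u).ncard ≤ (S \ {p, q, r}).card * 2 :=
      Finset.sum_le_card_nsmul _ _ _ fun u _ => hK u
    have h6 : ∑ u ∈ ({p, q, r} : Finset V), (K.neighborSet u).ncard ≤ 3 := by
      rw [Finset.sum_insert (by simp [hpq, hpr]), Finset.sum_insert (by simp [hqr]),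
        Finset.sum_singleton]
      omega
    have h7 : (S \ {p, q, r}).card + 3 = S.card := by
      rw [← Finset.card_sdiff_add_card_eq_card hsub, Finset.card_eq_three.2 ⟨p, q, r, hpq, hpr,
        hqr, rfl⟩]
    omega
  omega

lemma ncard_kempe_le [Finite V] (hf : Proper H f) (u : V) :
    ((kempe H f a b).neighborSet u).ncard ≤ 2 := by
  refine (Set.ncard_le_ncard_of_injOn (t := {a, b}) (fun v => f s(u, v)) (fun v hv => hv.2)
    ?_ (Set.toFinite _)).trans ((Set.ncard_insert_le a {b}).trans (by rw [Set.ncard_singleton]))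
  intro v hv w hw h
  by_contra hne
  exact hf u v w hne hv.1 hw.1 h

lemma ncard_kempe_le_of_missing [Finite V] (hf : Proper H f) {u : V}
    (h : Missing H f u a ∨ Missing H f u b) : ((kempe H f a b).neighborSet u).ncard ≤ 1 := by
  refine (Set.ncard_le_one (Set.toFinite _)).2 fun v hv w hw => ?_
  by_contra hne
  refine hf u v w hne hv.1 hw.1 ?_
  rcases h with h | h
  · rw [hv.2.resolve_left (h v hv.1), hw.2.resolve_left (h w hw.1)]
  · rw [hv.2.resolve_right (h v hv.1), hw.2.resolve_right (h w hw.1)]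

/-- If each vertex has a missing colour, then the colouring extends to a further edge. -/
lemma Proper.exists_extension [Finite V] (hf : Proper H f) (hmiss : ∀ u, ∃ c, Missing H f u c)
    (hxy : x ≠ y) (hadj : ¬ H.Adj x y) :
    ∃ f' : Sym2 V → C, Proper (H ⊔ SimpleGraph.edge x y) f' := by
  classical
  by_contra hno
  choose β hβ using hmiss
  let R : Set V := {u | ∃ l, Fan H f x y (u :: l)}
  have hyR : y ∈ R := ⟨[], .single⟩
  -- The chosen missing colour of a fan end `u` cannot be missing at `x`, or the fan could be
  -- recoloured. So it occurs on some edge `xv`, and `v` is again a fan end.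
  have hν : ∀ u : R, ∃ v : R, (v : V) ≠ y ∧ H.Adj x v ∧ f s(x, (v : V)) = β u := by
    rintro ⟨u, l, hl⟩
    have : ¬ Missing H f x (β u) := fun h => hno (hl.exists_proper hxy hf h (hβ u))
    simp only [Missing, not_forall, not_not] at this
    obtain ⟨v, hv, hc⟩ := this
    refine ⟨⟨v, ?_⟩, ?_, hv, hc⟩
    · by_cases hm : v ∈ u :: l
      · obtain ⟨l', hl', -⟩ := hl.exists_of_mem hm
        exact ⟨l', hl'⟩
      · exact ⟨_, hl.cons hv (hc ▸ hβ u) hm⟩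
    · exact fun h : v = y => hadj (h ▸ hv)
  choose ν hν hνadj hνc using hν
  -- The value `y` is never taken, since `xy` is not an edge of `H`. On the finite set `R` this
  -- yields two fan ends that miss the same colour.
  have hninj : ¬ Function.Injective ν := by
    intro hinj
    obtain ⟨u, hu⟩ := (Finite.injective_iff_surjective.1 hinj) ⟨y, hyR⟩
    exact hν u (congrArg Subtype.val hu)
  simp only [Function.Injective, not_forall] at hninj
  obtain ⟨y₁, y₂, heq, hne⟩ := hninj
  have hb : β y₁ = β y₂ := by rw [← hνc y₁, ← hνc y₂, heq]
  let a := β x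
  let b := β y₁
  have hxb : ¬ Missing H f x b := fun h => h _ (hνadj y₁) (hνc y₁)
  have hRx : ∀ u : R, (u : V) ≠ x := by
    rintro ⟨u, l, hl⟩
    exact hl.ne hxy List.mem_cons_self
  -- In the graph of the colours `a` and `b`, the vertices `x`, `y₁` and `y₂` have degree at most
  -- one, so `y₁` and `y₂` are not both in the component of `x`.
  have hex : ∃ n u l, Fan H f x y (u :: l) ∧ Missing H f u b ∧
      ¬ (kempe H f a b).Reachable x u ∧ l.length = n := by
    by_cases h : (kempe H f a b).Reachable x y₁
    · obtain ⟨l, hl⟩ := y₂.2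
      refine ⟨_, y₂, l, hl, by simpa only [b, hb] using hβ y₂, ?_, rfl⟩
      refine not_reachable_of_degree_le (fun u => ncard_kempe_le hf u) (hRx y₁).symm (hRx y₂).symm
        (fun h => hne (Subtype.ext h)) (ncard_kempe_le_of_missing hf (.inl (hβ x)))
        (ncard_kempe_le_of_missing hf (.inr (hβ y₁)))
        (ncard_kempe_le_of_missing hf (.inr (by simpa only [b, hb] using hβ y₂))) h
    · obtain ⟨l, hl⟩ := y₁.2
      exact ⟨_, y₁, l, hl, hβ y₁, h, rfl⟩
  obtain ⟨u, l, hl, hub, hxu, hlen⟩ := Nat.find_spec hex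
  have hux : ¬ (kempe H f a b).Reachable u x := fun h => hxu h.symm
  -- Swapping on the component of `u` makes `a` missing at `u` and keeps it missing at `x`. It
  -- remains to see that a shortest fan survives the swap.
  refine hno ((hl.imp (f' := ReloadCost.kempeSwap H f a b u)
    fun z hz v _ hv hm => ?_).exists_proper hxy (c := a) hf.kempeSwap ?_ ?_)
  · rw [kempeSwap_eq hv, if_neg hux]
    by_cases hzu : (kempe H f a b).Reachable u z
    · have hva : f s(x, v) ≠ a := hβ x v hv
      have hvb : f s(x, v) ≠ b := by
        -- Otherwise `z` misses `b` and lies outside the component of `x`, so the fan cut off at `z`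
        -- would be a shorter choice.
        intro hvb
        obtain ⟨l', hl', hlt⟩ : ∃ l', Fan H f x y (z :: l') ∧ l'.length < l.length := by
          cases hl with
          | single => simp at hz
          | cons h _ _ _ => exact h.exists_of_mem hz
        refine Nat.find_min hex (m := l'.length) (by omega) ⟨z, l', hl', hvb ▸ hm, ?_, rfl⟩
        exact fun h => hxu (h.trans hzu.symm)
      have := hm.kempeSwap (a := a) (b := b) (y := u)
      rwa [if_pos hzu, Equiv.swap_apply_of_ne_of_ne hva hvb] at this
    · have := hm.kempeSwap (a := a) (b := b) (y := u)
      rwa [if_neg hzu] at this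
  · have := (hβ x).kempeSwap (a := a) (b := b) (y := u)
    rwa [if_neg hux] at this
  · have := hub.kempeSwap (a := a) (b := b) (y := u)
    rwa [if_pos .rfl, Equiv.swap_apply_right] at this

/-- Vizing's theorem. -/
theorem exists_proper [Finite V] [Finite C] (G : SimpleGraph V)
    (hG : ∀ u, (G.neighborSet u).ncard < Nat.card C) [Nonempty C] :
    ∃ f : Sym2 V → C, Proper G f := by
  suffices h : ∀ n, ∀ H ≤ G, H.edgeSet.ncard = n → ∃ f : Sym2 V → C, Proper H f from
    h _ G le_rfl rfl
  intro n
  induction n with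
  | zero =>
    intro H _ hn
    rw [Set.ncard_eq_zero (Set.toFinite _), SimpleGraph.edgeSet_eq_empty] at hn
    subst hn
    exact ⟨fun _ => Classical.arbitrary C, fun u v w _ h => by simp at h⟩
  | succ n ih =>
    intro H hH hn
    obtain ⟨e, he⟩ : H.edgeSet.Nonempty := by
      rw [← Set.ncard_pos (Set.toFinite _)]; omega
    induction e with | _ x y
    have hxy : H.Adj x y := he
    obtain ⟨f, hf⟩ := ih (H.deleteEdges {s(x, y)}) ((H.deleteEdges_le _).trans hH) (by
      rw [SimpleGraph.edgeSet_deleteEdges, Set.ncard_sdiff_singleton_of_mem he]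
      omega)
    have heq : H.deleteEdges {s(x, y)} ⊔ SimpleGraph.edge x y = H := by
      ext u v
      simp only [SimpleGraph.sup_adj, SimpleGraph.deleteEdges_adj, SimpleGraph.edge_adj,
        Set.mem_singleton_iff, Sym2.eq_iff]
      constructor
      · rintro (h | ⟨⟨rfl, rfl⟩ | ⟨rfl, rfl⟩, -⟩)
        exacts [h.1, hxy, hxy.symm]
      · intro h
        have := h.ne
        tauto
    have := hf.exists_extension (x := x) (y := y) (fun u => ?_) hxy.ne (by simp)
    · rwa [heq] at this
    -- If all colours occurred at `u`, choosing an edge for each of them would give `u` at least as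
    -- many neighbours as there are colours.
    · by_contra! hall
      simp only [Missing, not_forall, not_not] at hall
      choose g hg hgc using hall
      have hinj : Function.Injective g := fun c d h => by rw [← hgc c, ← hgc d, h]
      have h1 : Nat.card C ≤ (G.neighborSet u).ncard := by
        rw [← Set.ncard_univ, ← Set.ncard_image_of_injective _ hinj]
        refine Set.ncard_le_ncard ?_ (Set.toFinite _)
        rintro _ ⟨c, -, rfl⟩
        exact hH ((H.deleteEdges_le _) (hg c))
      exact absurd (hG u) (not_lt.2 h1)

end Vizing

/-- An optimal solution must be output on every instance, so one has to exist. The assumption of at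
least `Δ + 1` colours enters here, through Vizing's theorem. -/
lemma nonempty_solution (I : Inst) : Nonempty (Solution I) := by
  classical
  obtain ⟨T, hle, hT⟩ := I.connected.exists_isTree_le
  have hk := I.maxDegree_lt
  have : Nonempty (Fin I.k) := ⟨⟨0, by omega⟩⟩
  obtain ⟨f, hf⟩ := exists_proper (C := Fin I.k) I.graph fun u => by
    have := I.graph.degree_le_maxDegree u
    rw [← SimpleGraph.coe_neighborFinset, Set.ncard_coe_finset,
      SimpleGraph.card_neighborFinset_eq_degree, Nat.card_eq_fintype_card, Fintype.card_fin]
    have h : I.graph.degree u ≤ _ := this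
    refine lt_of_lt_of_le (Nat.lt_succ_of_le h) ?_
    convert hk
  refine ⟨⟨SimpleGraph.Coloring.mk (fun e => f e) ?_, T, hle, hT⟩⟩
  rintro ⟨e, he⟩ ⟨e', he'⟩ hee
  rw [SimpleGraph.lineGraph_adj_iff_exists] at hee
  obtain ⟨hne, x, hx, hx'⟩ := hee
  obtain ⟨a, rfl⟩ := Sym2.mem_iff_exists.1 hx
  obtain ⟨b, rfl⟩ := Sym2.mem_iff_exists.1 hx'
  refine hf x a b ?_ he he'
  rintro rfl
  exact hne rfl

end ReloadCost

theorem mainTheorem1 (c₁ c₂ : ℕ) :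
    ReloadCost.SolvableInPolyTime ReloadCost.Solution.changeoverCost
      (ReloadCost.SparseBlocks c₁ c₂) ∧
    ReloadCost.SolvableInPolyTime ReloadCost.Solution.reloadCost
      (ReloadCost.SparseBlocks c₁ c₂) :=
  ⟨ReloadCost.solvable_of_cost c₁ c₂ _ (ReloadCost.PolyTime.const_nat 1)
      ReloadCost.Describes.itemCost_eq_changeoverCost ReloadCost.nonempty_solution,
    ReloadCost.solvable_of_cost c₁ c₂ _ ReloadCost.PolyTime.id
      ReloadCost.Describes.itemCost_eq_reloadCost ReloadCost.nonempty_solution⟩
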